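/- Let $k$ be a field of characteristic zero, let $G$ be a pro-algebraic group (affine group scheme) over $k$, and let $\mathrm{Rep}(G)$ be the tensor category of finite-dimensional representations of $G$ over $k$. **DGAs.** A (real) DGA over $\mathrm{Rep}(G)$ is an additive functor $A$ from $\mathrm{Rep}(G)$ to complexes of real vector spaces in degrees $\ge 0$, with morphisms of complexes $\mu_{UV}\colon A(U)\otimes A(V)\to A(U\otimes V)$, natural in $U,V$, associative, and commutative for the sign rule $u\otimes v\mapsto(-1)^{ij}v\otimes u$ ($u$ of degree $i$, $v$ of degree $j$); the differential of the tensor product is $d(u\otimes v)=du\otimes v+(-1)^i u\otimes dv$. A morphism of DGAs is a natural transformation compatible with the multiplications. $A$ is flat if it sends short exact sequences of representations to short exact sequences of complexes. $\mathrm{H}^i(A)$ is the functor $V\mapsto \mathrm{H}^i(A(V))$; a map $\mathrm{H}^i(\phi)$ is called injective, surjective or bijective if it is so for every $V\in\mathrm{Rep}(G)$. **Deformations.** Let $\mathcal N(G)$ be the category of finite-dimensional nilpotent Lie algebras over $k$ with a representation of $G$ by Lie algebra automorphisms; morphisms are the $G$-equivariant Lie algebra homomorphisms. For $N\in\mathcal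 N(G)$, $A(N)$ is a differential graded Lie algebra with bracket $A(N)\otimes A(N)\xrightarrow{\mu}A(N\otimes N)\xrightarrow{A([\,,])}A(N)$. Put $$\mathrm{MC}_A(N)=\{x\in A(N)^1 \mid dx+\tfrac12[x,x]=0\},\qquad \mathrm{G}_A(N)=\exp(A(N)^0),$$ where the group $\exp$ of a nilpotent Lie algebra has the Campbell–Baker–Hausdorff product. $\mathrm{G}_A(N)$ acts on $\mathrm{MC}_A(N)$ by the gauge action $\alpha(x)=\mathrm{ad}_\alpha(x+d)-d$, where $\mathrm{ad}_\alpha$ is the exponentiated adjoint action on $A(N)^1\oplus\mathbb R d$ and $[d,a]=da$. Put $\mathrm{Def}_A=\mathrm{MC}_A/\mathrm{G}_A\colon\mathcal N(G)\to\mathrm{Set}$, and let $\mathfrak{Def}_A(N)$ be the groupoid with object set $\mathrm{MC}_A(N)$ whose morphisms $x\to y$ are the $\alpha\in\mathrm{G}_A(N)$ with $\alpha(x)=y$. **Étale.** A natural transformation $F\to E$ of functors $\mathcal N(G)\to\mathrm{Set}$ is étale if (unramified) $F(V\epsilon)\to E(V\epsilon)$ is injective for every irreducible representation $V$, where $V\epsilon$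 is $V$ regarded as an abelian Lie algebra, and (smooth) $F(M)\to E(M)\times_{E(N)}F(N)$ is surjective for every surjection $M\to N$ in $\mathcal N(G)$. **Theorem.** Let $\phi\colon A\to B$ be a morphism of flat DGAs over $\mathrm{Rep}(G)$. 1. If $\mathrm{H}^1(\phi)$ is bijective and $\mathrm{H}^2(\phi)$ is injective, then $\mathrm{Def}_A\to\mathrm{Def}_B$ is étale. 2. If in addition $\mathrm{H}^0(\phi)$ is surjective, then $\mathrm{Def}_A\to\mathrm{Def}_B$ is an isomorphism of functors. 3. If $\mathrm{H}^1(\phi)$ is bijective and $\mathrm{H}^2(\phi)$ is injective, then $\mathfrak{Def}_A\to\mathfrak{Def}_B$ is an equivalence of functors of groupoids (that is, $\mathfrak{Def}_A(N)\to\mathfrak{Def}_B(N)$ is an equivalence of groupoids for every $N\in\mathcal N(G)$) if and only if $\mathrm{H}^0(\phi)$ is an isomorphism. -/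

import Mathlib

section TwistedDeformations
open CategoryTheory TensorProduct Polynomial
universe w v₁ u₁ u v

section NilpotentGroups
open scoped Nat

namespace Malcev

section Curves
variable {V : Type*} [AddCommGroup V] [Module ℚ V]

/-- Antiderivative of a polynomial, vanishing at `0`. -/
noncomputable def integ : ℚ[X] →ₗ[ℚ] ℚ[X] :=
  Polynomial.lsum fun n => ((n + 1 : ℚ)⁻¹) • Polynomial.monomial (n + 1)

lemma integ_monomial (n : ℕ) (a : ℚ) :
    integ (monomial n a) = monomial (n + 1) ((n + 1 : ℚ)⁻¹ * a) := by
  simp [integ, Polynomial.lsum_apply, Polynomial.sum_monomial_index, smul_monomial]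

lemma derivative_integ (p : ℚ[X]) : derivative (integ p) = p := by
  induction p using Polynomial.induction_on' with
  | add p q hp hq => simp [hp, hq]
  | monomial n a =>
    rw [integ_monomial, derivative_monomial]
    have : (n + 1 : ℚ) ≠ 0 := by positivity
    congr 1
    push_cast
    field_simp

lemma integ_derivative (p : ℚ[X]) : integ (derivative p) = p - C (p.eval 0) := by
  induction p using Polynomial.induction_on' with
  | add p q hp hq => simp [hp, hq]; ring
  | monomial n a =>
    cases n with
    | zero => simp
    | succ n =>
      rw [derivative_monomial, Nat.add_sub_cancel, integ_monomial]
      have : (n + 1 : ℚ) ≠ 0 := by positivity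
      simp only [eval_monomial, ne_eq, Nat.add_eq_zero_iff, one_ne_zero, and_false,
        not_false_eq_true, zero_pow, mul_zero, map_zero, sub_zero]
      congr 1
      push_cast
      field_simp

lemma eval_integ (p : ℚ[X]) : (integ p).eval 0 = 0 := by
  induction p using Polynomial.induction_on' with
  | add p q hp hq => simp [hp, hq]
  | monomial n a => simp [integ_monomial]

variable (V) in
/-- Polynomial curves `t ↦ ∑ tⁿ vₙ` in a rational vector space. -/
def Curve : Type _ := ℚ[X] ⊗[ℚ] V

noncomputable instance : AddCommGroup (Curve V) := inferInstanceAs (AddCommGroup (ℚ[X] ⊗[ℚ] V))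
noncomputable instance : Module ℚ (Curve V) := inferInstanceAs (Module ℚ (ℚ[X] ⊗[ℚ] V))

/-- The curve `t ↦ p(t) v`. -/
noncomputable def cmk : ℚ[X] →ₗ[ℚ] V →ₗ[ℚ] Curve V := TensorProduct.mk ℚ ℚ[X] V

lemma Curve.induction {P : Curve V → Prop} (w : Curve V) (zero : P 0)
    (mk : ∀ p v, P (cmk p v)) (add : ∀ a b, P a → P b → P (a + b)) : P w :=
  TensorProduct.induction_on w zero mk add

/-- Derivative of a polynomial curve. -/
noncomputable def cD : Curve V →ₗ[ℚ] Curve V := LinearMap.rTensor V derivative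
/-- Antiderivative of a polynomial curve. -/
noncomputable def cI : Curve V →ₗ[ℚ] Curve V := LinearMap.rTensor V integ
/-- Value of a polynomial curve at a rational point. -/
noncomputable def cEv (c : ℚ) : Curve V →ₗ[ℚ] V :=
  (TensorProduct.lid ℚ V).toLinearMap ∘ₗ LinearMap.rTensor V (Polynomial.leval c)

@[simp] lemma cD_mk (p : ℚ[X]) (v : V) : cD (cmk p v) = cmk (derivative p) v := rfl
@[simp] lemma cI_mk (p : ℚ[X]) (v : V) : cI (cmk p v) = cmk (integ p) v := rfl
@[simp] lemma cEv_mk (c : ℚ) (p : ℚ[X]) (v : V) : cEv c (cmk p v) = p.eval c • v := rfl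

lemma cD_cI (w : Curve V) : cD (cI w) = w := by
  induction w using Curve.induction with
  | zero => simp
  | mk p v => simp [derivative_integ]
  | add a b ha hb => simp [ha, hb]

lemma cI_cD (w : Curve V) : cI (cD w) = w - cmk 1 (cEv 0 w) := by
  induction w using Curve.induction with
  | zero => simp
  | mk p v =>
    simp only [cD_mk, cI_mk, integ_derivative, map_sub, LinearMap.sub_apply, cEv_mk, map_smul]
    rw [← mul_one (C _), ← smul_eq_C_mul, map_smul, LinearMap.smul_apply]
  | add a b ha hb => simp only [map_add, ha, hb]; abel

lemma cEv_cI (w : Curve V) : cEv 0 (cI w) = 0 := by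
  induction w using Curve.induction with
  | zero => simp
  | mk p v => simp [eval_integ]
  | add a b ha hb => simp [ha, hb]

/-- The curves that lie in a subspace. -/
noncomputable def curveIn (S : Submodule ℚ V) : Submodule ℚ (Curve V) :=
  Submodule.span ℚ {w | ∃ p, ∃ v ∈ S, w = cmk p v}

lemma cmk_mem {S : Submodule ℚ V} (p : ℚ[X]) {v : V} (h : v ∈ S) : cmk p v ∈ curveIn S :=
  Submodule.subset_span ⟨p, v, h, rfl⟩

lemma cD_mem {S : Submodule ℚ V} {w : Curve V} (h : w ∈ curveIn S) : cD w ∈ curveIn S := by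
  refine (Submodule.span_le (p := (curveIn S).comap cD)).mpr ?_ h
  rintro _ ⟨p, v, hv, rfl⟩
  exact cmk_mem _ hv

lemma cI_mem {S : Submodule ℚ V} {w : Curve V} (h : w ∈ curveIn S) : cI w ∈ curveIn S := by
  refine (Submodule.span_le (p := (curveIn S).comap cI)).mpr ?_ h
  rintro _ ⟨p, v, hv, rfl⟩
  exact cmk_mem _ hv

lemma curveIn_mono {S T : Submodule ℚ V} (h : S ≤ T) : curveIn S ≤ curveIn T := by
  refine Submodule.span_mono ?_
  rintro _ ⟨p, v, hv, rfl⟩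
  exact ⟨p, v, h hv, rfl⟩

lemma mem_curveIn_top (w : Curve V) : w ∈ curveIn (⊤ : Submodule ℚ V) := by
  induction w using Curve.induction with
  | zero => exact zero_mem _
  | mk p v => exact cmk_mem _ trivial
  | add a b ha hb => exact add_mem ha hb

lemma eq_zero_of_mem_curveIn_bot {w : Curve V} (h : w ∈ curveIn (⊥ : Submodule ℚ V)) : w = 0 := by
  refine (Submodule.span_le (p := ⊥)).mpr ?_ h
  rintro _ ⟨p, v, hv, rfl⟩
  rw [(Submodule.mem_bot ℚ).mp hv]
  simp

end Curves

section ODE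
variable {L : Type*} [LieRing L] [LieAlgebra ℚ L]
variable {M : Type*} [AddCommGroup M] [Module ℚ M] [LieRingModule L M] [LieModule ℚ L M]

/-- The pointwise bracket of curves. -/
noncomputable def cBr : Curve L →ₗ[ℚ] Curve M →ₗ[ℚ] Curve M :=
  TensorProduct.map₂ (LinearMap.mul ℚ ℚ[X]) 
    (LinearMap.mk₂ ℚ (fun (x : L) (m : M) => ⁅x, m⁆) add_lie smul_lie lie_add lie_smul)

lemma cBr_mk (p q : ℚ[X]) (x : L) (m : M) :
    cBr (cmk p x) (cmk q m) = cmk (p * q) ⁅x, m⁆ := rfl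

lemma cBr_leibniz (a b : Curve L) (m : Curve M) :
    cBr a (cBr b m) = cBr (cBr a b) m + cBr b (cBr a m) := by
  induction a using Curve.induction with
  | zero => simp
  | add a a' h h' => simp only [map_add, LinearMap.add_apply, h, h']; abel
  | mk p x =>
    induction b using Curve.induction with
    | zero => simp
    | add a a' h h' => simp only [map_add, LinearMap.add_apply, h, h']; abel
    | mk q y =>
      induction m using Curve.induction with
      | zero => simp
      | add a a' h h' => simp only [map_add, h, h']; abel
      | mk r m =>
        simp only [cBr_mk]
        rw [leibniz_lie, map_add, mul_assoc, mul_left_comm q p r]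

lemma cBr_skew (a b : Curve L) : cBr a b = - cBr b a := by
  induction a using Curve.induction with
  | zero => simp
  | add a a' h h' => simp only [map_add, LinearMap.add_apply, h, h']; abel
  | mk p x =>
    induction b using Curve.induction with
    | zero => simp
    | add a a' h h' => simp only [map_add, LinearMap.add_apply, h, h']; abel
    | mk q y => rw [cBr_mk, cBr_mk, ← lie_skew, map_neg, mul_comm]

noncomputable instance : LieRing (Curve L) where
  bracket a b := cBr a b
  add_lie a b c := by simp
  lie_add a b c := by simp
  lie_self a := by
    have h : (2 : ℚ) • cBr a a = 0 := by
      rw [two_smul]; nth_rewrite 1 [cBr_skew a a]; exact neg_add_cancel _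
    exact (smul_eq_zero.mp h).resolve_left two_ne_zero
  leibniz_lie := cBr_leibniz

noncomputable instance : LieAlgebra ℚ (Curve L) where
  lie_smul t a b := map_smul (cBr a) t b

noncomputable instance : LieRingModule (Curve L) (Curve M) where
  bracket a b := cBr a b
  add_lie a b c := by simp
  lie_add a b c := by simp
  leibniz_lie := cBr_leibniz

noncomputable instance : LieModule ℚ (Curve L) (Curve M) where
  smul_lie t a b := by change cBr (t • a) b = t • cBr a b; simp
  lie_smul t a b := map_smul (cBr a) t b

@[simp] lemma lie_cmk (p q : ℚ[X]) (x : L) (m : M) :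
    ⁅cmk p x, cmk q m⁆ = cmk (p * q) ⁅x, m⁆ := rfl

lemma cD_lie (a : Curve L) (b : Curve M) : cD ⁅a, b⁆ = ⁅cD a, b⁆ + ⁅a, cD b⁆ := by
  induction a using Curve.induction with
  | zero => simp
  | add a a' h h' => simp only [add_lie, map_add, h, h']; abel
  | mk p x =>
    induction b using Curve.induction with
    | zero => simp
    | add a a' h h' => simp only [lie_add, map_add, h, h']; abel
    | mk q y => simp

lemma cEv_lie (c : ℚ) (a : Curve L) (b : Curve M) : cEv c ⁅a, b⁆ = ⁅cEv c a, cEv c b⁆ := by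
  induction a using Curve.induction with
  | zero => simp
  | add a a' h h' => simp only [add_lie, map_add, h, h']
  | mk p x =>
    induction b using Curve.induction with
    | zero => simp
    | add a a' h h' => simp only [lie_add, map_add, h, h']
    | mk q y => simp [smul_smul, mul_comm]

variable (L M) in
/-- The filtration of the curves by the lower central series. -/
noncomputable def lcsF (m : ℕ) : Submodule ℚ (Curve M) :=
  curveIn (LieModule.lowerCentralSeries ℚ L M m).toSubmodule

lemma lie_mem_lcsF {m : ℕ} (a : Curve L) {b : Curve M} (hb : b ∈ lcsF L M m) :
    ⁅a, b⁆ ∈ lcsF L M (m + 1) := by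
  induction a using Curve.induction with
  | zero => simp
  | add a a' h h' => rw [add_lie]; exact add_mem h h'
  | mk p x =>
    refine (Submodule.span_le (p := (lcsF L M (m + 1)).comap (cBr (cmk p x)))).mpr ?_ hb
    rintro _ ⟨q, v, hv, rfl⟩
    refine cmk_mem _ ?_
    change ⁅x, v⁆ ∈ LieModule.lowerCentralSeries ℚ L M (m + 1)
    rw [LieModule.lowerCentralSeries_succ]
    exact LieSubmodule.lie_mem_lie (LieSubmodule.mem_top x) hv

lemma lie_mem_lcsF' {m : ℕ} {a : Curve L} (ha : a ∈ lcsF L L m) (b : Curve L) :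
    ⁅a, b⁆ ∈ lcsF L L (m + 1) := by
  rw [← lie_skew]; exact neg_mem (lie_mem_lcsF b ha)

lemma lcsF_succ_le (m : ℕ) : lcsF L M (m + 1) ≤ lcsF L M m :=
  curveIn_mono (LieModule.antitone_lowerCentralSeries ℚ L M (Nat.le_succ m))

lemma lcsF_zero (a : Curve M) : a ∈ lcsF L M 0 := by
  have : (LieModule.lowerCentralSeries ℚ L M 0).toSubmodule = ⊤ := by simp
  rw [lcsF, this]
  exact mem_curveIn_top a

variable (L M) in
lemma exists_lcsF_eq_zero [LieModule.IsNilpotent L M] :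
    ∃ m, ∀ a ∈ lcsF L M m, a = 0 := by
  obtain ⟨m, hm⟩ := LieModule.IsNilpotent.nilpotent ℚ L M
  refine ⟨m, fun a ha => ?_⟩
  rw [lcsF, hm] at ha
  exact eq_zero_of_mem_curveIn_bot ha

variable (L M) in
lemma exists_toEnd_curve_pow [LieModule.IsNilpotent L M] :
    ∃ m, ∀ Z : Curve L, LieModule.toEnd ℚ (Curve L) (Curve M) Z ^ m = 0 := by
  obtain ⟨m, hm⟩ := exists_lcsF_eq_zero L M
  refine ⟨m, fun Z => LinearMap.ext fun w => hm _ ?_⟩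
  induction m with
  | zero => exact lcsF_zero _
  | succ n ih =>
    clear ih hm
    have : ∀ n, (LieModule.toEnd ℚ (Curve L) (Curve M) Z ^ n) w ∈ lcsF L M n := by
      intro n
      induction n with
      | zero => exact lcsF_zero _
      | succ n ih => rw [pow_succ']; exact lie_mem_lcsF Z ih
    exact this _

/-- The terms `1 ≤ n ≤ N` of the logarithmic derivative
`∑ (-1) ^ n / (n + 1)! (ad Z) ^ n (dZ / dt)` of a curve. -/
noncomputable def dlogTail (N : ℕ) (Z : Curve L) : Curve L :=
  ∑ n ∈ Finset.range N, ((-1) ^ (n + 1) * ((n + 2)! : ℚ)⁻¹) •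
    (LieAlgebra.ad ℚ (Curve L) Z ^ (n + 1)) (cD Z)

lemma dlogTail_contract (N m : ℕ) {Z Z' : Curve L} (h : Z - Z' ∈ lcsF L L m) :
    dlogTail N Z - dlogTail N Z' ∈ lcsF L L (m + 1) := by
  let T : Curve L → ℕ → Curve L := fun Z n => (LieAlgebra.ad ℚ (Curve L) Z ^ n) (cD Z)
  have hT : ∀ Z n, T Z (n + 1) = ⁅Z, T Z n⁆ := fun Z n => by simp only [T, pow_succ']; rfl
  have step : ∀ n, T Z n - T Z' n ∈ lcsF L L m → T Z (n + 1) - T Z' (n + 1) ∈ lcsF L L (m+1) := by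
    intro n hn
    have e : T Z (n + 1) - T Z' (n + 1) = ⁅Z, T Z n - T Z' n⁆ + ⁅Z - Z', T Z' n⁆ := by
      rw [hT, hT, lie_sub, sub_lie]; abel
    rw [e]
    exact add_mem (lie_mem_lcsF _ hn) (lie_mem_lcsF' h _)
  have key : ∀ n, T Z n - T Z' n ∈ lcsF L L m := by
    intro n
    induction n with
    | zero =>
      have := cD_mem h
      rwa [map_sub] at this
    | succ n ih => exact lcsF_succ_le m (step n ih)
  unfold dlogTail
  rw [← Finset.sum_sub_distrib]
  refine sum_mem fun n _ => ?_
  have := Submodule.smul_mem _ ((-1) ^ (n + 1) * ((n + 2)! : ℚ)⁻¹) (step n (key n))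
  rwa [smul_sub] at this

/-- `Z` is the curve `t ↦ log (exp x * exp (t y))`: it starts at `x`, and its logarithmic
derivative `(1 - exp (- ad Z)) / ad Z (dZ / dt)` is the constant `y`. -/
def IsBCHCurve (x y : L) (Z : Curve L) : Prop :=
  cEv 0 Z = x ∧ ∃ N₀, ∀ N ≥ N₀, cD Z + dlogTail N Z = cmk 1 y

lemma dlogTail_stable [LieRing.IsNilpotent L] :
    ∃ N₀, ∀ N ≥ N₀, ∀ Z : Curve L, dlogTail N Z = dlogTail N₀ Z := by
  obtain ⟨c, hc⟩ := exists_toEnd_curve_pow L L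
  refine ⟨c, fun N hN Z => ?_⟩
  unfold dlogTail
  symm
  refine Finset.sum_subset (by simpa using hN) fun n _ hn => ?_
  have h0 : LieAlgebra.ad ℚ (Curve L) Z ^ (n + 1) = 0 :=
    pow_eq_zero_of_le (by simp only [Finset.mem_range] at hn; omega) (hc Z)
  rw [h0]; simp

lemma exists_isBCHCurve [LieRing.IsNilpotent L] (x y : L) :
    ∃ Z : Curve L, IsBCHCurve x y Z := by
  obtain ⟨N, hN⟩ := dlogTail_stable (L := L)
  obtain ⟨m, hm⟩ := exists_lcsF_eq_zero L L
  let P : Curve L → Curve L := fun Z => cmk 1 x + cI (cmk 1 y - dlogTail N Z)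
  have hP : ∀ k, P^[k + 1] 0 - P^[k] 0 ∈ lcsF L L k := by
    intro k
    induction k with
    | zero => exact lcsF_zero _
    | succ k ih =>
      rw [Function.iterate_succ_apply' P (k + 1), Function.iterate_succ_apply' P k]
      rw [Function.iterate_succ_apply' P k] at ih
      have := cI_mem (neg_mem (dlogTail_contract N k ih))
      refine (congrArg (· ∈ lcsF L L (k + 1)) ?_).mp this
      simp only [P, map_sub, map_neg]
      abel
  have hfix := hm _ (hP m)
  rw [Function.iterate_succ_apply', sub_eq_zero] at hfix
  refine ⟨P^[m] 0, ?_, N, fun N' hN' => ?_⟩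
  · rw [← hfix]; simp only [P, map_add, cEv_cI, cEv_mk, eval_one, one_smul, add_zero]
  · rw [hN _ hN']
    conv_lhs => enter [1]; rw [← hfix]
    simp only [P, map_add, cD_cI, cD_mk, derivative_one, map_zero, LinearMap.zero_apply, zero_add]
    abel

lemma IsBCHCurve.unique [LieRing.IsNilpotent L] {Z Z' : Curve L}
    (h0 : cEv 0 Z = cEv 0 Z') {N : ℕ} (h : cD Z + dlogTail N Z = cD Z' + dlogTail N Z') :
    Z = Z' := by
  obtain ⟨m, hm⟩ := exists_lcsF_eq_zero L L
  have key : ∀ k, Z - Z' ∈ lcsF L L k := by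
    intro k
    induction k with
    | zero => exact lcsF_zero _
    | succ k ih =>
      have h1 : cD (Z - Z') ∈ lcsF L L (k + 1) := by
        have := neg_mem (dlogTail_contract N k ih)
        refine (congrArg (· ∈ lcsF L L (k + 1)) ?_).mp this
        rw [map_sub, neg_sub, sub_eq_sub_iff_add_eq_add, add_comm, ← h, add_comm]
      have h2 := cI_mem h1
      rwa [cI_cD, map_sub, h0, sub_self, map_zero, sub_zero] at h2
  exact sub_eq_zero.mp (hm _ (key m))

/-- The curve `t ↦ log (exp x * exp (t y))` in a nilpotent Lie algebra. -/
noncomputable def bchCurve [LieRing.IsNilpotent L] (x y : L) : Curve L :=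
  (exists_isBCHCurve x y).choose

/-- The Campbell–Baker–Hausdorff product `log (exp x * exp y) = x + y + [x, y] / 2 + …`, the
value at `t = 1` of the curve `log (exp x * exp (t y))`. The lemma `expAct_bch` below shows that
`exp (bch x y) = exp x * exp y` in each nilpotent action. -/
noncomputable def bch [LieRing.IsNilpotent L] (x y : L) : L := cEv 1 (bchCurve x y)

lemma bch_eq [LieRing.IsNilpotent L] {x y : L} {Z : Curve L} (hZ : IsBCHCurve x y Z) :
    bch x y = cEv 1 Z := by
  obtain ⟨h0, N, hN⟩ := hZ
  obtain ⟨h0', N', hN'⟩ := (exists_isBCHCurve x y).choose_spec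
  unfold bch
  congr 1
  refine IsBCHCurve.unique (N := max N N') (h0'.trans h0.symm) ?_
  rw [hN _ (le_max_left _ _)]
  exact hN' _ (le_max_right _ _)

lemma map_bch {L' : Type*} [LieRing L'] [LieAlgebra ℚ L'] [LieRing.IsNilpotent L]
    [LieRing.IsNilpotent L'] (f : L →ₗ⁅ℚ⁆ L') (x y : L) : f (bch x y) = bch (f x) (f y) := by
  let F : Curve L →ₗ[ℚ] Curve L' := LinearMap.lTensor ℚ[X] (f : L →ₗ[ℚ] L')
  have hF : ∀ p x, F (cmk p x) = cmk p (f x) := fun _ _ => rfl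
  have hFl : ∀ a b, F ⁅a, b⁆ = ⁅F a, F b⁆ := by
    intro a b
    induction a using Curve.induction with
    | zero => simp
    | add a a' h h' => simp only [add_lie, map_add, h, h']
    | mk p x =>
      induction b using Curve.induction with
      | zero => simp
      | add a a' h h' => simp only [lie_add, map_add, h, h']
      | mk q y => simp [hF]
  have hev : ∀ c w, cEv c (F w) = f (cEv c w) := by
    intro c w
    induction w using Curve.induction with
    | zero => simp
    | add a b ha hb => simp [ha, hb]
    | mk p x => simp [hF]
  have hD : ∀ w, cD (F w) = F (cD w) := by
    intro w
    induction w using Curve.induction with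
    | zero => simp
    | add a b ha hb => simp [ha, hb]
    | mk p x => simp [hF]
  have had : ∀ Z n w, (LieAlgebra.ad ℚ (Curve L') (F Z) ^ n) (F w) =
      F ((LieAlgebra.ad ℚ (Curve L) Z ^ n) w) := by
    intro Z n w
    induction n with
    | zero => simp
    | succ n ih => simp [pow_succ', ih, hFl]
  obtain ⟨h0, N, hN⟩ := (exists_isBCHCurve x y).choose_spec
  have : IsBCHCurve (f x) (f y) (F (bchCurve x y)) := by
    refine ⟨by rw [hev]; exact congrArg f h0, N, fun N' hN' => ?_⟩
    have := congrArg F (hN N' hN')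
    rw [map_add, hF] at this
    rw [← this, hD]
    simp only [dlogTail, hD, had, map_sum, map_smul]
    rfl
  rw [bch_eq this, hev, bch]

end ODE
end Malcev
namespace Malcev
section Exp
open IsNilpotent

/-- The commutator `a ↦ z a - a z` in an associative algebra. -/
noncomputable def commu {P : Type*} [Ring P] [Algebra ℚ P] (z : P) : Module.End ℚ P :=
  LinearMap.mulLeft ℚ z - LinearMap.mulRight ℚ z

lemma commu_apply {P : Type*} [Ring P] [Algebra ℚ P] (z a : P) : commu z a = z * a - a * z := rfl

lemma exp_neg_mul_mul_exp {P : Type*} [Ring P] [Algebra ℚ P] {z : P} (hz : IsNilpotent z) (d : P) :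
    ∃ N₀, ∀ N ≥ N₀, exp (-z) * d * exp z =
      ∑ n ∈ Finset.range N, ((-1) ^ n * (n ! : ℚ)⁻¹) • (commu z ^ n) d := by
  obtain ⟨k, hk⟩ := hz
  let l := LinearMap.mulLeft ℚ (-z)
  let r := LinearMap.mulRight ℚ z
  have hl : l ^ k = 0 := by rw [LinearMap.pow_mulLeft, neg_pow, hk]; simp
  have hr : r ^ k = 0 := by rw [LinearMap.pow_mulRight, hk]; simp
  have hlr : Commute l r := by
    ext a; simp [l, r, mul_assoc]
  have e1 : exp (-z) * d * exp z = exp (l + r) d := by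
    rw [exp_add_of_commute hlr ⟨k, hl⟩ ⟨k, hr⟩, exp_eq_sum hl, exp_eq_sum hr,
      exp_eq_sum hk, exp_eq_sum (show (-z) ^ k = 0 by rw [neg_pow, hk, mul_zero])]
    simp [l, r, LinearMap.pow_mulLeft, LinearMap.pow_mulRight, Finset.sum_mul, Finset.mul_sum,
      mul_assoc]
  obtain ⟨m, hm⟩ := hlr.isNilpotent_add ⟨k, hl⟩ ⟨k, hr⟩
  have e2 : l + r = - commu z := by
    ext a; simp [l, r, commu_apply]; abel
  refine ⟨m, fun N hN => ?_⟩
  rw [e1, exp_eq_sum (pow_eq_zero_of_le hN hm), e2, LinearMap.sum_apply]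
  refine Finset.sum_congr rfl fun n _ => ?_
  rw [show -commu z = (-1 : ℚ) • commu z from (neg_one_smul ℚ _).symm, _root_.smul_pow, LinearMap.smul_apply,
    LinearMap.smul_apply, smul_smul, mul_comm]

variable {L : Type*} [LieRing L] [LieAlgebra ℚ L]
variable {M : Type*} [AddCommGroup M] [Module ℚ M] [LieRingModule L M] [LieModule ℚ L M]

variable (M) in
/-- The exponential of the action of an element on a nilpotent module. -/
noncomputable def expAct (x : L) : Module.End ℚ M := exp (LieModule.toEnd ℚ L M x)

lemma cD_expAct [LieModule.IsNilpotent L M] (Z : Curve L) :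
    ∃ N₀, ∀ N ≥ N₀, ∀ w : Curve M, cD (exp (LieModule.toEnd ℚ (Curve L) (Curve M) Z) w) =
      exp (LieModule.toEnd ℚ (Curve L) (Curve M) Z) (cD w + ⁅cD Z + dlogTail N Z, w⁆) := by
  obtain ⟨m, hm⟩ := exists_toEnd_curve_pow L M
  let ρ := LieModule.toEnd ℚ (Curve L) (Curve M)
  have hn : IsNilpotent (ρ Z) := ⟨m, hm Z⟩
  obtain ⟨N₀, hN₀⟩ := exp_neg_mul_mul_exp hn (cD : Module.End ℚ (Curve M))
  refine ⟨N₀, fun N hN w => ?_⟩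
  have hρ : ∀ a b : Curve L, ρ ⁅a, b⁆ = ρ a * ρ b - ρ b * ρ a := by
    intro a b
    ext w
    simp [ρ]
  have had : ∀ n, (commu (ρ Z) ^ (n + 1)) (cD : Module.End ℚ (Curve M)) =
      - ρ ((LieAlgebra.ad ℚ (Curve L) Z ^ n) (cD Z)) := by
    intro n
    induction n with
    | zero =>
      ext w
      simp [ρ, commu_apply, cD_lie]
    | succ n ih =>
      rw [pow_succ', Module.End.mul_apply, ih, pow_succ' _ n, Module.End.mul_apply,
        LieAlgebra.ad_apply, hρ, commu_apply, mul_neg, neg_mul, sub_neg_eq_add,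
        neg_add_eq_sub, neg_sub]
  have h := hN₀ (N + 2) (by omega)
  have h2 : exp (-ρ Z) * (cD : Module.End ℚ (Curve M)) * exp (ρ Z) =
      cD + ρ (cD Z + dlogTail N Z) := by
    rw [h, Finset.sum_range_succ', Finset.sum_range_succ']
    simp only [had, dlogTail, map_add, map_sum, map_smul]
    simp only [pow_zero, Nat.factorial, Module.End.one_apply]
    have : ∀ n, ((-1 : ℚ) ^ (n + 1 + 1) * (((n + 1).succ * ((n).succ * n !) : ℕ) : ℚ)⁻¹) •
        -ρ ((LieAlgebra.ad ℚ (Curve L) Z ^ (n + 1)) (cD Z)) =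
        ((-1 : ℚ) ^ (n + 1) * (((n + 1).succ * ((n).succ * n !) : ℕ) : ℚ)⁻¹) •
        ρ ((LieAlgebra.ad ℚ (Curve L) Z ^ (n + 1)) (cD Z)) := by
      intro n; rw [smul_neg, ← neg_smul, _root_.pow_succ _ (n + 1)]; congr 1; ring
    rw [Finset.sum_congr rfl fun n _ => this n]
    simp
    abel
  have h3 : (cD : Module.End ℚ (Curve M)) * exp (ρ Z) =
      exp (ρ Z) * (cD + ρ (cD Z + dlogTail N Z)) := by
    rw [← h2, ← mul_assoc, ← mul_assoc, exp_mul_exp_neg_self hn, one_mul]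
  exact LinearMap.congr_fun h3 w

lemma cEv_exp [LieModule.IsNilpotent L M] (c : ℚ) (Z : Curve L) (w : Curve M) :
    cEv c (exp (LieModule.toEnd ℚ (Curve L) (Curve M) Z) w) = expAct M (cEv c Z) (cEv c w) := by
  obtain ⟨m, hm⟩ := exists_toEnd_curve_pow L M
  have := Module.End.commute_exp_left_of_commute (g := (cEv c : Curve M →ₗ[ℚ] M))
    ⟨m, hm Z⟩ (LieModule.isNilpotent_toEnd_of_isNilpotent ℚ L M (cEv c Z))
    (by ext w; simp [cEv_lie])
  exact (LinearMap.congr_fun this w).symm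

/-- The exponentials of a nilpotent action multiply by the Campbell–Baker–Hausdorff product. -/
theorem expAct_bch [LieRing.IsNilpotent L] [LieModule.IsNilpotent L M] (x y : L) :
    expAct M (bch x y) = expAct M x * expAct M y := by
  obtain ⟨h0, N, hN⟩ := (exists_isBCHCurve x y).choose_spec
  change cEv 0 (bchCurve x y) = x at h0
  change ∀ N' ≥ N, cD (bchCurve x y) + dlogTail N' (bchCurve x y) = cmk 1 y at hN
  set Z := bchCurve x y with hZ
  obtain ⟨Y, hYdef⟩ : ∃ Y : Curve L, Y = - cmk X y := ⟨_, rfl⟩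
  have hY : ∀ N, cD Y + dlogTail N Y = - cmk 1 y := by
    intro N
    have : dlogTail N Y = 0 := by
      refine Finset.sum_eq_zero fun n _ => ?_
      have h0 : LieAlgebra.ad ℚ (Curve L) Y (cD Y) = 0 := by simp [hYdef]
      rw [_root_.pow_succ (LieAlgebra.ad ℚ (Curve L) Y), Module.End.mul_apply, h0, map_zero, smul_zero]
    rw [this]; simp [hYdef]
  obtain ⟨N₁, h1⟩ := cD_expAct (M := M) Z
  obtain ⟨N₂, h2⟩ := cD_expAct (M := M) Y
  let F : Curve M → Curve M := fun w => exp (LieModule.toEnd ℚ (Curve L) (Curve M) Z)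
    (exp (LieModule.toEnd ℚ (Curve L) (Curve M) Y) w)
  have hc : ∀ w : Curve M, exp (LieModule.toEnd ℚ (Curve L) (Curve M) Y) ⁅cmk 1 y, w⁆ =
      ⁅cmk 1 y, exp (LieModule.toEnd ℚ (Curve L) (Curve M) Y) w⁆ := by
    intro w
    obtain ⟨m, hm⟩ := exists_toEnd_curve_pow L M
    have := Module.End.commute_exp_left_of_commute
      (g := LieModule.toEnd ℚ (Curve L) (Curve M) (cmk 1 y)) ⟨m, hm Y⟩ ⟨m, hm Y⟩ (by
        ext w
        have : ⁅Y, cmk 1 y⁆ = 0 := by simp [hYdef]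
        simp only [LinearMap.comp_apply, LieModule.toEnd_apply_apply]
        rw [leibniz_lie, this, zero_lie, zero_add])
    exact LinearMap.congr_fun this w
  have hF : ∀ w, cD (F w) = F (cD w) := by
    intro w
    simp only [F]
    rw [h1 (max N N₁) (le_max_right _ _), hN _ (le_max_left _ _), h2 N₂ le_rfl, hY,
      neg_lie]
    simp only [map_add, map_neg, hc]
    abel
  ext m
  let v := cmk 1 (expAct M y m)
  have hv : cD v = 0 := by simp [v]
  have hFv := cI_cD (F v)
  rw [hF, hv] at hFv
  have hF0 : F 0 = 0 := by simp [F]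
  rw [hF0, map_zero, eq_comm, sub_eq_zero] at hFv
  have e0 : cEv 0 (F v) = expAct M x (expAct M y m) := by
    simp only [F]
    rw [cEv_exp, cEv_exp, h0]
    simp [hYdef, v, expAct]
  have e1 : cEv 1 (F v) = expAct M (bch x y) m := by
    simp only [F]
    rw [cEv_exp, cEv_exp]
    have : expAct M (-y) (expAct M y m) = m := by
      have := exp_neg_mul_exp_self (LieModule.isNilpotent_toEnd_of_isNilpotent ℚ L M y)
      rw [← map_neg] at this
      exact LinearMap.congr_fun this m
    simp only [hYdef, v, map_neg, cEv_mk, eval_X, eval_one, one_smul, this]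
    rfl
  rw [← e1, hFv, cEv_mk, e0]
  simp

end Exp
end Malcev
namespace Malcev
section Group
open IsNilpotent
variable {L : Type*} [LieRing L] [LieAlgebra ℚ L]
variable {M : Type*} [AddCommGroup M] [Module ℚ M] [LieRingModule L M] [LieModule ℚ L M]

lemma isNilpotent_of_filtration (F : ℕ → Submodule ℚ M) (h0 : ∀ m, m ∈ F 0)
    (h : ∀ n (x : L), ∀ m ∈ F n, ⁅x, m⁆ ∈ F (n + 1)) {n : ℕ} (hn : ∀ m ∈ F n, m = 0) :
    LieModule.IsNilpotent L M := by
  have key : ∀ n, (LieModule.lowerCentralSeries ℚ L M n).toSubmodule ≤ F n := by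
    intro n
    induction n with
    | zero => exact fun m _ => h0 m
    | succ n ih =>
      rw [LieModule.lowerCentralSeries_succ, LieSubmodule.lieIdeal_oper_eq_linear_span',
        Submodule.span_le]
      rintro _ ⟨x, _, m, hm, rfl⟩
      exact h n x m (ih hm)
  refine (LieModule.isNilpotent_iff ℚ L M).mpr ⟨n, ?_⟩
  rw [eq_bot_iff]
  intro m hm
  simpa using hn m (key n hm)

instance [LieModule.IsNilpotent L M] : LieModule.IsNilpotent (Curve L) (Curve M) := by
  obtain ⟨m, hm⟩ := exists_lcsF_eq_zero L M
  exact isNilpotent_of_filtration (lcsF L M) lcsF_zero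
    (fun n x w hw => lie_mem_lcsF x hw) hm

section Ext
variable {S : Type*} [AddCommGroup S] [Module ℚ S]

/-- A linear family of `1`-cocycles of a Lie algebra with values in a module. -/
def IsCocycle (c : L →ₗ[ℚ] S →ₗ[ℚ] M) : Prop :=
  ∀ a b s, c ⁅a, b⁆ s = ⁅a, c b s⁆ - ⁅b, c a s⁆

/-- The extension `M ⊕ S` of a trivial module `S` by `M` given by a family of cocycles:
`⁅a, (m, s)⁆ = (⁅a, m⁆ + c a s, 0)`. -/
def CocycleExt {c : L →ₗ[ℚ] S →ₗ[ℚ] M} (_ : IsCocycle c) : Type _ := M × S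

variable {c : L →ₗ[ℚ] S →ₗ[ℚ] M} (hc : IsCocycle c)

instance : AddCommGroup (CocycleExt hc) := inferInstanceAs (AddCommGroup (M × S))
instance : Module ℚ (CocycleExt hc) := inferInstanceAs (Module ℚ (M × S))

variable {hc} in
/-- The element `m + s` of the extension. -/
def CocycleExt.mk (m : M) (s : S) : CocycleExt hc := (m, s)

@[simp] lemma CocycleExt.mk_fst (m : M) (s : S) : (mk m s : CocycleExt hc).1 = m := rfl
@[simp] lemma CocycleExt.mk_snd (m : M) (s : S) : (mk m s : CocycleExt hc).2 = s := rfl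

lemma CocycleExt.ext {v w : CocycleExt hc} (h1 : v.1 = w.1) (h2 : v.2 = w.2) : v = w :=
  Prod.ext h1 h2

@[simp] lemma CocycleExt.add_fst (v w : CocycleExt hc) : (v + w).1 = v.1 + w.1 := rfl
@[simp] lemma CocycleExt.add_snd (v w : CocycleExt hc) : (v + w).2 = v.2 + w.2 := rfl
@[simp] lemma CocycleExt.smul_fst (t : ℚ) (v : CocycleExt hc) : (t • v).1 = t • v.1 := rfl
@[simp] lemma CocycleExt.smul_snd (t : ℚ) (v : CocycleExt hc) : (t • v).2 = t • v.2 := rfl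

instance : LieRingModule L (CocycleExt hc) where
  bracket a w := (⁅a, w.1⁆ + c a w.2, 0)
  add_lie a b w := CocycleExt.ext hc (by
    change ⁅a + b, w.1⁆ + c (a + b) w.2 = (⁅a, w.1⁆ + c a w.2) + (⁅b, w.1⁆ + c b w.2)
    rw [add_lie, map_add, LinearMap.add_apply]; abel) (add_zero _).symm
  lie_add a v w := CocycleExt.ext hc (by
    change ⁅a, v.1 + w.1⁆ + c a (v.2 + w.2) = (⁅a, v.1⁆ + c a v.2) + (⁅a, w.1⁆ + c a w.2)
    rw [lie_add, map_add]; abel) (add_zero _).symm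
  leibniz_lie a b w := CocycleExt.ext hc (by
    change ⁅a, ⁅b, w.1⁆ + c b w.2⁆ + c a 0 =
      ⁅⁅a, b⁆, w.1⁆ + c ⁅a, b⁆ w.2 + (⁅b, ⁅a, w.1⁆ + c a w.2⁆ + c b 0)
    rw [hc, lie_add, lie_add, map_zero, map_zero, leibniz_lie]; abel) (add_zero _).symm

@[simp] lemma CocycleExt.lie_fst (a : L) (w : CocycleExt hc) : ⁅a, w⁆.1 = ⁅a, w.1⁆ + c a w.2 := rfl
@[simp] lemma CocycleExt.lie_snd (a : L) (w : CocycleExt hc) : ⁅a, w⁆.2 = 0 := rfl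

instance : LieModule ℚ L (CocycleExt hc) where
  smul_lie t a w := CocycleExt.ext hc (by simp) (by simp)
  lie_smul t a w := CocycleExt.ext hc (by simp) (by simp)

instance [LieModule.IsNilpotent L M] : LieModule.IsNilpotent L (CocycleExt hc) := by
  obtain ⟨k, hk⟩ := LieModule.IsNilpotent.nilpotent ℚ L M
  let F : ℕ → Submodule ℚ (CocycleExt hc) := fun n => Nat.casesOn n ⊤ fun n =>
    Submodule.prod (LieModule.lowerCentralSeries ℚ L M n).toSubmodule ⊥
  refine isNilpotent_of_filtration F (fun _ => trivial) (n := k + 1) ?_ ?_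
  · rintro (_ | n) x w hw
    · exact ⟨by simp, rfl⟩
    · obtain ⟨h1, h2⟩ := hw
      have h2' : w.2 = 0 := h2
      refine ⟨?_, rfl⟩
      change ⁅x, w.1⁆ + c x w.2 ∈ LieModule.lowerCentralSeries ℚ L M (n + 1)
      rw [h2', map_zero, add_zero, LieModule.lowerCentralSeries_succ]
      exact LieSubmodule.lie_mem_lie (LieSubmodule.mem_top x) h1
  · rintro w ⟨h1, h2⟩
    rw [hk] at h1
    exact CocycleExt.ext hc h1 h2

lemma expAct_cocycleExt_snd [LieModule.IsNilpotent L M] (a : L) (w : CocycleExt hc) :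
    (expAct (CocycleExt hc) a w).2 = w.2 := by
  obtain ⟨k, hk⟩ := LieModule.isNilpotent_toEnd_of_isNilpotent ℚ L (CocycleExt hc) a
  have key : ∀ n, ((LieModule.toEnd ℚ L (CocycleExt hc) a ^ (n + 1)) w).2 = 0 := by
    intro n; rw [_root_.pow_succ']; rfl
  have hs : ∀ (s : Finset ℕ) (f : ℕ → CocycleExt hc), (∑ i ∈ s, f i).2 = ∑ i ∈ s, (f i).2 :=
    fun s f => Prod.snd_sum
  rw [expAct, exp_eq_sum (pow_eq_zero_of_le (Nat.le_succ k) hk), LinearMap.sum_apply, hs,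
    Finset.sum_range_succ']
  simp [key]

end Ext

/-- Curves in a Lie algebra, extended by the derivation `d / dt`. -/
lemma isCocycle_cD : IsCocycle (L := Curve L) (M := Curve L)
    ((LinearMap.lsmul ℚ (Curve L)).flip ∘ₗ (cD : Curve L →ₗ[ℚ] Curve L)) := by
  intro a b s
  change s • cD ⁅a, b⁆ = ⁅a, s • cD b⁆ - ⁅b, s • cD a⁆
  rw [cD_lie, ← lie_skew b, lie_smul, smul_add, smul_lie, sub_neg_eq_add, add_comm]

lemma exp_curve_injective [LieRing.IsNilpotent L] {u v : Curve L} (h0 : cEv 0 u = cEv 0 v)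
    (h : expAct (CocycleExt (isCocycle_cD (L := L))) u =
      expAct (CocycleExt (isCocycle_cD (L := L))) v) : u = v := by
  let E := CocycleExt (isCocycle_cD (L := L))
  obtain ⟨N, hN⟩ := LieModule.exists_forall_pow_toEnd_eq_zero ℚ (Curve L) E
  have key : ∀ u : Curve L, (expAct E u (CocycleExt.mk 0 1)).1 =
      -(cD (-u) + dlogTail N (-u)) := by
    intro u
    have hpow : ∀ n, (LieModule.toEnd ℚ (Curve L) E u ^ (n + 1)) (CocycleExt.mk 0 1) =
        CocycleExt.mk ((LieAlgebra.ad ℚ (Curve L) u ^ n) (cD u)) 0 := by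
      intro n
      induction n with
      | zero =>
        refine CocycleExt.ext isCocycle_cD ?_ rfl
        change ⁅u, (0 : Curve L)⁆ + (1 : ℚ) • cD u = cD u
        simp
      | succ n ih =>
        rw [_root_.pow_succ', Module.End.mul_apply, ih]
        refine CocycleExt.ext isCocycle_cD ?_ rfl
        change ⁅u, (LieAlgebra.ad ℚ (Curve L) u ^ n) (cD u)⁆ + (0 : ℚ) • cD u = _
        rw [zero_smul, add_zero, _root_.pow_succ']; rfl
    have hs : ∀ (s : Finset ℕ) (f : ℕ → E), (∑ i ∈ s, f i).1 = ∑ i ∈ s, (f i).1 :=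
      fun s f => Prod.fst_sum
    have hd : dlogTail N (-u) = - ∑ n ∈ Finset.range N, ((n + 2)! : ℚ)⁻¹ •
        (LieAlgebra.ad ℚ (Curve L) u ^ (n + 1)) (cD u) := by
      rw [dlogTail, ← Finset.sum_neg_distrib]
      refine Finset.sum_congr rfl fun n _ => ?_
      rw [map_neg, map_neg, map_neg,
        show -LieAlgebra.ad ℚ (Curve L) u = (-1 : ℚ) • LieAlgebra.ad ℚ (Curve L) u from
          (neg_one_smul ℚ _).symm, _root_.smul_pow, LinearMap.smul_apply, smul_neg, smul_smul]
      congr 2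
      rw [mul_right_comm, ← mul_pow]; simp
    rw [expAct, exp_eq_sum (pow_eq_zero_of_le (show N ≤ N + 2 by omega) (hN u)),
      LinearMap.sum_apply, hs, Finset.sum_range_succ', Finset.sum_range_succ', hd]
    simp only [LinearMap.smul_apply, CocycleExt.smul_fst, hpow, map_neg, neg_add_rev, neg_neg]
    simp [E]
  have h1 : cD (-u) + dlogTail N (-u) = cD (-v) + dlogTail N (-v) := by
    rw [← neg_inj, ← key, ← key, h]
  exact neg_injective (IsBCHCurve.unique (by rw [map_neg, map_neg, h0]) h1)

/-- The value of a curve, as a homomorphism of Lie algebras. -/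
noncomputable def cEvHom (c : ℚ) : Curve L →ₗ⁅ℚ⁆ L :=
  { cEv c with map_lie' := fun {a b} => cEv_lie c a b }

lemma bch_zero_zero [LieRing.IsNilpotent L] : bch (0 : L) 0 = 0 := by
  have : IsBCHCurve (0 : L) 0 0 := ⟨map_zero _, 0, fun N _ => by simp [dlogTail]⟩
  rw [bch_eq this, map_zero]

lemma cEvHom_zero_X (a : L) : cEvHom 0 (cmk X a) = 0 := by
  change cEv 0 _ = _
  simp

lemma cEvHom_one_X (a : L) : cEvHom 1 (cmk X a) = a := by
  change cEv 1 _ = _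
  simp

variable [LieRing.IsNilpotent L]

lemma bch_assoc (a b c : L) : bch (bch a b) c = bch a (bch b c) := by
  have h : bch (bch (cmk X a) (cmk X b)) (cmk X c) = bch (cmk X a) (bch (cmk X b) (cmk X c)) := by
    apply exp_curve_injective
    · change cEvHom 0 _ = cEvHom 0 _
      simp only [map_bch, cEvHom_zero_X, bch_zero_zero]
    · simp only [expAct_bch, mul_assoc]
  have h' := congrArg (cEvHom 1) h
  simpa only [map_bch, cEvHom_one_X] using h'

lemma zero_bch (a : L) : bch 0 a = a := by
  have h : bch 0 (cmk X a) = cmk X a := by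
    apply exp_curve_injective
    · change cEvHom 0 _ = cEvHom 0 _
      simp only [map_bch, cEvHom_zero_X, map_zero, bch_zero_zero]
    · rw [expAct_bch]; simp [expAct]
  have h' := congrArg (cEvHom 1) h
  simpa only [map_bch, cEvHom_one_X, map_zero] using h'

lemma bch_zero (a : L) : bch a 0 = a := by
  have h : bch (cmk X a) 0 = cmk X a := by
    apply exp_curve_injective
    · change cEvHom 0 _ = cEvHom 0 _
      simp only [map_bch, cEvHom_zero_X, map_zero, bch_zero_zero]
    · rw [expAct_bch]; simp [expAct]
  have h' := congrArg (cEvHom 1) h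
  simpa only [map_bch, cEvHom_one_X, map_zero] using h'

lemma expAct_neg_mul {L M : Type*} [LieRing L] [LieAlgebra ℚ L] [AddCommGroup M] [Module ℚ M]
    [LieRingModule L M] [LieModule ℚ L M] [LieModule.IsNilpotent L M] (a : L) :
    expAct M (-a) * expAct M a = 1 := by
  rw [expAct, expAct, map_neg]
  exact exp_neg_mul_exp_self (LieModule.isNilpotent_toEnd_of_isNilpotent ℚ L M a)

lemma neg_bch (a : L) : bch (-a) a = 0 := by
  have h : bch (-cmk X a) (cmk X a) = 0 := by
    apply exp_curve_injective
    · change cEvHom 0 _ = cEvHom 0 _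
      simp only [map_bch, cEvHom_zero_X, map_zero, bch_zero_zero, map_neg, neg_zero]
    · rw [expAct_bch, expAct_neg_mul]; simp [expAct]
  have h' := congrArg (cEvHom 1) h
  simpa only [map_bch, cEvHom_one_X, map_zero, map_neg] using h'

end Group

/-- The group `exp(L)` of a nilpotent Lie algebra over a field of characteristic zero: its
underlying set is `L`, with the Campbell–Baker–Hausdorff product. -/
@[ext] structure ExpGroup (L : Type*) where
  /-- The logarithm of an element. -/
  log : L

noncomputable instance {L : Type*} [LieRing L] [LieAlgebra ℚ L] [LieRing.IsNilpotent L] :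
    Group (ExpGroup L) where
  mul a b := ⟨bch a.log b.log⟩
  one := ⟨0⟩
  inv a := ⟨-a.log⟩
  mul_assoc a b c := ExpGroup.ext (bch_assoc _ _ _)
  one_mul a := ExpGroup.ext (zero_bch _)
  mul_one a := ExpGroup.ext (bch_zero _)
  inv_mul_cancel a := ExpGroup.ext (neg_bch _)

end Malcev

end NilpotentGroups

open MonoidalCategory

namespace Malcev
section ExpMaps
open IsNilpotent

lemma map_expAct {L L' M M' : Type*} [LieRing L] [LieAlgebra ℚ L] [LieRing L'] [LieAlgebra ℚ L']
    [AddCommGroup M] [Module ℚ M] [LieRingModule L M] [LieModule ℚ L M]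
    [AddCommGroup M'] [Module ℚ M'] [LieRingModule L' M'] [LieModule ℚ L' M']
    [LieModule.IsNilpotent L M] [LieModule.IsNilpotent L' M']
    (g : M →ₗ[ℚ] M') (x : L) (y : L') (h : ∀ m, g ⁅x, m⁆ = ⁅y, g m⁆) (m : M) :
    g (expAct M x m) = expAct M' y (g m) := by
  have := Module.End.commute_exp_left_of_commute (g := g)
    (LieModule.isNilpotent_toEnd_of_isNilpotent ℚ L M x)
    (LieModule.isNilpotent_toEnd_of_isNilpotent ℚ L' M' y) (LinearMap.ext fun m => (h m).symm)
  exact (LinearMap.congr_fun this m).symm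

lemma expAct_bilin {L M M' : Type*} [LieRing L] [LieAlgebra ℚ L]
    [AddCommGroup M] [Module ℚ M] [LieRingModule L M] [LieModule ℚ L M]
    [AddCommGroup M'] [Module ℚ M'] [LieRingModule L M'] [LieModule ℚ L M']
    [LieModule.IsNilpotent L M] [LieModule.IsNilpotent L M']
    (B : M →ₗ[ℚ] M →ₗ[ℚ] M') (x : L) (h : ∀ a b, ⁅x, B a b⁆ = B ⁅x, a⁆ b + B a ⁅x, b⁆) (a b : M) :
    B (expAct M x a) (expAct M x b) = expAct M' x (B a b) := by
  have hn := LieModule.isNilpotent_toEnd_of_isNilpotent ℚ L M x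
  let D := LieModule.toEnd ℚ L M x
  let DL : Module.End ℚ (M ⊗[ℚ] M) := D.lTensor M
  let DR : Module.End ℚ (M ⊗[ℚ] M) := D.rTensor M
  have h_nilL : IsNilpotent DL := hn.map <| Module.End.lTensorAlgHom ℚ M M
  have h_nilR : IsNilpotent DR := hn.map <| Module.End.rTensorAlgHom ℚ M M
  have h_comm : Commute DL DR := by ext; simp [DL, DR]
  have h₁ : exp (LieModule.toEnd ℚ L M' x) (B a b) =
      TensorProduct.lift B (exp (DL + DR) (a ⊗ₜ[ℚ] b)) := by
    have := Module.End.commute_exp_left_of_commute (g := TensorProduct.lift B)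
      (h_comm.isNilpotent_add h_nilL h_nilR)
      (LieModule.isNilpotent_toEnd_of_isNilpotent ℚ L M' x) (by
        ext a b
        simp [DL, DR, D, h, add_comm])
    simpa using LinearMap.congr_fun this (a ⊗ₜ[ℚ] b)
  have h₂ : exp DL = (exp D).lTensor M := (map_exp hn (Module.End.lTensorAlgHom ℚ M M)).symm
  have h₃ : exp DR = (exp D).rTensor M := (map_exp hn (Module.End.rTensorAlgHom ℚ M M)).symm
  rw [expAct, expAct, h₁, exp_add_of_commute h_comm h_nilL h_nilR, h₂, h₃]
  simp [D]

end ExpMaps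
end Malcev

namespace TwistedDGA

section Defs
variable {C : Type u₁} [Category.{v₁} C]

/-- The degree `i` part `A(U)ⁱ` of a functor with values in non-negatively graded real complexes. -/
def Deg (F : C ⥤ CochainComplex (ModuleCat.{w} ℝ) ℕ) (U : C) (i : ℕ) : Type w :=
  ((F.obj U).X i : ModuleCat.{w} ℝ)

variable (F : C ⥤ CochainComplex (ModuleCat.{w} ℝ) ℕ)

instance (U : C) (i : ℕ) : AddCommGroup (Deg F U i) :=
  inferInstanceAs (AddCommGroup ((F.obj U).X i : ModuleCat.{w} ℝ))
instance (U : C) (i : ℕ) : Module ℝ (Deg F U i) :=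
  inferInstanceAs (Module ℝ ((F.obj U).X i : ModuleCat.{w} ℝ))

/-- The differential `d : A(U)ⁱ → A(U)ⁱ⁺¹`. -/
def dif (U : C) (i : ℕ) : Deg F U i →ₗ[ℝ] Deg F U (i + 1) := ((F.obj U).d i (i + 1)).hom

/-- The map `A(f) : A(U)ⁱ → A(V)ⁱ`. -/
def Deg.map {U V : C} (f : U ⟶ V) (i : ℕ) : Deg F U i →ₗ[ℝ] Deg F V i := ((F.map f).f i).hom

lemma dif_dif (U : C) (i : ℕ) (a : Deg F U i) : dif F U (i + 1) (dif F U i a) = 0 := by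
  have := (F.obj U).d_comp_d i (i + 1) (i + 1 + 1)
  exact congrArg (fun f => f.hom a) this

lemma Deg.map_dif {U V : C} (f : U ⟶ V) (i : ℕ) (a : Deg F U i) :
    Deg.map F f (i + 1) (dif F U i a) = dif F V i (Deg.map F f i a) := by
  have := (F.map f).comm i (i + 1)
  exact (congrArg (fun f => f.hom a) this).symm

lemma Deg.map_comp {U V W : C} (f : U ⟶ V) (g : V ⟶ W) (i : ℕ) (a : Deg F U i) :
    Deg.map F (f ≫ g) i a = Deg.map F g i (Deg.map F f i a) := by
  simp [Deg.map]; rfl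

lemma Deg.map_id {U : C} (i : ℕ) (a : Deg F U i) : Deg.map F (𝟙 U) i a = a := by
  simp [Deg.map]; rfl

variable [Preadditive C] [F.Additive]

lemma Deg.map_neg {U V : C} (f : U ⟶ V) (i : ℕ) (a : Deg F U i) :
    Deg.map F (-f) i a = - Deg.map F f i a := by
  simp only [Deg.map, Functor.map_neg]; rfl

lemma Deg.map_add {U V : C} (f g : U ⟶ V) (i : ℕ) (a : Deg F U i) :
    Deg.map F (f + g) i a = Deg.map F f i a + Deg.map F g i a := by
  simp only [Deg.map, Functor.map_add]; rfl

lemma Deg.map_zero {U V : C} (i : ℕ) (a : Deg F U i) :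
    Deg.map F (0 : U ⟶ V) i a = 0 := by
  simp only [Deg.map, Functor.map_zero]; rfl

end Defs

/-- A (real) DGA over a tensor category: an additive functor to non-negatively graded real
complexes with a functorial multiplication `A(U) ⊗ A(V) → A(U ⊗ V)`, given by its bilinear
components `A(U)ⁱ × A(V)ʲ → A(U ⊗ V)ⁿ` for `i + j = n`. It is a morphism of complexes
(`mul_dif`), associative, and commutative for the sign rule. -/
structure DGA (C : Type u₁) [Category.{v₁} C] [Preadditive C] [MonoidalCategory C]
    [SymmetricCategory C] where
  F : C ⥤ CochainComplex (ModuleCat.{w} ℝ) ℕ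
  additive : F.Additive
  mul (U V : C) {i j n : ℕ} (h : i + j = n) : Deg F U i →ₗ[ℝ] Deg F V j →ₗ[ℝ] Deg F (U ⊗ V) n
  mul_natural : ∀ {U U' V V' : C} (f : U ⟶ U') (g : V ⟶ V') {i j n : ℕ} (h : i + j = n)
    (a : Deg F U i) (b : Deg F V j),
    Deg.map F (f ⊗ₘ g) n (mul U V h a b) = mul U' V' h (Deg.map F f i a) (Deg.map F g j b)
  mul_dif : ∀ (U V : C) {i j n : ℕ} (h : i + j = n) (a : Deg F U i) (b : Deg F V j),
    dif F (U ⊗ V) n (mul U V h a b) =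
      mul U V (show i + 1 + j = n + 1 by omega) (dif F U i a) b +
        (-1 : ℝ) ^ i • mul U V (show i + (j + 1) = n + 1 by omega) a (dif F V j b)
  mul_assoc : ∀ (U V W : C) {i j l m p n : ℕ} (hm : i + j = m) (hp : j + l = p) (hn : m + l = n)
    (a : Deg F U i) (b : Deg F V j) (c : Deg F W l),
    Deg.map F (α_ U V W).hom n (mul (U ⊗ V) W hn (mul U V hm a b) c) =
      mul U (V ⊗ W) (show i + p = n by omega) a (mul V W hp b c)
  mul_comm : ∀ (U V : C) {i j n : ℕ} (h : i + j = n) (a : Deg F U i) (b : Deg F V j),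
    Deg.map F (β_ U V).hom n (mul U V h a b) =
      (-1 : ℝ) ^ (i * j) • mul V U (show j + i = n by omega) b a

attribute [instance] DGA.additive

/-- A morphism of DGAs: a natural transformation compatible with the multiplications. -/
structure DGA.Hom {C : Type u₁} [Category.{v₁} C] [Preadditive C] [MonoidalCategory C]
    [SymmetricCategory C] (A B : DGA.{w} C) where
  nat : A.F ⟶ B.F
  map_mul : ∀ (U V : C) {i j n : ℕ} (h : i + j = n) (a : Deg A.F U i) (b : Deg A.F V j),
    ((nat.app (U ⊗ V)).f n).hom (A.mul U V h a b) =
      B.mul U V h (((nat.app U).f i).hom a) (((nat.app V).f j).hom b)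

section Bracket
variable {C : Type u₁} [Category.{v₁} C] [Preadditive C] [MonoidalCategory C]
  [SymmetricCategory C]

/-- The axioms of a Lie algebra for a bracket on an object of a tensor category. -/
structure IsLie {X : C} (br : X ⊗ X ⟶ X) : Prop where
  skew : (β_ X X).hom ≫ br = -br
  jacobi : X ◁ br ≫ br = (α_ X X X).inv ≫ br ▷ X ≫ br +
    (α_ X X X).inv ≫ (β_ X X).hom ▷ X ≫ (α_ X X X).hom ≫ X ◁ br ≫ br

variable (A : DGA.{w} C) {X : C} (br : X ⊗ X ⟶ X)

/-- The bracket `A(X) ⊗ A(X) → A(X ⊗ X) → A(X)` induced by a bracket on `X`. -/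
def DGA.bra {i j n : ℕ} (h : i + j = n) : Deg A.F X i →ₗ[ℝ] Deg A.F X j →ₗ[ℝ] Deg A.F X n :=
  (A.mul X X h).compr₂ (Deg.map A.F br n)

lemma DGA.bra_apply {i j n : ℕ} (h : i + j = n) (a : Deg A.F X i) (b : Deg A.F X j) :
    A.bra br h a b = Deg.map A.F br n (A.mul X X h a b) := rfl

variable {br}

lemma DGA.bra_skew (hbr : IsLie br) {i j n : ℕ} (h : i + j = n) (a : Deg A.F X i)
    (b : Deg A.F X j) :
    A.bra br h a b = -((-1 : ℝ) ^ (i * j) • A.bra br (show j + i = n by omega) b a) := by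
  rw [A.bra_apply, A.bra_apply, ← map_smul, ← A.mul_comm, ← Deg.map_comp, hbr.skew, Deg.map_neg,
    neg_neg]

lemma DGA.bra_jacobi (hbr : IsLie br) {i j l m p q n : ℕ} (hm : i + j = m) (hp : j + l = p)
    (hq : i + l = q) (hn : m + l = n) (a : Deg A.F X i) (b : Deg A.F X j) (c : Deg A.F X l) :
    A.bra br (show i + p = n by omega) a (A.bra br hp b c) =
      A.bra br hn (A.bra br hm a b) c +
        (-1 : ℝ) ^ (i * j) • A.bra br (show j + q = n by omega) b (A.bra br hq a c) := by
  have hα : ∀ (i j l m p n : ℕ) (hm : i + j = m) (hp : j + l = p) (hn : m + l = n)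
      (a : Deg A.F X i) (b : Deg A.F X j) (c : Deg A.F X l),
      Deg.map A.F (α_ X X X).inv n (A.mul X (X ⊗ X) (show i + p = n by omega) a
        (A.mul X X hp b c)) = A.mul (X ⊗ X) X hn (A.mul X X hm a b) c := by
    intro i j l m p n hm hp hn a b c
    rw [← A.mul_assoc X X X hm hp hn, ← Deg.map_comp, Iso.hom_inv_id, Deg.map_id]
  have h1 : ∀ {i p n : ℕ} (h : i + p = n) (a : Deg A.F X i) (w : Deg A.F (X ⊗ X) p),
      Deg.map A.F (X ◁ br) n (A.mul X (X ⊗ X) h a w) = A.mul X X h a (Deg.map A.F br p w) := by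
    intro i p n h a w
    rw [← id_tensorHom, A.mul_natural, Deg.map_id]
  have h2 : ∀ {Y : C} (f : X ⊗ X ⟶ Y) {m l n : ℕ} (h : m + l = n) (w : Deg A.F (X ⊗ X) m)
      (c : Deg A.F X l),
      Deg.map A.F (f ▷ X) n (A.mul (X ⊗ X) X h w c) = A.mul Y X h (Deg.map A.F f m w) c := by
    intro Y f m l n h w c
    rw [← tensorHom_id, A.mul_natural, Deg.map_id]
  simp only [A.bra_apply]
  rw [← h1, ← Deg.map_comp, hbr.jacobi, Deg.map_add]
  congr 1
  · rw [Deg.map_comp, hα i j l m p n hm hp hn, Deg.map_comp, h2]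
  · rw [Deg.map_comp, hα i j l m p n hm hp hn, Deg.map_comp, h2, A.mul_comm, map_smul,
      LinearMap.smul_apply, map_smul, Deg.map_comp, A.mul_assoc X X X _ hq, Deg.map_comp, h1]

lemma DGA.bra_dif {i j n : ℕ} (h : i + j = n) (a : Deg A.F X i) (b : Deg A.F X j) :
    dif A.F X n (A.bra br h a b) =
      A.bra br (show i + 1 + j = n + 1 by omega) (dif A.F X i a) b +
        (-1 : ℝ) ^ i • A.bra br (show i + (j + 1) = n + 1 by omega) a (dif A.F X j b) := by
  simp only [A.bra_apply]
  rw [← Deg.map_dif, A.mul_dif, _root_.map_add, map_smul]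

end Bracket
end TwistedDGA

namespace TwistedDGA
open Malcev

section DGLA
variable {C : Type u₁} [Category.{v₁} C] [Preadditive C] [MonoidalCategory C]
  [SymmetricCategory C]

/-- The right-nested tensor power `X ⊗ (X ⊗ (⋯ ⊗ X))` with `n + 1` factors. -/
def tpow (X : C) : ℕ → C
  | 0 => X
  | n + 1 => X ⊗ tpow X n

/-- The iterated bracket `[x₁, [x₂, […, xₙ₊₁]]]`. -/
def iter {X : C} (br : X ⊗ X ⟶ X) : (n : ℕ) → (tpow X n ⟶ X)
  | 0 => 𝟙 X
  | n + 1 => X ◁ iter br n ≫ br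

variable (C) in
/-- A nilpotent Lie algebra in a tensor category. -/
structure NilLie where
  X : C
  br : X ⊗ X ⟶ X
  isLie : IsLie br
  nilpotent : ∃ n, iter br n = 0

/-- The degree `n` part of the differential graded Lie algebra `A(N)`. -/
def LDeg (A : DGA.{w} C) (N : NilLie C) (n : ℕ) : Type w := Deg A.F N.X n

variable (A : DGA.{w} C) (N : NilLie C)

instance (n : ℕ) : AddCommGroup (LDeg A N n) := inferInstanceAs (AddCommGroup (Deg A.F N.X n))
instance (n : ℕ) : Module ℝ (LDeg A N n) := inferInstanceAs (Module ℝ (Deg A.F N.X n))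
noncomputable instance (n : ℕ) : Module ℚ (LDeg A N n) := Module.compHom _ (algebraMap ℚ ℝ)

instance (n : ℕ) : IsScalarTower ℚ ℝ (LDeg A N n) :=
  ⟨fun q r x => by
    rw [Algebra.smul_def, mul_smul]; rfl⟩

/-- The differential of `A(N)`. -/
def ldif (n : ℕ) : LDeg A N n →ₗ[ℝ] LDeg A N (n + 1) := dif A.F N.X n

/-- The bracket of `A(N)`. -/
def lbra {i j n : ℕ} (h : i + j = n) : LDeg A N i →ₗ[ℝ] LDeg A N j →ₗ[ℝ] LDeg A N n :=
  A.bra N.br h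

lemma lbra_skew {i j n : ℕ} (h : i + j = n) (a : LDeg A N i) (b : LDeg A N j) :
    lbra A N h a b = -((-1 : ℝ) ^ (i * j) • lbra A N (show j + i = n by omega) b a) :=
  A.bra_skew N.isLie h a b

lemma lbra_jacobi {i j l m p q n : ℕ} (hm : i + j = m) (hp : j + l = p)
    (hq : i + l = q) (hn : m + l = n) (a : LDeg A N i) (b : LDeg A N j) (c : LDeg A N l) :
    lbra A N (show i + p = n by omega) a (lbra A N hp b c) =
      lbra A N hn (lbra A N hm a b) c +
        (-1 : ℝ) ^ (i * j) • lbra A N (show j + q = n by omega) b (lbra A N hq a c) :=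
  A.bra_jacobi N.isLie hm hp hq hn a b c

lemma ldif_lbra {i j n : ℕ} (h : i + j = n) (a : LDeg A N i) (b : LDeg A N j) :
    ldif A N n (lbra A N h a b) =
      lbra A N (show i + 1 + j = n + 1 by omega) (ldif A N i a) b +
        (-1 : ℝ) ^ i • lbra A N (show i + (j + 1) = n + 1 by omega) a (ldif A N j b) :=
  A.bra_dif h a b

lemma ldif_ldif (n : ℕ) (a : LDeg A N n) : ldif A N (n + 1) (ldif A N n a) = 0 :=
  dif_dif A.F N.X n a

/-- The Lie algebra `A(N)⁰`. -/
noncomputable instance : LieRing (LDeg A N 0) where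
  bracket a b := lbra A N (add_zero 0) a b
  add_lie a b c := by simp
  lie_add a b c := by simp
  lie_self a := by
    have h := lbra_skew A N (add_zero 0) a a
    have h2 : (2 : ℝ) • lbra A N (add_zero 0) a a = 0 := by
      rw [two_smul]; nth_rewrite 1 [h]; simp
    exact (smul_eq_zero.mp h2).resolve_left two_ne_zero
  leibniz_lie a b c := by
    have := lbra_jacobi A N (add_zero 0) (add_zero 0) (add_zero 0) (add_zero 0) a b c
    simpa using this

noncomputable instance : LieAlgebra ℝ (LDeg A N 0) where
  lie_smul t a b := map_smul (lbra A N (add_zero 0) a) t b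

noncomputable instance : LieAlgebra ℚ (LDeg A N 0) where
  lie_smul t a b := map_smul (lbra A N (add_zero 0) a) (t : ℝ) b

/-- The adjoint action of `A(N)⁰` on the parts of positive degree. -/
noncomputable instance (n : ℕ) : LieRingModule (LDeg A N 0) (LDeg A N (n + 1)) where
  bracket a b := lbra A N (zero_add (n + 1)) a b
  add_lie a b c := by simp
  lie_add a b c := by simp
  leibniz_lie a b c := by
    have := lbra_jacobi A N (add_zero 0) (zero_add (n + 1)) (zero_add (n + 1))
      (zero_add (n + 1)) a b c
    rw [zero_mul, pow_zero, one_smul] at this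
    exact this

lemma lie_def_zero (a b : LDeg A N 0) : ⁅a, b⁆ = lbra A N (add_zero 0) a b := rfl
lemma lie_def_succ (n : ℕ) (a : LDeg A N 0) (b : LDeg A N (n + 1)) :
    ⁅a, b⁆ = lbra A N (zero_add (n + 1)) a b := rfl

noncomputable instance (n : ℕ) : LieModule ℚ (LDeg A N 0) (LDeg A N (n + 1)) where
  smul_lie t a b := by
    change lbra A N _ ((t : ℝ) • a) b = (t : ℝ) • lbra A N _ a b
    rw [map_smul, LinearMap.smul_apply]
  lie_smul t a b := map_smul (lbra A N (zero_add (n + 1)) a) (t : ℝ) b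

/-- The elements of `A(N)ⁿ` that come from iterated brackets of length `m + 1`. -/
def iterF (n m : ℕ) : Submodule ℚ (LDeg A N n) where
  carrier := {x | ∃ w, Deg.map A.F (iter N.br m) n w = x}
  zero_mem' := ⟨0, map_zero _⟩
  add_mem' := by
    rintro _ _ ⟨w, rfl⟩ ⟨w', rfl⟩
    exact ⟨w + w', map_add _ _ _⟩
  smul_mem' := by
    rintro t _ ⟨w, rfl⟩
    exact ⟨(t : ℝ) • w, map_smul _ _ _⟩

lemma iterF_zero (n : ℕ) (x : LDeg A N n) : x ∈ iterF A N n 0 :=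
  ⟨x, Deg.map_id A.F n x⟩

lemma lbra_mem_iterF {n m : ℕ} (a : LDeg A N 0) {x : LDeg A N n} (hx : x ∈ iterF A N n m) :
    lbra A N (zero_add n) a x ∈ iterF A N n (m + 1) := by
  obtain ⟨w, rfl⟩ := hx
  refine ⟨A.mul N.X (tpow N.X m) (zero_add n) a w, ?_⟩
  have h := A.mul_natural (𝟙 N.X) (iter N.br m) (zero_add n) (show Deg A.F N.X 0 from a) w
  rw [Deg.map_id, id_tensorHom] at h
  exact (Deg.map_comp A.F _ _ _ _).trans (congrArg (Deg.map A.F N.br n) h)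

lemma iterF_eq_zero : ∃ m, ∀ n, ∀ x ∈ iterF A N n m, x = 0 := by
  obtain ⟨m, hm⟩ := N.nilpotent
  refine ⟨m, ?_⟩
  rintro n _ ⟨w, rfl⟩
  rw [hm]
  exact Deg.map_zero A.F n w

instance : LieRing.IsNilpotent (LDeg A N 0) := by
  obtain ⟨m, hm⟩ := iterF_eq_zero A N
  exact isNilpotent_of_filtration (iterF A N 0) (iterF_zero A N 0)
    (fun n x w hw => lbra_mem_iterF A N x hw) (hm 0)

instance (n : ℕ) : LieModule.IsNilpotent (LDeg A N 0) (LDeg A N (n + 1)) := by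
  obtain ⟨m, hm⟩ := iterF_eq_zero A N
  exact isNilpotent_of_filtration (iterF A N (n + 1)) (iterF_zero A N (n + 1))
    (fun k x w hw => lbra_mem_iterF A N x hw) (hm (n + 1))

/-- The Maurer–Cartan set `{x ∈ A(N)¹ | dx + [x, x] / 2 = 0}`. -/
def MC : Type w :=
  {x : LDeg A N 1 // ldif A N 1 x + (1 / 2 : ℝ) • lbra A N (one_add_one_eq_two) x x = 0}

/-- The gauge group `exp(A(N)⁰)`. -/
abbrev Gauge : Type w := ExpGroup (LDeg A N 0)

/-- The map `(a, s) ↦ [a, s d] = - s da`. -/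
noncomputable def bracketD : LDeg A N 0 →ₗ[ℚ] ℝ →ₗ[ℚ] LDeg A N 1 :=
  LinearMap.mk₂ ℚ (fun a s => -(s • ldif A N 0 a))
    (by intro a b s; rw [map_add, smul_add, neg_add])
    (by
      intro t a s
      change -(s • ldif A N 0 ((t : ℝ) • a)) = (t : ℝ) • -(s • ldif A N 0 a)
      rw [map_smul, smul_comm, smul_neg])
    (by intro a s s'; rw [add_smul, neg_add])
    (by intro t a s; rw [smul_assoc, smul_neg])

lemma bracketD_apply (a : LDeg A N 0) (s : ℝ) : bracketD A N a s = -(s • ldif A N 0 a) := rfl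

lemma isCocycle_bracketD : IsCocycle (bracketD A N) := by
  intro a b s
  have h1 := ldif_lbra A N (add_zero 0) a b
  have h2 := lbra_skew A N (show 1 + 0 = 1 from rfl) (ldif A N 0 a) b
  rw [pow_zero, one_smul] at h1
  rw [mul_zero, pow_zero, one_smul] at h2
  simp only [bracketD_apply]
  rw [lie_def_zero, h1, h2]
  change -(s • (-lbra A N (zero_add 1) b (ldif A N 0 a) +
      lbra A N (zero_add 1) a (ldif A N 0 b))) =
    lbra A N (zero_add 1) a (-(s • ldif A N 0 b)) - lbra A N (zero_add 1) b (-(s • ldif A N 0 a))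
  simp only [map_neg, map_smul, smul_add, smul_neg]
  abel

/-- The degree one part `A(N)¹ ⊕ ℝ d` of the differential graded Lie algebra obtained from `A(N)`
by adjoining `d`, with `[d, a] = da`; it is an `A(N)⁰`-module for the adjoint action. -/
abbrev WithD : Type w := CocycleExt (isCocycle_bracketD A N)

/-- The bracket `[x + s d, y + t d] = [x, y] + s dy + t dx` of `A(N)¹ ⊕ ℝ d`. -/
noncomputable def braD : WithD A N →ₗ[ℚ] WithD A N →ₗ[ℚ] LDeg A N 2 :=
  LinearMap.mk₂ ℚ (fun v w => lbra A N one_add_one_eq_two v.1 w.1 + v.2 • ldif A N 1 w.1 +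
      w.2 • ldif A N 1 v.1)
    (by
      intro v v' w
      simp only [CocycleExt.add_fst, CocycleExt.add_snd, map_add, LinearMap.add_apply, add_smul,
        smul_add]
      abel)
    (by
      intro t v w
      change lbra A N _ ((t : ℝ) • v.1) w.1 + (t • v.2) • ldif A N 1 w.1 +
        w.2 • ldif A N 1 ((t : ℝ) • v.1) = t • _
      rw [map_smul, LinearMap.smul_apply, map_smul, smul_assoc, smul_comm w.2, smul_add, smul_add]
      rfl)
    (by
      intro v w w'
      simp only [CocycleExt.add_fst, CocycleExt.add_snd, map_add, add_smul, smul_add]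
      abel)
    (by
      intro t v w
      change lbra A N _ v.1 ((t : ℝ) • w.1) + v.2 • ldif A N 1 ((t : ℝ) • w.1) +
        (t • w.2) • ldif A N 1 v.1 = t • _
      rw [map_smul, map_smul, smul_assoc, smul_comm v.2, smul_add, smul_add]
      rfl)

lemma braD_apply (v w : WithD A N) : braD A N v w =
    lbra A N one_add_one_eq_two v.1 w.1 + v.2 • ldif A N 1 w.1 + w.2 • ldif A N 1 v.1 := rfl

lemma lie_braD (a : LDeg A N 0) (v w : WithD A N) :
    ⁅a, braD A N v w⁆ = braD A N ⁅a, v⁆ w + braD A N v ⁅a, w⁆ := by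
  have hj := lbra_jacobi A N (zero_add 1) one_add_one_eq_two (zero_add 1) one_add_one_eq_two
    a v.1 w.1
  have hd : ∀ x : LDeg A N 1, ldif A N 1 (lbra A N (zero_add 1) a x) =
      lbra A N one_add_one_eq_two (ldif A N 0 a) x + lbra A N (zero_add 2) a (ldif A N 1 x) := by
    intro x
    have := ldif_lbra A N (zero_add 1) a x
    rwa [pow_zero, one_smul] at this
  have hs : lbra A N one_add_one_eq_two v.1 (ldif A N 0 a) =
      lbra A N one_add_one_eq_two (ldif A N 0 a) v.1 := by
    have := lbra_skew A N one_add_one_eq_two v.1 (ldif A N 0 a)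
    rw [mul_one, pow_one, neg_smul, one_smul, neg_neg] at this
    exact this
  rw [zero_mul, pow_zero, one_smul] at hj
  simp only [braD_apply, CocycleExt.lie_fst, CocycleExt.lie_snd, bracketD_apply, lie_def_succ,
    map_add, map_neg, map_smul, LinearMap.add_apply, LinearMap.neg_apply, LinearMap.smul_apply,
    zero_smul, add_zero, hd, smul_add, ldif_ldif, smul_zero, neg_zero, hs]
  rw [hj]
  abel

lemma mem_MC_iff (x : LDeg A N 1) :
    ldif A N 1 x + (1 / 2 : ℝ) • lbra A N (one_add_one_eq_two) x x = 0 ↔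
      braD A N (CocycleExt.mk x 1) (CocycleExt.mk x 1) = 0 := by
  have : braD A N (CocycleExt.mk x 1) (CocycleExt.mk x 1) =
      (2 : ℝ) • (ldif A N 1 x + (1 / 2 : ℝ) • lbra A N (one_add_one_eq_two) x x) := by
    rw [braD_apply, smul_add, smul_smul, two_smul]
    simp only [CocycleExt.mk_fst, CocycleExt.mk_snd, one_smul]
    norm_num
    abel
  rw [this, smul_eq_zero]
  simp

/-- The gauge action `α(x) = ad_α (x + d) - d` on `A(N)¹`, where `ad_α` is the exponential of the
adjoint action on `A(N)¹ ⊕ ℝ d`. -/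
noncomputable def gaugeAct (g : Gauge A N) (x : LDeg A N 1) : LDeg A N 1 :=
  (expAct (WithD A N) g.log (CocycleExt.mk x 1)).1

lemma expAct_mk (g : Gauge A N) (x : LDeg A N 1) :
    expAct (WithD A N) g.log (CocycleExt.mk x 1) = CocycleExt.mk (gaugeAct A N g x) 1 :=
  CocycleExt.ext _ rfl (expAct_cocycleExt_snd _ _ _)

/-- The gauge action on the Maurer–Cartan set. -/
noncomputable instance : MulAction (Gauge A N) (MC A N) where
  smul g x := ⟨gaugeAct A N g x.1, by
    rw [mem_MC_iff, ← expAct_mk, expAct_bilin _ _ (lie_braD A N _),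
      (mem_MC_iff A N _).mp x.2, map_zero]⟩
  one_smul x := Subtype.ext (by
    change (expAct (WithD A N) 0 (CocycleExt.mk x.1 1)).1 = x.1
    simp [expAct])
  mul_smul g h x := Subtype.ext (by
    change (expAct (WithD A N) (bch g.log h.log) (CocycleExt.mk x.1 1)).1 =
      gaugeAct A N g (gaugeAct A N h x.1)
    rw [expAct_bch, Module.End.mul_apply, expAct_mk, expAct_mk]; rfl)

lemma smul_val (g : Gauge A N) (x : MC A N) : (g • x).1 = gaugeAct A N g x.1 := rfl

end DGLA
end TwistedDGA

namespace TwistedDGA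
open Malcev

section Maps
variable {C : Type u₁} [Category.{v₁} C] [Preadditive C] [MonoidalCategory C]
  [SymmetricCategory C]

/-- A morphism of differential graded Lie algebras `A(N) → B(N')`. -/
structure LHom (A : DGA.{w} C) (N : NilLie C) (B : DGA.{w} C) (N' : NilLie C) where
  map (n : ℕ) : LDeg A N n →ₗ[ℝ] LDeg B N' n
  map_dif : ∀ (n : ℕ) (a : LDeg A N n), map (n + 1) (ldif A N n a) = ldif B N' n (map n a)
  map_bra : ∀ {i j n : ℕ} (h : i + j = n) (a : LDeg A N i) (b : LDeg A N j),
    map n (lbra A N h a b) = lbra B N' h (map i a) (map j b)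

variable {A : DGA.{w} C} {N : NilLie C} {B : DGA.{w} C} {N' : NilLie C}

namespace LHom

/-- The induced map of Maurer–Cartan sets. -/
def mc (F : LHom A N B N') (x : MC A N) : MC B N' :=
  ⟨F.map 1 x.1, by
    have h := congrArg (F.map 2) x.2
    rw [map_add, map_smul, F.map_dif, F.map_bra, map_zero] at h
    exact h⟩

/-- The induced map of Lie algebras `A(N)⁰ → B(N')⁰`. -/
noncomputable def lie (F : LHom A N B N') : LDeg A N 0 →ₗ⁅ℚ⁆ LDeg B N' 0 where
  toFun := F.map 0
  map_add' := map_add _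
  map_smul' t a := map_smul (F.map 0) (t : ℝ) a
  map_lie' := F.map_bra (add_zero 0) _ _

/-- The induced map of gauge groups. -/
noncomputable def gauge (F : LHom A N B N') : Gauge A N →* Gauge B N' where
  toFun g := ⟨F.lie g.log⟩
  map_one' := ExpGroup.ext (map_zero F.lie)
  map_mul' _ _ := ExpGroup.ext (map_bch F.lie _ _)

/-- The induced map `A(N)¹ ⊕ ℝ d → B(N')¹ ⊕ ℝ d`. -/
noncomputable def withD (F : LHom A N B N') : WithD A N →ₗ[ℚ] WithD B N' where
  toFun v := CocycleExt.mk (F.map 1 v.1) v.2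
  map_add' v v' := CocycleExt.ext _ (map_add (F.map 1) v.1 v'.1) rfl
  map_smul' t v := CocycleExt.ext _ (map_smul (F.map 1) (t : ℝ) v.1) rfl

lemma mc_smul (F : LHom A N B N') (g : Gauge A N) (x : MC A N) :
    F.mc (g • x) = F.gauge g • F.mc x := by
  have h := map_expAct F.withD g.log (F.lie g.log) (by
    intro v
    refine CocycleExt.ext _ ?_ rfl
    change F.map 1 (lbra A N _ g.log v.1 + -(v.2 • ldif A N 0 g.log)) =
      lbra B N' _ (F.map 0 g.log) (F.map 1 v.1) + -(v.2 • ldif B N' 0 (F.map 0 g.log))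
    rw [map_add, map_neg, map_smul, F.map_bra, F.map_dif]) (CocycleExt.mk x.1 1)
  exact Subtype.ext (congrArg (fun v => v.1) h)

end LHom

/-- The category of nilpotent Lie algebras in `C`. -/
@[ext] structure NilLie.Hom (N N' : NilLie C) where
  hom : N.X ⟶ N'.X
  comm : N.br ≫ hom = (hom ⊗ₘ hom) ≫ N'.br

instance : Category (NilLie C) where
  Hom := NilLie.Hom
  id N := ⟨𝟙 N.X, by simp⟩
  comp f g := ⟨f.hom ≫ g.hom, by
    rw [← Category.assoc, f.comm, Category.assoc, g.comm, ← tensorHom_comp_tensorHom,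
      Category.assoc]⟩

/-- The morphism `A(N) → A(N')` induced by a morphism `N → N'`. -/
def LHom.ofHom (A : DGA.{w} C) (f : N ⟶ N') : LHom A N A N' where
  map n := Deg.map A.F f.hom n
  map_dif n a := Deg.map_dif A.F f.hom n a
  map_bra {i j n} h a b := by
    change Deg.map A.F f.hom n (Deg.map A.F N.br n (A.mul N.X N.X h a b)) =
      Deg.map A.F N'.br n (A.mul N'.X N'.X h (Deg.map A.F f.hom i a) (Deg.map A.F f.hom j b))
    rw [← Deg.map_comp, f.comm, Deg.map_comp]
    exact congrArg _ (A.mul_natural f.hom f.hom h (show Deg A.F N.X i from a)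
      (show Deg A.F N.X j from b))

/-- The component `A(U)ⁿ → B(U)ⁿ` of a morphism of DGAs. -/
def DGA.Hom.map (φ : DGA.Hom A B) (U : C) (n : ℕ) : Deg A.F U n →ₗ[ℝ] Deg B.F U n :=
  ((φ.nat.app U).f n).hom

lemma DGA.Hom.map_natural (φ : DGA.Hom A B) {U V : C} (f : U ⟶ V) (n : ℕ) (a : Deg A.F U n) :
    φ.map V n (Deg.map A.F f n a) = Deg.map B.F f n (φ.map U n a) := by
  have h := congrArg (fun g => g.f n) (φ.nat.naturality f)
  exact congrArg (fun g => g.hom a) h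

/-- The morphism `A(N) → B(N)` induced by a morphism of DGAs. -/
def LHom.ofDGA (φ : DGA.Hom A B) (N : NilLie C) : LHom A N B N where
  map n := φ.map N.X n
  map_dif n a := by
    have h := (φ.nat.app N.X).comm n (n + 1)
    exact (congrArg (fun g => g.hom a) h).symm
  map_bra {i j n} h a b := by
    change φ.map N.X n (Deg.map A.F N.br n (A.mul N.X N.X h a b)) =
      Deg.map B.F N.br n (B.mul N.X N.X h (φ.map N.X i a) (φ.map N.X j b))
    rw [φ.map_natural]
    exact congrArg _ (φ.map_mul _ _ h a b)

lemma LHom.ofHom_id (A : DGA.{w} C) (N : NilLie C) (n : ℕ) (a : LDeg A N n) :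
    (LHom.ofHom A (𝟙 N)).map n a = a := Deg.map_id A.F n a

lemma LHom.ofHom_comp (A : DGA.{w} C) {N N' N'' : NilLie C} (f : N ⟶ N') (g : N' ⟶ N'') (n : ℕ)
    (a : LDeg A N n) : (LHom.ofHom A (f ≫ g)).map n a =
      (LHom.ofHom A g).map n ((LHom.ofHom A f).map n a) := Deg.map_comp A.F f.hom g.hom n a

lemma LHom.ofDGA_natural (φ : DGA.Hom A B) (f : N ⟶ N') (n : ℕ) (a : LDeg A N n) :
    (LHom.ofDGA φ N').map n ((LHom.ofHom A f).map n a) =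
      (LHom.ofHom B f).map n ((LHom.ofDGA φ N).map n a) := φ.map_natural f.hom n a

/-- The deformation set `Def_A(N) = MC_A(N) / G_A(N)`. -/
def DefSet (A : DGA.{w} C) (N : NilLie C) : Type w :=
  Quotient (MulAction.orbitRel (Gauge A N) (MC A N))

/-- The induced map of deformation sets. -/
noncomputable def LHom.defMap (F : LHom A N B N') : DefSet A N → DefSet B N' :=
  Quotient.map F.mc (by
    rintro _ x ⟨g, rfl⟩
    exact ⟨F.gauge g, (F.mc_smul g x).symm⟩)

variable (A) in
/-- The deformation functor `Def_A`. -/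
noncomputable def defFunctor : NilLie C ⥤ Type w where
  obj N := DefSet A N
  map f := ↾((LHom.ofHom A f).defMap)
  map_id N := by
    ext x
    obtain ⟨x, rfl⟩ := Quotient.exists_rep x
    exact congrArg (Quotient.mk _) (Subtype.ext (LHom.ofHom_id A N 1 x.1))
  map_comp f g := by
    ext x
    obtain ⟨x, rfl⟩ := Quotient.exists_rep x
    exact congrArg (Quotient.mk _) (Subtype.ext (LHom.ofHom_comp A f g 1 x.1))

/-- The transformation `Def_A → Def_B` induced by a morphism `A → B`. -/
noncomputable def defNat (φ : DGA.Hom A B) : defFunctor A ⟶ defFunctor B where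
  app N := ↾((LHom.ofDGA φ N).defMap)
  naturality N N' f := by
    ext x
    obtain ⟨x, rfl⟩ := Quotient.exists_rep x
    exact congrArg (Quotient.mk _) (Subtype.ext (LHom.ofDGA_natural φ f 1 x.1))

/-- The objects of the deformation groupoid: the elements of `MC_A(N)`. -/
@[ext] structure DefGrpd (A : DGA.{w} C) (N : NilLie C) where
  pt : MC A N

/-- The morphisms `x → y` of the deformation groupoid: the `g ∈ G_A(N)` with `g(x) = y`. -/
@[ext] structure DefGrpd.Hom (x y : DefGrpd A N) where
  g : Gauge A N
  eq : g • x.pt = y.pt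

noncomputable instance : Groupoid (DefGrpd A N) where
  Hom x y := DefGrpd.Hom x y
  id x := ⟨1, one_smul _ _⟩
  comp f h := ⟨h.g * f.g, by rw [mul_smul, f.eq, h.eq]⟩
  id_comp f := DefGrpd.Hom.ext (mul_one _)
  comp_id f := DefGrpd.Hom.ext (one_mul _)
  assoc f h l := DefGrpd.Hom.ext (mul_assoc _ _ _).symm
  inv f := ⟨f.g⁻¹, by rw [← f.eq, inv_smul_smul]⟩
  inv_comp f := DefGrpd.Hom.ext (mul_inv_cancel f.g)
  comp_inv f := DefGrpd.Hom.ext (inv_mul_cancel f.g)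

lemma DefGrpd.hom_ext {x y : DefGrpd A N} {f h : x ⟶ y} (e : DefGrpd.Hom.g f = DefGrpd.Hom.g h) :
    f = h := DefGrpd.Hom.ext e

lemma DefGrpd.comp_g {x y z : DefGrpd A N} (f : x ⟶ y) (h : y ⟶ z) :
    DefGrpd.Hom.g (f ≫ h) = DefGrpd.Hom.g h * DefGrpd.Hom.g f := rfl

lemma DefGrpd.eqToHom_g {x y : DefGrpd A N} (e : x = y) : DefGrpd.Hom.g (eqToHom e) = 1 := by
  subst e; rfl

/-- The induced functor of deformation groupoids. -/
noncomputable def LHom.grpdMap (F : LHom A N B N') : DefGrpd A N ⥤ DefGrpd B N' where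
  obj x := ⟨F.mc x.pt⟩
  map f := ⟨F.gauge f.g, by rw [← F.mc_smul, f.eq]⟩
  map_id x := DefGrpd.Hom.ext (map_one F.gauge)
  map_comp f h := DefGrpd.Hom.ext (map_mul F.gauge _ _)

end Maps
end TwistedDGA

namespace TwistedDGA

section Coaction
variable {k : Type*} [CommRing k]

/-- The bilinear map `(V ⊗ R) × (W ⊗ R) → (V ⊗ W) ⊗ R` given by the product of an algebra `R`. -/
noncomputable def tprod (R V W : Type*) [CommRing R] [Algebra k R] [AddCommGroup V] [Module k V]
    [AddCommGroup W] [Module k W] : V ⊗[k] R →ₗ[k] W ⊗[k] R →ₗ[k] (V ⊗[k] W) ⊗[k] R :=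
  TensorProduct.curry ((LinearMap.mul' k R).lTensor (V ⊗[k] W) ∘ₗ
    (TensorProduct.tensorTensorTensorComm k V R W R).toLinearMap)

lemma tprod_tmul {R V W : Type*} [CommRing R] [Algebra k R] [AddCommGroup V] [Module k V]
    [AddCommGroup W] [Module k W] (v : V) (w : W) (a b : R) :
    tprod R V W (v ⊗ₜ[k] a) (w ⊗ₜ[k] b) = (v ⊗ₜ[k] w) ⊗ₜ[k] (a * b) := rfl

variable {H : Type*} [CommRing H] [HopfAlgebra k H]

/-- The axioms of a (right) comodule structure `V → V ⊗ O(G)`, which is the same thing as a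
representation of `G`. -/
structure IsCoaction {V : Type*} [AddCommGroup V] [Module k V] (ρ : V →ₗ[k] V ⊗[k] H) : Prop where
  coassoc : ∀ v, TensorProduct.assoc k V H H (ρ.rTensor H (ρ v)) =
    (Coalgebra.comul (R := k) (A := H)).lTensor V (ρ v)
  counit : ∀ v, TensorProduct.rid k V ((Coalgebra.counit (R := k) (A := H)).lTensor V (ρ v)) = v

variable {V W X Y : Type*} [AddCommGroup V] [Module k V] [AddCommGroup W] [Module k W]
  [AddCommGroup X] [Module k X] [AddCommGroup Y] [Module k Y]

/-- The diagonal coaction on a tensor product. -/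
noncomputable def tcoact (ρ : V →ₗ[k] V ⊗[k] H) (σ : W →ₗ[k] W ⊗[k] H) :
    V ⊗[k] W →ₗ[k] (V ⊗[k] W) ⊗[k] H :=
  TensorProduct.lift ((tprod H V W).compl₁₂ ρ σ)

lemma tcoact_tmul (ρ : V →ₗ[k] V ⊗[k] H) (σ : W →ₗ[k] W ⊗[k] H) (v : V) (w : W) :
    tcoact ρ σ (v ⊗ₜ[k] w) = tprod H V W (ρ v) (σ w) := rfl

/-- Two bilinear maps on `(V ⊗ R) × (W ⊗ S)` agree if they agree on pure tensors. -/
lemma bilin_ext {R S : Type*} [AddCommGroup R] [Module k R] [AddCommGroup S] [Module k S]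
    {f g : V ⊗[k] R →ₗ[k] W ⊗[k] S →ₗ[k] X}
    (h : ∀ v a w b, f (v ⊗ₜ a) (w ⊗ₜ b) = g (v ⊗ₜ a) (w ⊗ₜ b)) (s : V ⊗[k] R) (t : W ⊗[k] S) :
    f s t = g s t := by
  have : f = g := by
    ext v a w b
    exact h v a w b
  rw [this]

lemma map_tprod (f : V →ₗ[k] X) (g : W →ₗ[k] Y) (s : V ⊗[k] H) (t : W ⊗[k] H) :
    (TensorProduct.map f g).rTensor H (tprod H V W s t) =
      tprod H X Y (f.rTensor H s) (g.rTensor H t) :=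
  bilin_ext (f := (tprod H V W).compr₂ ((TensorProduct.map f g).rTensor H))
    (g := (tprod H X Y).compl₁₂ (f.rTensor H) (g.rTensor H)) (fun _ _ _ _ => rfl) s t

lemma IsCoaction.tensor {ρ : V →ₗ[k] V ⊗[k] H} {σ : W →ₗ[k] W ⊗[k] H} (hρ : IsCoaction ρ)
    (hσ : IsCoaction σ) : IsCoaction (tcoact ρ σ) where
  coassoc x := by
    induction x with
    | zero => simp
    | add x y hx hy => simp only [map_add, hx, hy]
    | tmul v w =>
      have h1 : ∀ (s : V ⊗[k] H) (t : W ⊗[k] H),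
          TensorProduct.assoc k _ H H ((tcoact ρ σ).rTensor H (tprod H V W s t)) =
          tprod (H ⊗[k] H) V W (TensorProduct.assoc k V H H (ρ.rTensor H s))
            (TensorProduct.assoc k W H H (σ.rTensor H t)) := by
        intro s t
        have h0 : ∀ (s : V ⊗[k] H) (t : W ⊗[k] H) (a b : H),
            TensorProduct.assoc k _ H H (tprod H V W s t ⊗ₜ (a * b)) =
            tprod (H ⊗[k] H) V W (TensorProduct.assoc k V H H (s ⊗ₜ a))
              (TensorProduct.assoc k W H H (t ⊗ₜ b)) := by
          intro s t a b
          induction s with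
          | zero => simp
          | add x y hx hy => simp only [map_add, LinearMap.add_apply, add_tmul, hx, hy]
          | tmul v c =>
            induction t with
            | zero => simp
            | add x y hx hy => simp only [map_add, add_tmul, hx, hy]
            | tmul w d => simp [tprod_tmul]
        induction s with
        | zero => simp
        | add x y hx hy => simp only [map_add, LinearMap.add_apply, hx, hy]
        | tmul v a =>
          induction t with
          | zero => simp
          | add x y hx hy => simp only [map_add, hx, hy]
          | tmul w b => exact h0 (ρ v) (σ w) a b
      have h2 : ∀ (s : V ⊗[k] H) (t : W ⊗[k] H),
          (Coalgebra.comul (R := k) (A := H)).lTensor _ (tprod H V W s t) =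
          tprod (H ⊗[k] H) V W ((Coalgebra.comul (R := k) (A := H)).lTensor V s)
            ((Coalgebra.comul (R := k) (A := H)).lTensor W t) := by
        intro s t
        induction s with
        | zero => simp
        | add x y hx hy => simp only [map_add, LinearMap.add_apply, hx, hy]
        | tmul v a =>
          induction t with
          | zero => simp
          | add x y hx hy => simp only [map_add, hx, hy]
          | tmul w b => simp [tprod_tmul]
      rw [tcoact_tmul, h1, h2, hρ.coassoc, hσ.coassoc]
  counit x := by
    induction x with
    | zero => simp
    | add x y hx hy => simp only [map_add, hx, hy]
    | tmul v w =>
      have h1 : ∀ (s : V ⊗[k] H) (t : W ⊗[k] H),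
          TensorProduct.rid k _ ((Coalgebra.counit (R := k) (A := H)).lTensor _ (tprod H V W s t)) =
          TensorProduct.rid k V ((Coalgebra.counit (R := k) (A := H)).lTensor V s) ⊗ₜ
            TensorProduct.rid k W ((Coalgebra.counit (R := k) (A := H)).lTensor W t) := by
        intro s t
        induction s with
        | zero => simp
        | add x y hx hy => simp only [map_add, LinearMap.add_apply, add_tmul, hx, hy]
        | tmul v a =>
          induction t with
          | zero => simp
          | add x y hx hy => simp only [map_add, tmul_add, hx, hy]
          | tmul w b =>
            simp only [tprod_tmul, LinearMap.lTensor_tmul, Bialgebra.counit_mul,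
              TensorProduct.rid_tmul]
            rw [smul_tmul_smul]
      rw [tcoact_tmul, h1, hρ.counit, hσ.counit]

/-- The trivial coaction on the ground ring. -/
noncomputable def ucoact (k H : Type*) [CommRing k] [CommRing H] [HopfAlgebra k H] :
    k →ₗ[k] k ⊗[k] H :=
  (TensorProduct.mk k k H).flip 1

lemma IsCoaction.unit : IsCoaction (ucoact k H) where
  coassoc x := by simp [ucoact, Algebra.TensorProduct.one_def]
  counit x := by simp [ucoact]

/-- The condition that a linear map is a map of comodules. -/
def IsColinear (ρ : V →ₗ[k] V ⊗[k] H) (σ : W →ₗ[k] W ⊗[k] H) (f : V →ₗ[k] W) : Prop :=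
  ∀ v, σ (f v) = f.rTensor H (ρ v)

lemma IsColinear.id (ρ : V →ₗ[k] V ⊗[k] H) : IsColinear ρ ρ LinearMap.id := by
  intro v; simp

lemma IsColinear.comp {ρ : V →ₗ[k] V ⊗[k] H} {σ : W →ₗ[k] W ⊗[k] H} {τ : X →ₗ[k] X ⊗[k] H}
    {g : W →ₗ[k] X} {f : V →ₗ[k] W} (hg : IsColinear σ τ g) (hf : IsColinear ρ σ f) :
    IsColinear ρ τ (g ∘ₗ f) := by
  intro v
  rw [LinearMap.comp_apply, hg, hf, LinearMap.rTensor_comp, LinearMap.comp_apply]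

lemma IsColinear.symm {ρ : V →ₗ[k] V ⊗[k] H} {σ : W →ₗ[k] W ⊗[k] H} {e : V ≃ₗ[k] W}
    (h : IsColinear ρ σ e.toLinearMap) : IsColinear σ ρ e.symm.toLinearMap := by
  intro w
  have := h (e.symm w)
  simp only [LinearEquiv.coe_coe, LinearEquiv.apply_symm_apply] at this
  have h2 : ∀ t : V ⊗[k] H, e.symm.toLinearMap.rTensor H (e.toLinearMap.rTensor H t) = t := by
    intro t
    rw [← LinearMap.rTensor_comp_apply]
    simp
  rw [this, h2]
  rfl

lemma IsColinear.tensor {ρ : V →ₗ[k] V ⊗[k] H} {σ : W →ₗ[k] W ⊗[k] H} {ρ' : X →ₗ[k] X ⊗[k] H}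
    {σ' : Y →ₗ[k] Y ⊗[k] H} {f : V →ₗ[k] X} {g : W →ₗ[k] Y} (hf : IsColinear ρ ρ' f)
    (hg : IsColinear σ σ' g) :
    IsColinear (tcoact ρ σ) (tcoact ρ' σ') (TensorProduct.map f g) := by
  intro x
  induction x with
  | zero => simp
  | add x y hx hy => simp only [map_add, hx, hy]
  | tmul v w => rw [tcoact_tmul, map_tprod, map_tmul, tcoact_tmul, hf, hg]

lemma isColinear_assoc (ρ : V →ₗ[k] V ⊗[k] H) (σ : W →ₗ[k] W ⊗[k] H) (τ : X →ₗ[k] X ⊗[k] H) :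
    IsColinear (tcoact (tcoact ρ σ) τ) (tcoact ρ (tcoact σ τ))
      (TensorProduct.assoc k V W X).toLinearMap := by
  intro x
  have h : ∀ (r : V ⊗[k] H) (s : W ⊗[k] H) (t : X ⊗[k] H),
      tprod H V (W ⊗[k] X) r (tprod H W X s t) =
        (TensorProduct.assoc k V W X).toLinearMap.rTensor H
          (tprod H (V ⊗[k] W) X (tprod H V W r s) t) := by
    intro r s t
    induction r with
    | zero => simp
    | add x y hx hy => simp only [map_add, LinearMap.add_apply, hx, hy]
    | tmul v a =>
      induction s with
      | zero => simp
      | add x y hx hy => simp only [map_add, LinearMap.add_apply, hx, hy]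
      | tmul w b =>
        induction t with
        | zero => simp
        | add x y hx hy => simp only [map_add, hx, hy]
        | tmul x c => simp [tprod_tmul, _root_.mul_assoc]
  induction x with
  | zero => simp
  | add x y hx hy => simp only [map_add, hx, hy]
  | tmul y z =>
    induction y with
    | zero => simp
    | add x y hx hy => simp only [map_add, add_tmul, hx, hy]
    | tmul v w => exact h (ρ v) (σ w) (τ z)

lemma isColinear_comm (ρ : V →ₗ[k] V ⊗[k] H) (σ : W →ₗ[k] W ⊗[k] H) :
    IsColinear (tcoact ρ σ) (tcoact σ ρ) (TensorProduct.comm k V W).toLinearMap := by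
  intro x
  induction x with
  | zero => simp
  | add x y hx hy => simp only [map_add, hx, hy]
  | tmul v w =>
    exact bilin_ext (f := (tprod H W V).flip) (g := (tprod H V W).compr₂
      ((TensorProduct.comm k V W).toLinearMap.rTensor H))
      (fun v a w b => by simp [tprod_tmul, _root_.mul_comm]) (ρ v) (σ w)

lemma isColinear_lid (ρ : V →ₗ[k] V ⊗[k] H) :
    IsColinear (tcoact (ucoact k H) ρ) ρ (TensorProduct.lid k V).toLinearMap := by
  intro x
  induction x with
  | zero => simp
  | add x y hx hy => simp only [map_add, hx, hy]
  | tmul c v =>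
    have h : ∀ t : V ⊗[k] H, c • t = (TensorProduct.lid k V).toLinearMap.rTensor H
        (tprod H k V (c ⊗ₜ 1) t) := by
      intro t
      induction t with
      | zero => simp
      | add x y hx hy => simp only [map_add, smul_add, hx, hy]
      | tmul v a => simp [tprod_tmul, smul_tmul']
    simpa [tcoact_tmul, ucoact] using h (ρ v)

lemma isColinear_rid (ρ : V →ₗ[k] V ⊗[k] H) :
    IsColinear (tcoact ρ (ucoact k H)) ρ (TensorProduct.rid k V).toLinearMap := by
  intro x
  induction x with
  | zero => simp
  | add x y hx hy => simp only [map_add, hx, hy]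
  | tmul v c =>
    have h : ∀ t : V ⊗[k] H, c • t = (TensorProduct.rid k V).toLinearMap.rTensor H
        (tprod H V k t (c ⊗ₜ 1)) := by
      intro t
      induction t with
      | zero => simp
      | add x y hx hy => simp only [map_add, LinearMap.add_apply, smul_add, hx, hy]
      | tmul v a => simp [tprod_tmul, smul_tmul']
    simpa [tcoact_tmul, ucoact] using h (ρ v)

end Coaction
end TwistedDGA

namespace TwistedDGA

section GRep
variable (k : Type u) [Field k] (H : Type v) [CommRing H] [HopfAlgebra k H]

/-- A finite-dimensional representation of the affine group scheme `G = Spec H` over `k`, that is,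
a finite-dimensional comodule over the Hopf algebra `H = O(G)`. -/
structure GRep where
  carrier : Type u
  [addCommGroup : AddCommGroup carrier]
  [module : Module k carrier]
  [finite : FiniteDimensional k carrier]
  coact : carrier →ₗ[k] carrier ⊗[k] H
  isCoaction : IsCoaction coact

attribute [instance] GRep.addCommGroup GRep.module GRep.finite

variable {k H}

/-- A `G`-equivariant linear map. -/
@[ext] structure GRep.Hom (V W : GRep k H) where
  lin : V.carrier →ₗ[k] W.carrier
  colinear : IsColinear V.coact W.coact lin

instance : Category (GRep k H) where
  Hom V W := GRep.Hom V W
  id V := ⟨LinearMap.id, IsColinear.id _⟩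
  comp f g := ⟨g.lin ∘ₗ f.lin, g.colinear.comp f.colinear⟩

namespace GRep

/-- The linear map underlying a morphism. -/
def lin {V W : GRep k H} (f : V ⟶ W) : V.carrier →ₗ[k] W.carrier := GRep.Hom.lin f

lemma lin_injective {V W : GRep k H} : Function.Injective (lin : (V ⟶ W) → _) :=
  fun _ _ h => GRep.Hom.ext h

lemma lin_id (V : GRep k H) : lin (𝟙 V) = LinearMap.id := rfl
lemma lin_comp {V W X : GRep k H} (f : V ⟶ W) (g : W ⟶ X) : lin (f ≫ g) = lin g ∘ₗ lin f := rfl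

/-- A linear map that commutes with the coactions, as a morphism. -/
def ofLin {V W : GRep k H} (f : V.carrier →ₗ[k] W.carrier)
    (h : IsColinear V.coact W.coact f) : V ⟶ W := GRep.Hom.mk f h

@[simp] lemma lin_ofLin {V W : GRep k H} (f : V.carrier →ₗ[k] W.carrier)
    (h : IsColinear V.coact W.coact f) : lin (ofLin f h) = f := rfl

/-- A linear equivalence that commutes with the coactions, as an isomorphism. -/
def ofEquiv {V W : GRep k H} (e : V.carrier ≃ₗ[k] W.carrier)
    (h : IsColinear V.coact W.coact e.toLinearMap) : V ≅ W where
  hom := ofLin e.toLinearMap h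
  inv := ofLin e.symm.toLinearMap h.symm
  hom_inv_id := lin_injective (by ext x; exact e.symm_apply_apply x)
  inv_hom_id := lin_injective (by ext x; exact e.apply_symm_apply x)

lemma coact_lin {V W : GRep k H} (f : V ⟶ W) (v : V.carrier) :
    W.coact (lin f v) = (lin f).rTensor H (V.coact v) := GRep.Hom.colinear f v

section Add
variable {V W : GRep k H}

instance : Zero (V ⟶ W) := ⟨ofLin 0 (by intro v; simp)⟩
instance : Add (V ⟶ W) := ⟨fun f g => ofLin (lin f + lin g) (by
  intro v
  rw [LinearMap.add_apply, map_add, coact_lin, coact_lin, LinearMap.rTensor_add]; rfl)⟩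
instance : Neg (V ⟶ W) := ⟨fun f => ofLin (-lin f) (by
  intro v
  rw [LinearMap.neg_apply, map_neg, coact_lin, LinearMap.rTensor_neg]; rfl)⟩
instance : Sub (V ⟶ W) := ⟨fun f g => ofLin (lin f - lin g) (by
  intro v
  rw [LinearMap.sub_apply, map_sub, coact_lin, coact_lin, LinearMap.rTensor_sub]; rfl)⟩
instance : SMul ℕ (V ⟶ W) := ⟨fun n f => ofLin (n • lin f) (by
  intro v
  rw [LinearMap.smul_apply, map_nsmul, coact_lin, ← Nat.cast_smul_eq_nsmul k n (lin f),
    LinearMap.rTensor_smul, LinearMap.smul_apply, Nat.cast_smul_eq_nsmul])⟩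
instance : SMul ℤ (V ⟶ W) := ⟨fun n f => ofLin (n • lin f) (by
  intro v
  rw [LinearMap.smul_apply, map_zsmul, coact_lin, ← Int.cast_smul_eq_zsmul k n (lin f),
    LinearMap.rTensor_smul, LinearMap.smul_apply, Int.cast_smul_eq_zsmul])⟩

instance : AddCommGroup (V ⟶ W) :=
  lin_injective.addCommGroup lin rfl (fun _ _ => rfl) (fun _ => rfl) (fun _ _ => rfl)
    (fun _ _ => rfl) (fun _ _ => rfl)

end Add

instance : Preadditive (GRep k H) where
  add_comp _ _ _ f f' g := lin_injective (by ext x; exact map_add (lin g) _ _)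
  comp_add _ _ _ f g g' := lin_injective (by ext x; rfl)

/-- The tensor product of representations. -/
noncomputable def tensor (V W : GRep k H) : GRep k H where
  carrier := V.carrier ⊗[k] W.carrier
  coact := tcoact V.coact W.coact
  isCoaction := V.isCoaction.tensor W.isCoaction

variable (k H) in
/-- The trivial one-dimensional representation. -/
noncomputable def unit : GRep k H where
  carrier := k
  coact := ucoact k H
  isCoaction := IsCoaction.unit

/-- The forgetful functor to vector spaces. -/
def toMod : GRep k H ⥤ ModuleCat.{u} k where
  obj V := ModuleCat.of k V.carrier
  map f := ModuleCat.ofHom (lin f)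

instance : (toMod (k := k) (H := H)).Faithful where
  map_injective h := lin_injective (congrArg ModuleCat.Hom.hom h)

noncomputable instance : MonoidalCategoryStruct (GRep k H) where
  tensorObj V W := tensor V W
  whiskerLeft V _ _ f :=
    ofLin ((lin f).lTensor V.carrier) ((IsColinear.id V.coact).tensor f.colinear)
  whiskerRight f W :=
    ofLin ((lin f).rTensor W.carrier) (IsColinear.tensor f.colinear (IsColinear.id W.coact))
  tensorHom f g := ofLin (TensorProduct.map (lin f) (lin g)) (IsColinear.tensor f.colinear g.colinear)
  tensorUnit := unit k H
  associator V W X := ofEquiv (TensorProduct.assoc k V.carrier W.carrier X.carrier)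
    (isColinear_assoc _ _ _)
  leftUnitor V := ofEquiv (TensorProduct.lid k V.carrier) (isColinear_lid _)
  rightUnitor V := ofEquiv (TensorProduct.rid k V.carrier) (isColinear_rid _)

/-- The data identifying the tensor product of representations with that of vector spaces. -/
noncomputable def inducingData : Monoidal.InducingFunctorData (toMod (k := k) (H := H)) where
  μIso _ _ := Iso.refl _
  whiskerLeft_eq X Y Z f := by ext; rfl
  whiskerRight_eq f X := by ext; rfl
  tensorHom_eq f g := by ext; rfl
  εIso := Iso.refl _
  associator_eq X Y Z := ModuleCat.hom_ext <| TensorProduct.ext <| TensorProduct.ext <| by ext; rfl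
  leftUnitor_eq X := ModuleCat.hom_ext <| TensorProduct.ext <| by ext; rfl
  rightUnitor_eq X := ModuleCat.hom_ext <| TensorProduct.ext <| by ext; rfl

noncomputable instance : MonoidalCategory (GRep k H) :=
  Monoidal.induced toMod inducingData

noncomputable instance : (toMod (k := k) (H := H)).Monoidal :=
  Monoidal.fromInducedMonoidal toMod inducingData

noncomputable instance : BraidedCategory (GRep k H) :=
  BraidedCategory.ofFaithful toMod
    (fun V W => ofEquiv (TensorProduct.comm k V.carrier W.carrier) (isColinear_comm _ _))
    (fun V W => ModuleCat.hom_ext <| TensorProduct.ext <| by ext; rfl)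

noncomputable instance : (toMod (k := k) (H := H)).Braided where
  braided V W := ModuleCat.hom_ext <| TensorProduct.ext <| by ext; rfl

noncomputable instance : SymmetricCategory (GRep k H) :=
  SymmetricCategory.ofFaithful toMod

end GRep
end GRep

end TwistedDGA

namespace TwistedDGA

section NLie
variable (k : Type u) [Field k] (H : Type v) [CommRing H] [HopfAlgebra k H]

/-- The bracket of a Lie algebra as a linear map `L ⊗ L → L`. -/
noncomputable def brLin (L : Type*) [LieRing L] [LieAlgebra k L] : L ⊗[k] L →ₗ[k] L :=
  TensorProduct.lift (LieModule.toEnd k L L : L →ₗ[k] Module.End k L)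

lemma brLin_tmul {L : Type*} [LieRing L] [LieAlgebra k L] (x y : L) :
    brLin k L (x ⊗ₜ y) = ⁅x, y⁆ := rfl

/-- An object of `𝒩(G)`: a finite-dimensional nilpotent Lie algebra over `k` with a representation
of `G = Spec H` by Lie algebra automorphisms (that is, the bracket is `G`-equivariant). -/
structure NLie where
  carrier : Type u
  [lieRing : LieRing carrier]
  [lieAlgebra : LieAlgebra k carrier]
  [finite : FiniteDimensional k carrier]
  [nilpotent : LieRing.IsNilpotent carrier]
  coact : carrier →ₗ[k] carrier ⊗[k] H
  isCoaction : IsCoaction coact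
  colinear_bracket : IsColinear (tcoact coact coact) coact (brLin k carrier)

attribute [instance] NLie.lieRing NLie.lieAlgebra NLie.finite NLie.nilpotent

variable {k H}

/-- A morphism of `𝒩(G)`: a `G`-equivariant homomorphism of Lie algebras. -/
@[ext] structure NLie.Hom (M N : NLie k H) where
  lie : M.carrier →ₗ⁅k⁆ N.carrier
  colinear : IsColinear M.coact N.coact (lie : M.carrier →ₗ[k] N.carrier)

instance : Category (NLie k H) where
  Hom M N := NLie.Hom M N
  id M := ⟨LieHom.id, IsColinear.id _⟩
  comp f g := ⟨g.lie.comp f.lie, g.colinear.comp f.colinear⟩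

namespace NLie

/-- The homomorphism of Lie algebras underlying a morphism. -/
def lieHom {M N : NLie k H} (f : M ⟶ N) : M.carrier →ₗ⁅k⁆ N.carrier := NLie.Hom.lie f

/-- The representation underlying an object of `𝒩(G)`. -/
def rep (N : NLie k H) : GRep k H where
  carrier := N.carrier
  coact := N.coact
  isCoaction := N.isCoaction

/-- The bracket as a morphism of representations. -/
noncomputable def br (N : NLie k H) : N.rep ⊗ N.rep ⟶ N.rep :=
  GRep.ofLin (V := GRep.tensor N.rep N.rep) (brLin k N.carrier) N.colinear_bracket

lemma lin_br (N : NLie k H) : GRep.lin N.br = brLin k N.carrier := rfl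

lemma isLie_br (N : NLie k H) : IsLie N.br where
  skew := by
    apply GRep.lin_injective
    refine TensorProduct.ext' fun x y => ?_
    exact (lie_skew (show N.carrier from y) (show N.carrier from x)).symm
  jacobi := by
    apply GRep.lin_injective
    refine TensorProduct.ext (LinearMap.ext fun x => TensorProduct.ext' fun y z => ?_)
    exact leibniz_lie (show N.carrier from x) (show N.carrier from y) (show N.carrier from z)

/-- The linear map underlying the iterated bracket. -/
noncomputable def iterLin (N : NLie k H) (n : ℕ) : (tpow N.rep n).carrier →ₗ[k] N.carrier :=
  GRep.lin (iter N.br n)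

lemma iterLin_mem (N : NLie k H) (n : ℕ) (t : (tpow N.rep n).carrier) :
    N.iterLin n t ∈ LieModule.lowerCentralSeries k N.carrier N.carrier n := by
  induction n with
  | zero =>
    rw [LieModule.lowerCentralSeries_zero]
    exact LieSubmodule.mem_top _
  | succ n ih =>
    have key : ∀ t : N.carrier ⊗[k] (tpow N.rep n).carrier,
        brLin k N.carrier ((N.iterLin n).lTensor N.carrier t) ∈
          LieModule.lowerCentralSeries k N.carrier N.carrier (n + 1) := by
      intro t
      induction t with
      | zero =>
        rw [map_zero, map_zero]
        exact zero_mem _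
      | add x y hx hy =>
        rw [map_add, map_add]
        exact add_mem hx hy
      | tmul x y =>
        rw [LieModule.lowerCentralSeries_succ]
        exact LieSubmodule.lie_mem_lie (LieSubmodule.mem_top x) (ih y)
    exact key t

/-- An object of `𝒩(G)` as a nilpotent Lie algebra in the tensor category `Rep(G)`. -/
noncomputable def toNil (N : NLie k H) : NilLie (GRep k H) where
  X := N.rep
  br := N.br
  isLie := N.isLie_br
  nilpotent := by
    obtain ⟨n, hn⟩ := (LieModule.isNilpotent_iff k N.carrier N.carrier).mp N.nilpotent
    refine ⟨n, GRep.lin_injective (LinearMap.ext fun t => ?_)⟩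
    have h0 : N.iterLin n t = 0 := by
      have := N.iterLin_mem n t
      rwa [hn, LieSubmodule.mem_bot] at this
    exact h0

variable (k H) in
/-- The functor from `𝒩(G)` to nilpotent Lie algebras in `Rep(G)`. -/
noncomputable def toNilFunctor : NLie k H ⥤ NilLie (GRep k H) where
  obj N := N.toNil
  map {M N} f := NilLie.Hom.mk (GRep.ofLin (V := M.rep) (W := N.rep) _ (NLie.Hom.colinear f)) (by
    apply GRep.lin_injective
    refine TensorProduct.ext' fun x y => ?_
    exact LieHom.map_lie (lieHom f) x y)
  map_id N := rfl
  map_comp f g := rfl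

end NLie

/-- The object `Vε` of `𝒩(G)`: a representation `V` regarded as an abelian Lie algebra. -/
noncomputable def GRep.eps (V : GRep k H) : NLie k H :=
  let lieRing : LieRing V.carrier :=
    { bracket := fun _ _ => 0
      add_lie := fun _ _ _ => (add_zero 0).symm
      lie_add := fun _ _ _ => (add_zero 0).symm
      lie_self := fun _ => rfl
      leibniz_lie := fun _ _ _ => (add_zero 0).symm }
  let lieAlgebra : LieAlgebra k V.carrier :=
    { toModule := V.module
      lie_smul := fun t _ _ => (smul_zero t).symm }
  have : IsLieAbelian V.carrier := ⟨fun _ _ => rfl⟩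
  { carrier := V.carrier
    lieRing := lieRing
    lieAlgebra := lieAlgebra
    finite := V.finite
    nilpotent := inferInstance
    coact := V.coact
    isCoaction := V.isCoaction
    colinear_bracket := by
      have : brLin k V.carrier = 0 := TensorProduct.ext' fun _ _ => rfl
      intro x
      rw [this, LinearMap.rTensor_zero, LinearMap.zero_apply, LinearMap.zero_apply, map_zero] }

lemma GRep.eps_rep (V : GRep k H) : V.eps.rep = V := rfl

end NLie

end TwistedDGA

namespace TwistedDGA

section Cohomology
variable {C : Type u₁} [Category.{v₁} C] [Preadditive C] [MonoidalCategory C]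
  [SymmetricCategory C]

/-- The cohomology functor `Hⁱ(A)`. -/
noncomputable def cohomology (A : DGA.{w} C) (i : ℕ) : C ⥤ ModuleCat.{w} ℝ :=
  A.F ⋙ HomologicalComplex.homologyFunctor (ModuleCat.{w} ℝ) (ComplexShape.up ℕ) i

/-- The map `Hⁱ(φ) : Hⁱ(A) → Hⁱ(B)` induced by a morphism of DGAs. -/
noncomputable def cohomologyMap {A B : DGA.{w} C} (φ : DGA.Hom A B) (i : ℕ) :
    cohomology A i ⟶ cohomology B i :=
  Functor.whiskerRight φ.nat
    (HomologicalComplex.homologyFunctor (ModuleCat.{w} ℝ) (ComplexShape.up ℕ) i)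

lemma DefGrpd.functor_ext {A B : DGA.{w} C} {N N' : NilLie C} {F G : DefGrpd A N ⥤ DefGrpd B N'}
    (hobj : ∀ x, (F.obj x).pt.1 = (G.obj x).pt.1)
    (hmap : ∀ {x y : DefGrpd A N} (f : x ⟶ y),
      (DefGrpd.Hom.g (F.map f)).log = (DefGrpd.Hom.g (G.map f)).log) : F = G :=
  CategoryTheory.Functor.ext (fun x => DefGrpd.ext (Subtype.ext (hobj x))) (fun x y f => by
    apply DefGrpd.hom_ext
    rw [DefGrpd.comp_g, DefGrpd.comp_g, DefGrpd.eqToHom_g, DefGrpd.eqToHom_g, one_mul, mul_one]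
    exact Malcev.ExpGroup.ext (hmap f))

/-- The deformation groupoid as a functor: its value at `N` has the elements of `MC_A(N)` as
objects and the elements of `G_A(N)` carrying one to the other as morphisms. -/
noncomputable def grpdFunctor (A : DGA.{w} C) : NilLie C ⥤ Grpd.{w, w} where
  obj N := Grpd.of (DefGrpd A N)
  map f := (LHom.ofHom A f).grpdMap
  map_id N := DefGrpd.functor_ext (fun x => LHom.ofHom_id A N 1 x.pt.1)
    (fun f => LHom.ofHom_id A N 0 (DefGrpd.Hom.g f).log)
  map_comp f g := DefGrpd.functor_ext (fun x => LHom.ofHom_comp A f g 1 x.pt.1)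
    (fun h => LHom.ofHom_comp A f g 0 (DefGrpd.Hom.g h).log)

/-- The transformation of deformation groupoids induced by a morphism `A → B`. -/
noncomputable def grpdNat {A B : DGA.{w} C} (φ : DGA.Hom A B) : grpdFunctor A ⟶ grpdFunctor B where
  app N := show DefGrpd A N ⥤ DefGrpd B N from (LHom.ofDGA φ N).grpdMap
  naturality _ _ f := DefGrpd.functor_ext (fun x => LHom.ofDGA_natural φ f 1 x.pt.1)
    (fun h => LHom.ofDGA_natural φ f 0 (DefGrpd.Hom.g h).log)

end Cohomology

section Main
variable {k : Type u} [Field k] {H : Type v} [CommRing H] [HopfAlgebra k H]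

/-- A DGA over `Rep(G)` is flat if it sends short exact sequences `0 → U → V → W → 0` of
representations to short exact sequences of complexes. -/
def DGA.Flat (A : DGA.{w} (GRep k H)) : Prop :=
  ∀ (U V W : GRep k H) (f : U ⟶ V) (g : V ⟶ W), Function.Injective (GRep.lin f) →
    Function.Exact (GRep.lin f) (GRep.lin g) → Function.Surjective (GRep.lin g) →
    ∀ i : ℕ, Function.Injective (Deg.map A.F f i) ∧
      Function.Exact (Deg.map A.F f i) (Deg.map A.F g i) ∧ Function.Surjective (Deg.map A.F g i)

/-- The deformation functor `Def_A : 𝒩(G) → Set`. -/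
noncomputable def Def (A : DGA.{w} (GRep k H)) : NLie k H ⥤ Type w :=
  NLie.toNilFunctor k H ⋙ defFunctor A

/-- The transformation `Def_A → Def_B`. -/
noncomputable def Def.map {A B : DGA.{w} (GRep k H)} (φ : DGA.Hom A B) : Def A ⟶ Def B :=
  Functor.whiskerLeft (NLie.toNilFunctor k H) (defNat φ)

/-- The deformation groupoid `𝔇ef_A`, as a functor from `𝒩(G)` to groupoids. -/
noncomputable def DefGroupoid (A : DGA.{w} (GRep k H)) : NLie k H ⥤ Grpd.{w, w} :=
  NLie.toNilFunctor k H ⋙ grpdFunctor A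

/-- The transformation `𝔇ef_A → 𝔇ef_B`. -/
noncomputable def DefGroupoid.map {A B : DGA.{w} (GRep k H)} (φ : DGA.Hom A B) :
    DefGroupoid A ⟶ DefGroupoid B :=
  Functor.whiskerLeft (NLie.toNilFunctor k H) (grpdNat φ)

/-- A transformation of functors of groupoids is an equivalence if all its components are
equivalences of groupoids. -/
def IsGrpdEquivalence {F E : NLie k H ⥤ Grpd.{w, w}} (η : F ⟶ E) : Prop :=
  ∀ N : NLie k H, Functor.IsEquivalence (C := F.obj N) (D := E.obj N) (η.app N)

/-- A transformation `η : F → E` is unramified if `F(Vε) → E(Vε)` is injective for all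
irreducible representations `V`. -/
def IsUnramified {F E : NLie k H ⥤ Type w} (η : F ⟶ E) : Prop :=
  ∀ V : GRep k H, Simple V → Function.Injective (η.app V.eps)

/-- A transformation `η : F → E` is smooth if `F(M) → E(M) ×_{E(N)} F(N)` is surjective for each
surjection `M → N`. -/
def IsSmooth {F E : NLie k H ⥤ Type w} (η : F ⟶ E) : Prop :=
  ∀ (M N : NLie k H) (p : M ⟶ N), Function.Surjective (NLie.lieHom p) →
    ∀ (y : E.obj M) (x : F.obj N), E.map p y = η.app N x →
      ∃ z : F.obj M, η.app M z = y ∧ F.map p z = x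

/-- A transformation is étale if it is smooth and unramified. -/
def IsEtale {F E : NLie k H ⥤ Type w} (η : F ⟶ E) : Prop :=
  IsSmooth η ∧ IsUnramified η

end Main
end TwistedDGA

end TwistedDeformations

/-! The argument is obstruction theory along central extensions. Let 0 → V → M → N → 0 be a central
extension in 𝒩(G) and A flat. Then A(V) sits centrally in A(M), with quotient A(N). Adding v ∈ A(V)¹
to x ∈ A(M)¹ changes the curvature dx + [x, x]/2 by dv only; a gauge element b ∈ A(V)⁰ moves a
Maurer–Cartan element by −db, and it multiplies other gauge elements by adding logarithms. So the
problem is linear along the fibres and is governed by the cohomology of A(V): obstructions to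
lifting lie in H², lifts modulo the gauge elements of A(V)⁰ form a torsor under H¹ when they exist,
and the gauge elements of A(V)⁰ that fix a lift form H⁰.

Comparison of A with B then takes three lemmas. `exists_mc_lift` uses surjectivity on H¹ and
injectivity on H² to lift objects, `DGA.Hom.FullAt.of_centralExt` uses surjectivity on H⁰ and
injectivity on H¹ to pass fullness from N to M, and `DGA.Hom.FaithfulAt.of_centralExt` uses
injectivity on H⁰ to pass faithfulness.

Every surjection p : M → N in 𝒩(G) is a composite of central ones, because M → N factors through M /
[M, ker p] and M is nilpotent (`NLie.surjective_induction`). The kernels and quotients are again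
representations because tensoring with O(G) over a field is exact. This gives smoothness; applied to
N → 0 it gives surjectivity of Def_A(N) → Def_B(N), while fullness gives injectivity.

On Vε the theory is linear: Def is H¹ and the automorphisms of the trivial deformation are H⁰. The
first fact yields unramifiedness, the second the necessity of the condition on H⁰ for an equivalence
of groupoids. -/

section DeformationInvariance
open CategoryTheory TensorProduct Polynomial MonoidalCategory
universe w v₁ u₁ u v

/-! ### Exponentials when brackets vanish -/

namespace Malcev

/-- The straight curve x + t y solves the defining equation: its derivative y commutes with it, so
all correction terms of the logarithmic derivative vanish. -/
lemma bch_of_lie_eq_zero {L : Type*} [LieRing L] [LieAlgebra ℚ L] [LieRing.IsNilpotent L]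
    {x y : L} (h : ⁅x, y⁆ = 0) : bch x y = x + y := by
  have hZ : IsBCHCurve x y (cmk 1 x + cmk X y) := by
    refine ⟨by simp, 0, fun N _ => ?_⟩
    have h0 : LieAlgebra.ad ℚ (Curve L) (cmk 1 x + cmk X y) (cD (cmk 1 x + cmk X y)) = 0 := by
      simp [h]
    have h1 : dlogTail N (cmk 1 x + cmk X y) = 0 := by
      refine Finset.sum_eq_zero fun n _ => ?_
      rw [pow_succ (LieAlgebra.ad ℚ (Curve L) _), Module.End.mul_apply, h0, map_zero, smul_zero]
    rw [h1]
    simp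
  rw [bch_eq hZ]
  simp

/-- The exponential series stops after its linear term. A central element acts in this way on A(M)¹
⊕ ℝ d: it may move d, but moves it to something that it kills. -/
lemma expAct_of_lie_lie_eq_zero {L M : Type*} [LieRing L] [LieAlgebra ℚ L] [AddCommGroup M]
    [Module ℚ M] [LieRingModule L M] [LieModule ℚ L M] {x : L} (h : ∀ m : M, ⁅x, ⁅x, m⁆⁆ = 0)
    (m : M) : expAct M x m = m + ⁅x, m⁆ := by
  have h2 : LieModule.toEnd ℚ L M x ^ 2 = 0 := by
    ext m
    simpa [pow_two] using h m
  rw [expAct, IsNilpotent.exp_eq_sum h2]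
  simp [Finset.sum_range_succ]

lemma expAct_of_lie_eq_zero {L M : Type*} [LieRing L] [LieAlgebra ℚ L] [AddCommGroup M]
    [Module ℚ M] [LieRingModule L M] [LieModule ℚ L M] [LieModule.IsNilpotent L M]
    {x : L} {m : M} (h : ⁅x, m⁆ = 0) : expAct M x m = m := by
  obtain ⟨n, hn⟩ := LieModule.isNilpotent_toEnd_of_isNilpotent ℚ L M x
  -- The exponent is raised by one to make the range nonempty, so that the constant term can be
  -- split off; each other term contains the factor ⁅x, m⁆.
  rw [expAct, IsNilpotent.exp_eq_sum (pow_eq_zero_of_le (Nat.le_succ n) hn), LinearMap.sum_apply,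
    Finset.sum_range_succ', Finset.sum_eq_zero]
  · simp
  · intro i _
    rw [pow_succ, LinearMap.smul_apply, Module.End.mul_apply, LieModule.toEnd_apply_apply, h,
      map_zero, smul_zero]

end Malcev

namespace TwistedDGA
open Malcev

/-! ### Maurer–Cartan elements and gauge group of a central extension -/

section CentralExtension
variable {C : Type u₁} [Category.{v₁} C] [Preadditive C] [MonoidalCategory C]
  [SymmetricCategory C]

/-- A central extension `0 → V → M → N → 0` of nilpotent Lie algebras in a tensor category, given
by `ι : V → M` and `p : M → N`, which the functor `A` carries to exact sequences. -/
structure DGA.CentralExt (A : DGA.{w} C) {V : C} {M N : NilLie C} (ι : V ⟶ M.X) (p : M ⟶ N) :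
    Prop where
  central : M.X ◁ ι ≫ M.br = 0
  injective (i : ℕ) : Function.Injective (Deg.map A.F ι i)
  exact (i : ℕ) : Function.Exact (Deg.map A.F ι i) (Deg.map A.F p.hom i)
  surjective (i : ℕ) : Function.Surjective (Deg.map A.F p.hom i)

/-- The map `A(V)ⁿ → A(M)ⁿ` induced by a map `V → M`. -/
def LDeg.ofDeg (A : DGA.{w} C) {V : C} {M : NilLie C} (ι : V ⟶ M.X) (n : ℕ) :
    Deg A.F V n →ₗ[ℝ] LDeg A M n := Deg.map A.F ι n

lemma LDeg.ofDeg_dif (A : DGA.{w} C) {V : C} {M : NilLie C} (ι : V ⟶ M.X) {n : ℕ}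
    (v : Deg A.F V n) :
    LDeg.ofDeg A ι (n + 1) (dif A.F V n v) = ldif A M n (LDeg.ofDeg A ι n v) :=
  Deg.map_dif A.F ι n v

/-- The elements of the gauge group that come from `A(V)⁰`. -/
def Gauge.ofDeg (A : DGA.{w} C) {V : C} {M : NilLie C} (ι : V ⟶ M.X)
    (b : Deg A.F V 0) : Gauge A M := ⟨LDeg.ofDeg A ι 0 b⟩

/-- The Maurer–Cartan expression `dx + [x, x] / 2`. -/
noncomputable def curvature (A : DGA.{w} C) (N : NilLie C) (x : LDeg A N 1) : LDeg A N 2 :=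
  ldif A N 1 x + (1 / 2 : ℝ) • lbra A N one_add_one_eq_two x x

lemma LHom.map_curvature {A B : DGA.{w} C} {M N : NilLie C} (F : LHom A M B N) (x : LDeg A M 1) :
    F.map 2 (curvature A M x) = curvature B N (F.map 1 x) := by
  rw [curvature, curvature, map_add, map_smul, F.map_dif, F.map_bra]

/-- With u = [[x, x], x], graded skew symmetry gives [x, [x, x]] = −u, and the Jacobi identity for
x, x, x then reads −u = 2u. -/
lemma lbra_lbra_self (A : DGA.{w} C) (N : NilLie C) (x : LDeg A N 1) :
    lbra A N (show 2 + 1 = 3 from rfl) (lbra A N one_add_one_eq_two x x) x = 0 := by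
  have hj := lbra_jacobi A N one_add_one_eq_two one_add_one_eq_two one_add_one_eq_two
    (show 2 + 1 = 3 from rfl) x x x
  have hs := lbra_skew A N (show 1 + 2 = 3 from rfl) x (lbra A N one_add_one_eq_two x x)
  norm_num at hj hs
  rw [hs] at hj
  have h3 : (3 : ℝ) • lbra A N (show 2 + 1 = 3 from rfl) (lbra A N one_add_one_eq_two x x) x = 0 := by
    linear_combination (norm := module) - hj
  exact (smul_eq_zero.mp h3).resolve_left (by norm_num)

/-- The Bianchi identity. -/
lemma ldif_curvature (A : DGA.{w} C) (N : NilLie C) (x : LDeg A N 1) :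
    ldif A N 2 (curvature A N x) =
      lbra A N (show 2 + 1 = 3 from rfl) (curvature A N x) x := by
  have hs := lbra_skew A N (show 1 + 2 = 3 from rfl) x (ldif A N 1 x)
  have hd := ldif_lbra A N one_add_one_eq_two x x
  norm_num at hs hd
  -- Since [x, dx] = −[dx, x], this gives d[x, x] = 2[dx, x]. The factor 1/2 of the curvature
  -- cancels the 2, and the cubic term on the other side is zero.
  rw [hs] at hd
  rw [curvature, map_add, map_smul, ldif_ldif, zero_add, hd, map_add, LinearMap.add_apply,
    map_smul, LinearMap.smul_apply, lbra_lbra_self]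
  module

namespace DGA.CentralExt
variable {A : DGA.{w} C} {V : C} {M N : NilLie C} {ι : V ⟶ M.X} {p : M ⟶ N}

lemma ofDeg_injective (E : A.CentralExt ι p) {n : ℕ} {v v' : Deg A.F V n}
    (h : LDeg.ofDeg A ι n v = LDeg.ofDeg A ι n v') : v = v' := E.injective n h

lemma map_ofDeg (E : A.CentralExt ι p) {n : ℕ} (v : Deg A.F V n) :
    (LHom.ofHom A p).map n (LDeg.ofDeg A ι n v) = 0 := E.exact n |>.apply_apply_eq_zero v

lemma exists_ofDeg (E : A.CentralExt ι p) {n : ℕ} {x : LDeg A M n}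
    (h : (LHom.ofHom A p).map n x = 0) : ∃ v, LDeg.ofDeg A ι n v = x := (E.exact n x).mp h

lemma exists_eq_add (E : A.CentralExt ι p) {n : ℕ} {x y : LDeg A M n}
    (h : (LHom.ofHom A p).map n x = (LHom.ofHom A p).map n y) :
    ∃ v, x = y + LDeg.ofDeg A ι n v := by
  obtain ⟨v, hv⟩ := E.exists_ofDeg (x := x - y) (by rw [map_sub, h, sub_self])
  exact ⟨v, by rw [hv, add_sub_cancel]⟩

lemma exists_lift (E : A.CentralExt ι p) {n : ℕ} (y : LDeg A N n) :
    ∃ x, (LHom.ofHom A p).map n x = y := E.surjective n y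

/-- Centrality is an identity of morphisms in the tensor category; naturality of the multiplication
carries it to all degrees of A at once. -/
lemma lbra_ofDeg (E : A.CentralExt ι p) {i j n : ℕ} (h : i + j = n) (a : LDeg A M i)
    (v : Deg A.F V j) : lbra A M h a (LDeg.ofDeg A ι j v) = 0 := by
  have h1 := A.mul_natural (𝟙 M.X) ι h (show Deg A.F M.X i from a) v
  rw [Deg.map_id, id_tensorHom] at h1
  have h2 : Deg.map A.F M.br n (Deg.map A.F (M.X ◁ ι) n (A.mul M.X V h a v)) = 0 := by
    rw [← Deg.map_comp, E.central, Deg.map_zero]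
  rw [h1] at h2
  exact h2

lemma ofDeg_lbra (E : A.CentralExt ι p) {i j n : ℕ} (h : i + j = n) (v : Deg A.F V i)
    (a : LDeg A M j) : lbra A M h (LDeg.ofDeg A ι i v) a = 0 := by
  rw [lbra_skew, E.lbra_ofDeg, smul_zero, neg_zero]

/-- The mixed brackets and the bracket of v with itself vanish by centrality. The curvature is thus
affine along the fibres with linear part d, also at an x that is not Maurer–Cartan. -/
lemma curvature_add (E : A.CentralExt ι p) (x : LDeg A M 1) (v : Deg A.F V 1) :
    curvature A M (x + LDeg.ofDeg A ι 1 v) =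
      curvature A M x + LDeg.ofDeg A ι 2 (dif A.F V 1 v) := by
  simp only [curvature, map_add, LinearMap.add_apply, E.lbra_ofDeg, E.ofDeg_lbra, LDeg.ofDeg_dif]
  module

lemma dif_eq_zero (E : A.CentralExt ι p) {x y : MC A M} {v : Deg A.F V 1}
    (h : x.1 = y.1 + LDeg.ofDeg A ι 1 v) : dif A.F V 1 v = 0 := by
  have hx : curvature A M x.1 = 0 := x.2
  have hy : curvature A M y.1 = 0 := y.2
  rw [h, E.curvature_add, hy, zero_add] at hx
  exact E.ofDeg_injective (hx.trans (map_zero _).symm)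

/-- The Maurer–Cartan elements of a central extension are permuted by the cocycles. -/
def addMC (E : A.CentralExt ι p) (x : MC A M) (v : Deg A.F V 1) (hv : dif A.F V 1 v = 0) :
    MC A M :=
  ⟨x.1 + LDeg.ofDeg A ι 1 v, by
    have hx : curvature A M x.1 = 0 := x.2
    have := E.curvature_add x.1 v
    rw [hx, hv, map_zero, add_zero] at this
    exact this⟩

/-- A central b commutes with A(M)¹ and sees only d: the bracket with x + d is −db, and a second
bracket with b is zero. -/
lemma ofDeg_smul (E : A.CentralExt ι p) (b : Deg A.F V 0) (x : MC A M) :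
    (Gauge.ofDeg A ι b • x).1 = x.1 - LDeg.ofDeg A ι 1 (dif A.F V 0 b) := by
  have h1 : ∀ m : WithD A M, ⁅LDeg.ofDeg A ι 0 b, m⁆ =
      CocycleExt.mk (-(m.2 • ldif A M 0 (LDeg.ofDeg A ι 0 b))) 0 := by
    intro m
    refine CocycleExt.ext _ ?_ rfl
    rw [CocycleExt.lie_fst, lie_def_succ, E.ofDeg_lbra, zero_add, bracketD_apply]; rfl
  have h2 : ∀ m : WithD A M, ⁅LDeg.ofDeg A ι 0 b, ⁅LDeg.ofDeg A ι 0 b, m⁆⁆ = 0 := by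
    intro m
    rw [h1, CocycleExt.lie_snd, zero_smul, neg_zero]; rfl
  have h3 := congrArg (fun v => v.1) (expAct_of_lie_lie_eq_zero h2 (CocycleExt.mk x.1 1))
  rw [smul_val]
  refine h3.trans ?_
  rw [h1, CocycleExt.add_fst, CocycleExt.mk_fst, CocycleExt.mk_fst, CocycleExt.mk_snd, one_smul,
    ← LDeg.ofDeg_dif, sub_eq_add_neg]

/-- The exponentiated adjoint action is linear on A(M)¹ ⊕ ℝ d and fixes the central element v, so
gauge transformations commute with translations along the fibre. -/
lemma smul_add (E : A.CentralExt ι p) (g : Gauge A M) {x y : MC A M} {v : Deg A.F V 1}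
    (h : x.1 = y.1 + LDeg.ofDeg A ι 1 v) : (g • x).1 = (g • y).1 + LDeg.ofDeg A ι 1 v := by
  have h1 : ⁅g.log, (CocycleExt.mk (LDeg.ofDeg A ι 1 v) 0 : WithD A M)⁆ = 0 := by
    refine CocycleExt.ext _ ?_ rfl
    rw [CocycleExt.lie_fst, CocycleExt.mk_fst, CocycleExt.mk_snd, map_zero, lie_def_succ,
      E.lbra_ofDeg, add_zero]; rfl
  have h2 : (CocycleExt.mk x.1 1 : WithD A M) =
      CocycleExt.mk y.1 1 + CocycleExt.mk (LDeg.ofDeg A ι 1 v) 0 :=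
    CocycleExt.ext _ h (add_zero _).symm
  have h3 := congrArg (fun w => (expAct (WithD A M) g.log w).1) h2
  simp only [map_add, expAct_of_lie_eq_zero h1, CocycleExt.add_fst, CocycleExt.mk_fst] at h3
  exact h3

lemma mul_ofDeg_log (E : A.CentralExt ι p) (g : Gauge A M) (b : Deg A.F V 0) :
    (g * Gauge.ofDeg A ι b).log = g.log + LDeg.ofDeg A ι 0 b :=
  bch_of_lie_eq_zero (E.lbra_ofDeg (add_zero 0) _ _)

/-- Two elements of the gauge group with the same image differ by a central element. -/
lemma exists_eq_mul (E : A.CentralExt ι p) {g h : Gauge A M}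
    (e : (LHom.ofHom A p).gauge g = (LHom.ofHom A p).gauge h) :
    ∃ b, g = h * Gauge.ofDeg A ι b := by
  obtain ⟨b, hb⟩ := E.exists_eq_add (x := g.log) (y := h.log) (congrArg ExpGroup.log e)
  exact ⟨b, ExpGroup.ext (hb.trans (E.mul_ofDeg_log h b).symm)⟩

lemma exists_gauge_lift (E : A.CentralExt ι p) (g : Gauge A N) :
    ∃ h, (LHom.ofHom A p).gauge h = g := by
  obtain ⟨a, ha⟩ := E.exists_lift g.log
  exact ⟨⟨a⟩, ExpGroup.ext ha⟩

/-- A central correction can be applied before g: the translation by −db passes through g unchanged.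
-/
lemma mul_ofDeg_smul (E : A.CentralExt ι p) (g : Gauge A M) (b : Deg A.F V 0) (x : MC A M) :
    ((g * Gauge.ofDeg A ι b) • x).1 = (g • x).1 - LDeg.ofDeg A ι 1 (dif A.F V 0 b) := by
  rw [mul_smul, E.smul_add g (y := x) (v := -dif A.F V 0 b)
    (by rw [E.ofDeg_smul, map_neg, sub_eq_add_neg]), map_neg, sub_eq_add_neg]

end DGA.CentralExt

/-! ### Lifting objects, fullness and faithfulness along a central extension -/

section Lifting
variable {A B : DGA.{w} C} (φ : DGA.Hom A B) {V : C} {M N : NilLie C} {ι : V ⟶ M.X} {p : M ⟶ N}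

lemma LHom.ofDGA_ofDeg (n : ℕ) (v : Deg A.F V n) :
    (LHom.ofDGA φ M).map n (LDeg.ofDeg A ι n v) = LDeg.ofDeg B ι n (φ.map V n v) :=
  φ.map_natural ι n v

lemma DGA.Hom.map_dif {U : C} {n : ℕ} (a : Deg A.F U n) :
    φ.map U (n + 1) (dif A.F U n a) = dif B.F U n (φ.map U n a) :=
  (congrArg (fun g => g.hom a) ((φ.nat.app U).comm n (n + 1))).symm

lemma LHom.ofDGA_mc_natural (x : MC A M) :
    (LHom.ofDGA φ N).mc ((LHom.ofHom A p).mc x) = (LHom.ofHom B p).mc ((LHom.ofDGA φ M).mc x) :=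
  Subtype.ext (LHom.ofDGA_natural φ p 1 x.1)

lemma LHom.ofDGA_gauge_natural (g : Gauge A M) :
    (LHom.ofDGA φ N).gauge ((LHom.ofHom A p).gauge g) =
      (LHom.ofHom B p).gauge ((LHom.ofDGA φ M).gauge g) :=
  ExpGroup.ext (LHom.ofDGA_natural φ p 0 g.log)

/-- `Hⁱ⁺¹(φ)` is injective on `A(V)`. -/
def DGA.Hom.CohInj (V : C) (i : ℕ) : Prop :=
  ∀ a : Deg A.F V (i + 1), dif A.F V (i + 1) a = 0 → ∀ b : Deg B.F V i,
    φ.map V (i + 1) a = dif B.F V i b → ∃ c, dif A.F V i c = a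

/-- `Hⁱ⁺¹(φ)` is surjective on `A(V)`. -/
def DGA.Hom.CohSurj (V : C) (i : ℕ) : Prop :=
  ∀ b : Deg B.F V (i + 1), dif B.F V (i + 1) b = 0 →
    ∃ a, dif A.F V (i + 1) a = 0 ∧ ∃ c, b = φ.map V (i + 1) a + dif B.F V i c

/-- `H⁰(φ)` is injective on `A(V)`. -/
def DGA.Hom.ZeroInj (V : C) : Prop :=
  ∀ a : Deg A.F V 0, dif A.F V 0 a = 0 → φ.map V 0 a = 0 → a = 0

/-- `H⁰(φ)` is surjective on `A(V)`. -/
def DGA.Hom.ZeroSurj (V : C) : Prop :=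
  ∀ b : Deg B.F V 0, dif B.F V 0 b = 0 → ∃ a, dif A.F V 0 a = 0 ∧ φ.map V 0 a = b

variable {φ}

/-- Maurer–Cartan elements lift along a central extension. -/
theorem exists_mc_lift (EA : A.CentralExt ι p) (EB : B.CentralExt ι p) (h1 : φ.CohSurj V 0)
    (h2 : φ.CohInj V 1) (y : MC B M) (x : MC A N)
    (hyx : (LHom.ofHom B p).mc y = (LHom.ofDGA φ N).mc x) :
    ∃ z : MC A M, (LHom.ofHom A p).mc z = x ∧ ∃ g : Gauge B M, g • y = (LHom.ofDGA φ M).mc z := by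
  -- An arbitrary preimage of x, in general not a Maurer–Cartan element. Its curvature o lies in
  -- A(V)² and is the obstruction; b ∈ B(V)¹ measures how far the image of x₀ is from y.
  obtain ⟨x₀, hx₀⟩ := EA.exists_lift x.1
  have hxc : curvature A N x.1 = 0 := x.2
  have hyc : curvature B M y.1 = 0 := y.2
  obtain ⟨o, ho⟩ := EA.exists_ofDeg (x := curvature A M x₀) (by rw [LHom.map_curvature, hx₀, hxc])
  obtain ⟨b, hb⟩ := EB.exists_eq_add (x := (LHom.ofDGA φ M).map 1 x₀) (y := y.1) (by
    rw [← LHom.ofDGA_natural, hx₀]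
    exact congrArg Subtype.val hyx.symm)
  -- By the Bianchi identity do is the bracket of the central element o with x₀.
  have hod : dif A.F V 2 o = 0 := by
    apply EA.ofDeg_injective
    rw [LDeg.ofDeg_dif, ho, ldif_curvature, ← ho, EA.ofDeg_lbra, map_zero]
  -- The image of x₀ is y + b and y has curvature zero, so the obstruction becomes the coboundary db
  -- in B. Injectivity of H² makes it a coboundary dc in A already.
  have hob : φ.map V 2 o = dif B.F V 1 b := by
    apply EB.ofDeg_injective
    rw [← LHom.ofDGA_ofDeg, ho, LHom.map_curvature, hb, EB.curvature_add, hyc, zero_add]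
  obtain ⟨c, hc⟩ := h2 o hod b hob
  -- Subtracting c cancels the curvature. The image of x₁ differs from y by b − φ(c), which is a
  -- cocycle because both points are Maurer–Cartan.
  let x₁ : MC A M := ⟨x₀ + LDeg.ofDeg A ι 1 (-c), by
    have := EA.curvature_add x₀ (-c)
    rw [map_neg (dif A.F V 1), hc, map_neg (LDeg.ofDeg A ι 2), ho, add_neg_cancel] at this
    exact this⟩
  have hx₁ : ((LHom.ofDGA φ M).mc x₁).1 = y.1 + LDeg.ofDeg B ι 1 (b - φ.map V 1 c) := by
    change (LHom.ofDGA φ M).map 1 (x₀ + LDeg.ofDeg A ι 1 (-c)) = _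
    rw [_root_.map_add, hb, LHom.ofDGA_ofDeg, map_neg, map_neg, map_sub]
    abel
  -- By surjectivity of H¹, b − φ(c) = φ(a) + de. Subtracting the cocycle a from x₁ leaves the
  -- difference de, which is the effect on y of the gauge element −e.
  obtain ⟨a, ha, e, he⟩ := h1 _ (EB.dif_eq_zero hx₁)
  refine ⟨EA.addMC x₁ (-a) (by rw [map_neg, ha, neg_zero]), Subtype.ext ?_,
    Gauge.ofDeg B ι (-e), Subtype.ext ?_⟩
  · change (LHom.ofHom A p).map 1 (x₀ + LDeg.ofDeg A ι 1 (-c) + LDeg.ofDeg A ι 1 (-a)) = x.1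
    rw [_root_.map_add, _root_.map_add, EA.map_ofDeg, EA.map_ofDeg, add_zero, add_zero, hx₀]
  · rw [EB.ofDeg_smul]
    change _ = (LHom.ofDGA φ M).map 1 (x₁.1 + LDeg.ofDeg A ι 1 (-a))
    rw [_root_.map_add, LHom.ofDGA_ofDeg]
    refine Eq.trans ?_ (congrArg (· + LDeg.ofDeg B ι 1 (φ.map V 1 (-a))) hx₁.symm)
    simp only [he, _root_.map_add, map_neg]
    abel

variable (φ) in
/-- The map of deformation groupoids over `N` is full. -/
def DGA.Hom.FullAt (N : NilLie C) : Prop :=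
  ∀ (x x' : MC A N) (g : Gauge B N), g • (LHom.ofDGA φ N).mc x = (LHom.ofDGA φ N).mc x' →
    ∃ h : Gauge A N, h • x = x' ∧ (LHom.ofDGA φ N).gauge h = g

variable (φ) in
/-- The map of deformation groupoids over `N` is faithful. -/
def DGA.Hom.FaithfulAt (N : NilLie C) : Prop :=
  ∀ (x : MC A N) (g h : Gauge A N), g • x = h • x →
    (LHom.ofDGA φ N).gauge g = (LHom.ofDGA φ N).gauge h → g = h

/-- A lift of g exists over N; any lift h of it to M is wrong in two ways: h • x misses x' by some v
∈ A(V)¹, and φ(h) misses g by some b ∈ B(V)⁰. These errors satisfy φ(v) = −db, so injectivity of H¹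
and then surjectivity of H⁰ allow one correction from A(V)⁰ to repair both. -/
theorem DGA.Hom.FullAt.of_centralExt (EA : A.CentralExt ι p) (EB : B.CentralExt ι p)
    (h0 : φ.ZeroSurj V) (h1 : φ.CohInj V 0) (hN : φ.FullAt N) : φ.FullAt M := by
  intro x x' g hg
  obtain ⟨h', hx', hg'⟩ := hN ((LHom.ofHom A p).mc x) ((LHom.ofHom A p).mc x')
    ((LHom.ofHom B p).gauge g) (by
      rw [LHom.ofDGA_mc_natural, LHom.ofDGA_mc_natural, ← hg, LHom.mc_smul])
  obtain ⟨h, rfl⟩ := EA.exists_gauge_lift h'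
  rw [LHom.ofDGA_gauge_natural] at hg'
  obtain ⟨b, hb⟩ := EB.exists_eq_mul hg'
  rw [← LHom.mc_smul] at hx'
  obtain ⟨v, hv⟩ := EA.exists_eq_add (congrArg Subtype.val hx')
  -- The point φ(h • x) is computed twice: through the gauge action in B it is φ(x') − db, through A
  -- it is φ(x') + φ(v).
  have e : φ.map V 1 v = dif B.F V 0 (-b) := by
    have e1 : ((LHom.ofDGA φ M).mc (h • x)).1 =
        ((LHom.ofDGA φ M).mc x').1 - LDeg.ofDeg B ι 1 (dif B.F V 0 b) := by
      rw [LHom.mc_smul, hb, EB.mul_ofDeg_smul, hg]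
    have e2 : ((LHom.ofDGA φ M).mc (h • x)).1 =
        ((LHom.ofDGA φ M).mc x').1 + LDeg.ofDeg B ι 1 (φ.map V 1 v) := by
      rw [← LHom.ofDGA_ofDeg]
      exact (congrArg ((LHom.ofDGA φ M).map 1) hv).trans (_root_.map_add _ _ _)
    rw [e1, sub_eq_add_neg] at e2
    rw [map_neg]
    exact EB.ofDeg_injective (by rw [map_neg]; exact (add_left_cancel e2).symm)
  obtain ⟨a, rfl⟩ := h1 v (EA.dif_eq_zero hv) (-b) e
  rw [DGA.Hom.map_dif] at e
  -- Writing v = da makes φ(a) and −b primitives of the same element. Their difference is a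
  -- 0-cocycle, hence φ(c) for a cocycle c. The correction a + c moves h • x by −da, and φ(a + c) =
  -- −b.
  obtain ⟨c, hc, hc'⟩ := h0 (-b - φ.map V 0 a) (by rw [map_sub, e, sub_self])
  refine ⟨h * Gauge.ofDeg A ι (a + c), Subtype.ext ?_, ?_⟩
  · rw [EA.mul_ofDeg_smul, _root_.map_add, hc, add_zero, hv, add_sub_cancel_right]
  · apply ExpGroup.ext
    change (LHom.ofDGA φ M).map 0 (h * Gauge.ofDeg A ι (a + c)).log = g.log
    have hb' := congrArg ExpGroup.log hb
    rw [EB.mul_ofDeg_log] at hb'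
    rw [EA.mul_ofDeg_log, _root_.map_add, LHom.ofDGA_ofDeg, _root_.map_add, hc']
    change (LHom.ofDGA φ M).map 0 h.log = _ at hb'
    rw [hb', add_sub_cancel, map_neg, add_neg_cancel_right]

/-- Faithfulness over N leaves a difference a ∈ A(V)⁰ between g and h. Equal effect on x forces da =
0, equal images force φ(a) = 0, and injectivity of H⁰ gives a = 0. -/
theorem DGA.Hom.FaithfulAt.of_centralExt (EA : A.CentralExt ι p) (EB : B.CentralExt ι p)
    (h0 : φ.ZeroInj V) (hN : φ.FaithfulAt N) : φ.FaithfulAt M := by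
  intro x g h hx hg
  obtain ⟨a, rfl⟩ := EA.exists_eq_mul (hN ((LHom.ofHom A p).mc x) ((LHom.ofHom A p).gauge g)
    ((LHom.ofHom A p).gauge h) (by rw [← LHom.mc_smul, ← LHom.mc_smul, hx])
    (by rw [LHom.ofDGA_gauge_natural, LHom.ofDGA_gauge_natural, hg]))
  have e1 : dif A.F V 0 a = 0 := by
    have := congrArg Subtype.val hx
    rw [EA.mul_ofDeg_smul, sub_eq_self] at this
    exact EA.ofDeg_injective (this.trans (map_zero _).symm)
  have e2 : φ.map V 0 a = 0 := by
    have := congrArg ExpGroup.log hg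
    change (LHom.ofDGA φ M).map 0 (h * Gauge.ofDeg A ι a).log = (LHom.ofDGA φ M).map 0 h.log at this
    rw [EA.mul_ofDeg_log, _root_.map_add, LHom.ofDGA_ofDeg, add_eq_left] at this
    exact EB.ofDeg_injective (this.trans (map_zero _).symm)
  rw [h0 a e1 e2]
  apply ExpGroup.ext
  rw [EA.mul_ofDeg_log, map_zero, add_zero]

end Lifting
end CentralExtension
end TwistedDGA

/-! ### Maps on cohomology in terms of cocycles and coboundaries -/

section ComplexElements
variable (K L : CochainComplex (ModuleCat.{w} ℝ) ℕ) (f : K ⟶ L)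

namespace CochainComplex

lemma iCycles_injective (i : ℕ) : Function.Injective (K.iCycles i) :=
  (ModuleCat.mono_iff_injective _).mp inferInstance

lemma homologyπ_surjective (i : ℕ) : Function.Surjective (K.homologyπ i) :=
  (ModuleCat.epi_iff_surjective _).mp inferInstance

lemma d_iCycles_apply (i : ℕ) (z : K.cycles i) : K.d i (i + 1) (K.iCycles i z) = 0 :=
  congrArg (fun g => g.hom z) (K.iCycles_d i (i + 1))

lemma exists_iCycles_eq {i : ℕ} (x : K.X i) (hx : K.d i (i + 1) x = 0) :
    ∃ z, K.iCycles i z = x := by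
  have e : (ShortComplex.mk (K.iCycles i) (K.d i (i + 1)) (K.iCycles_d i (i + 1))).Exact :=
    ShortComplex.exact_of_f_is_kernel _ (K.cyclesIsKernel i (i + 1) (by simp))
  exact (ShortComplex.moduleCat_exact_iff _).mp e x hx

lemma homologyπ_eq_zero_iff {i : ℕ} (z : K.cycles (i + 1)) :
    K.homologyπ (i + 1) z = 0 ↔ ∃ y, K.d i (i + 1) y = K.iCycles (i + 1) z := by
  have e : (ShortComplex.mk (K.toCycles i (i + 1)) (K.homologyπ (i + 1))
      (K.toCycles_comp_homologyπ i (i + 1))).Exact :=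
    ShortComplex.exact_of_g_is_cokernel _ (K.homologyIsCokernel i (i + 1) (by simp))
  have ht : ∀ y, K.iCycles (i + 1) (K.toCycles i (i + 1) y) = K.d i (i + 1) y := fun y =>
    congrArg (fun g => g.hom y) (K.toCycles_i i (i + 1))
  constructor
  · intro h
    obtain ⟨y, hy⟩ := (ShortComplex.moduleCat_exact_iff _).mp e z h
    exact ⟨y, by rw [← ht]; exact congrArg _ hy⟩
  · rintro ⟨y, hy⟩
    rw [← ht] at hy
    rw [← K.iCycles_injective _ hy]
    exact congrArg (fun g => g.hom y) (K.toCycles_comp_homologyπ i (i + 1))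

/-- No nonzero differential enters degree 0, so a cocycle there is determined by its class. This is
why the conditions on H⁰ carry no coboundary term and are treated apart. -/
lemma homologyπ_zero_injective : Function.Injective (K.homologyπ 0) :=
  (ModuleCat.mono_iff_injective _).mp inferInstance

variable {K L}

lemma homologyMap_homologyπ (i : ℕ) (z : K.cycles i) :
    HomologicalComplex.homologyMap f i (K.homologyπ i z) =
      L.homologyπ i (HomologicalComplex.cyclesMap f i z) :=
  congrArg (fun g => g.hom z) (HomologicalComplex.homologyπ_naturality f i)

lemma iCycles_cyclesMap (i : ℕ) (z : K.cycles i) :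
    L.iCycles i (HomologicalComplex.cyclesMap f i z) = f.f i (K.iCycles i z) :=
  congrArg (fun g => g.hom z) (HomologicalComplex.cyclesMap_i f i)

lemma exists_of_homologyMap_injective {i : ℕ}
    (h : Function.Injective (HomologicalComplex.homologyMap f (i + 1))) {a : K.X (i + 1)}
    (ha : K.d (i + 1) (i + 1 + 1) a = 0) {b : L.X i} (hb : f.f (i + 1) a = L.d i (i + 1) b) :
    ∃ c, K.d i (i + 1) c = a := by
  obtain ⟨z, rfl⟩ := K.exists_iCycles_eq a ha
  refine (K.homologyπ_eq_zero_iff z).mp (h ?_)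
  rw [homologyMap_homologyπ, map_zero, homologyπ_eq_zero_iff]
  exact ⟨b, by rw [iCycles_cyclesMap, hb]⟩

lemma exists_of_homologyMap_surjective {i : ℕ}
    (h : Function.Surjective (HomologicalComplex.homologyMap f (i + 1))) {b : L.X (i + 1)}
    (hb : L.d (i + 1) (i + 1 + 1) b = 0) :
    ∃ a, K.d (i + 1) (i + 1 + 1) a = 0 ∧ ∃ c, b = f.f (i + 1) a + L.d i (i + 1) c := by
  obtain ⟨z, rfl⟩ := L.exists_iCycles_eq b hb
  obtain ⟨t, ht⟩ := h (L.homologyπ (i + 1) z)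
  obtain ⟨y, rfl⟩ := K.homologyπ_surjective (i + 1) t
  -- The sign is switched so that c bounds b − f(y), which is the form needed in the conclusion.
  rw [homologyMap_homologyπ, ← sub_eq_zero, ← map_sub, ← neg_eq_zero, ← map_neg,
    homologyπ_eq_zero_iff] at ht
  obtain ⟨c, hc⟩ := ht
  refine ⟨K.iCycles (i + 1) y, K.d_iCycles_apply _ y, c, ?_⟩
  rw [hc, ← iCycles_cyclesMap, ← map_add]
  congr 1
  abel

lemma homologyMap_zero_injective_iff :
    Function.Injective (HomologicalComplex.homologyMap f 0) ↔
      ∀ a : K.X 0, K.d 0 1 a = 0 → f.f 0 a = 0 → a = 0 := by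
  constructor
  · intro h a ha hf
    obtain ⟨z, rfl⟩ := K.exists_iCycles_eq a ha
    have : z = 0 := by
      apply K.homologyπ_zero_injective
      apply h
      rw [homologyMap_homologyπ, map_zero, map_zero]
      have : HomologicalComplex.cyclesMap f 0 z = 0 := by
        apply L.iCycles_injective
        rw [iCycles_cyclesMap, hf, map_zero]
      rw [this, map_zero]
    rw [this, map_zero]
  · intro h
    refine (injective_iff_map_eq_zero _).mpr fun t ht => ?_
    obtain ⟨z, rfl⟩ := K.homologyπ_surjective 0 t
    rw [homologyMap_homologyπ] at ht
    have h0 : HomologicalComplex.cyclesMap f 0 z = 0 :=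
      L.homologyπ_zero_injective (ht.trans (map_zero _).symm)
    have hz : z = 0 := by
      apply K.iCycles_injective
      rw [map_zero]
      exact h _ (K.d_iCycles_apply 0 z) (by rw [← iCycles_cyclesMap, h0, map_zero])
    rw [hz, map_zero]

lemma homologyMap_zero_surjective_iff :
    Function.Surjective (HomologicalComplex.homologyMap f 0) ↔
      ∀ b : L.X 0, L.d 0 1 b = 0 → ∃ a, K.d 0 1 a = 0 ∧ f.f 0 a = b := by
  constructor
  · intro h b hb
    obtain ⟨z, rfl⟩ := L.exists_iCycles_eq b hb
    obtain ⟨t, ht⟩ := h (L.homologyπ 0 z)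
    obtain ⟨y, rfl⟩ := K.homologyπ_surjective 0 t
    rw [homologyMap_homologyπ] at ht
    refine ⟨K.iCycles 0 y, K.d_iCycles_apply 0 y, ?_⟩
    rw [← iCycles_cyclesMap, L.homologyπ_zero_injective ht]
  · intro h t
    obtain ⟨z, rfl⟩ := L.homologyπ_surjective 0 t
    obtain ⟨a, ha, hab⟩ := h _ (L.d_iCycles_apply 0 z)
    obtain ⟨y, rfl⟩ := K.exists_iCycles_eq a ha
    refine ⟨K.homologyπ 0 y, ?_⟩
    rw [homologyMap_homologyπ]
    congr 1
    apply L.iCycles_injective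
    rw [iCycles_cyclesMap, hab]

end CochainComplex
end ComplexElements

/-! ### Cohomological hypotheses on a morphism of DGAs -/

namespace TwistedDGA
variable {C : Type u₁} [Category.{v₁} C] [Preadditive C] [MonoidalCategory C]
  [SymmetricCategory C] {A B : DGA.{w} C} (φ : DGA.Hom A B) (V : C)

lemma DGA.Hom.cohInj {i : ℕ} (h : Function.Injective ((cohomologyMap φ (i + 1)).app V)) :
    φ.CohInj V i := fun _ ha _ hb =>
  CochainComplex.exists_of_homologyMap_injective (φ.nat.app V) h ha hb

lemma DGA.Hom.cohSurj {i : ℕ} (h : Function.Surjective ((cohomologyMap φ (i + 1)).app V)) :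
    φ.CohSurj V i := fun _ hb =>
  CochainComplex.exists_of_homologyMap_surjective (φ.nat.app V) h hb

lemma DGA.Hom.zeroInj_iff : φ.ZeroInj V ↔ Function.Injective ((cohomologyMap φ 0).app V) :=
  (CochainComplex.homologyMap_zero_injective_iff (φ.nat.app V)).symm

lemma DGA.Hom.zeroSurj_iff : φ.ZeroSurj V ↔ Function.Surjective ((cohomologyMap φ 0).app V) :=
  (CochainComplex.homologyMap_zero_surjective_iff (φ.nat.app V)).symm

lemma isIso_cohomologyMap_zero_iff :
    IsIso (cohomologyMap φ 0) ↔ ∀ V, φ.ZeroInj V ∧ φ.ZeroSurj V := by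
  rw [NatTrans.isIso_iff_isIso_app]
  refine forall_congr' fun V => ?_
  rw [DGA.Hom.zeroInj_iff, DGA.Hom.zeroSurj_iff]
  exact ConcreteCategory.isIso_iff_bijective _

end TwistedDGA

namespace TwistedDGA

/-! ### Subcomodules and quotient comodules -/

section Comodules
variable {k : Type*} [CommRing k] {H : Type*} [CommRing H] [HopfAlgebra k H]
variable {V W : Type*} [AddCommGroup V] [Module k V] [AddCommGroup W] [Module k W]
  {ρ : V →ₗ[k] V ⊗[k] H} {σ : W →ₗ[k] W ⊗[k] H} {f : V →ₗ[k] W}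

/-- Together with `IsColinear.rTensor_comul` and `IsColinear.map_counit` this says that f carries
both sides of each comodule axiom for ρ to the corresponding sides for σ. The axioms therefore
descend along surjections and can be tested after injections. -/
lemma IsColinear.rTensor_assoc (h : IsColinear ρ σ f) (v : V) :
    f.rTensor (H ⊗[k] H) (TensorProduct.assoc k V H H (ρ.rTensor H (ρ v))) =
      TensorProduct.assoc k W H H (σ.rTensor H (σ (f v))) := by
  have h1 : ∀ t : V ⊗[k] H, f.rTensor (H ⊗[k] H) (TensorProduct.assoc k V H H (ρ.rTensor H t)) =
      TensorProduct.assoc k W H H (σ.rTensor H (f.rTensor H t)) := by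
    intro t
    induction t with
    | zero => simp
    | add x y hx hy => simp only [map_add, hx, hy]
    | tmul v a =>
      have h2 : ∀ t : V ⊗[k] H, f.rTensor (H ⊗[k] H) (TensorProduct.assoc k V H H (t ⊗ₜ a)) =
          TensorProduct.assoc k W H H (f.rTensor H t ⊗ₜ a) := by
        intro t
        induction t with
        | zero => simp
        | add x y hx hy => simp only [map_add, add_tmul, hx, hy]
        | tmul v b => rfl
      rw [LinearMap.rTensor_tmul, h2, LinearMap.rTensor_tmul, LinearMap.rTensor_tmul, h]
  rw [h1, h]

lemma IsColinear.rTensor_comul (h : IsColinear ρ σ f) (v : V) :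
    f.rTensor (H ⊗[k] H) ((Coalgebra.comul (R := k) (A := H)).lTensor V (ρ v)) =
      (Coalgebra.comul (R := k) (A := H)).lTensor W (σ (f v)) := by
  rw [h]
  induction ρ v with
  | zero => simp
  | add x y hx hy => simp only [map_add, hx, hy]
  | tmul v a => rfl

lemma IsColinear.map_counit (h : IsColinear ρ σ f) (v : V) :
    f (TensorProduct.rid k V ((Coalgebra.counit (R := k) (A := H)).lTensor V (ρ v))) =
      TensorProduct.rid k W ((Coalgebra.counit (R := k) (A := H)).lTensor W (σ (f v))) := by
  rw [h]
  induction ρ v with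
  | zero => simp
  | add x y hx hy => simp only [map_add, hx, hy]
  | tmul v a => simp

lemma IsCoaction.of_surjective (hf : Function.Surjective f) (h : IsColinear ρ σ f)
    (hρ : IsCoaction ρ) : IsCoaction σ where
  coassoc w := by
    obtain ⟨v, rfl⟩ := hf w
    rw [← h.rTensor_assoc, hρ.coassoc, h.rTensor_comul]
  counit w := by
    obtain ⟨v, rfl⟩ := hf w
    rw [← h.map_counit, hρ.counit]

/-- Coassociativity is an equation in V ⊗ (H ⊗ H); flatness keeps f injective after this tensor
product. -/
lemma IsCoaction.of_injective [Module.Flat k H] (hf : Function.Injective f)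
    (h : IsColinear ρ σ f) (hσ : IsCoaction σ) : IsCoaction ρ where
  coassoc v := by
    apply Module.Flat.rTensor_preserves_injective_linearMap (M := H ⊗[k] H) f hf
    rw [h.rTensor_assoc, hσ.coassoc, h.rTensor_comul]
  counit v := by
    apply hf
    rw [h.map_counit, hσ.counit]

/-- The kernel of a map of comodules over a flat Hopf algebra is a comodule. -/
lemma IsColinear.exists_coaction_ker [Module.Flat k H] (h : IsColinear ρ σ f) :
    ∃ τ : LinearMap.ker f →ₗ[k] LinearMap.ker f ⊗[k] H,
      IsColinear τ ρ (LinearMap.ker f).subtype := by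
  have hi := Module.Flat.rTensor_preserves_injective_linearMap (M := H)
    (LinearMap.ker f).subtype Subtype.val_injective
  have he := Module.Flat.rTensor_exact H (LinearMap.exact_subtype_ker_map f)
  -- For v in the kernel, f ⊗ H kills ρ(v); by flatness the kernel of f ⊗ H is the image of ker f ⊗
  -- H. This inclusion is injective, so inverting it on its range gives the coaction.
  have hρ : ∀ v : LinearMap.ker f, ρ v.1 ∈
      LinearMap.range ((LinearMap.ker f).subtype.rTensor H) := fun v =>
    (he _).mp (by rw [← h]; exact (congrArg σ v.2).trans (map_zero σ))
  refine ⟨(LinearEquiv.ofInjective _ hi).symm.toLinearMap ∘ₗ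
    LinearMap.codRestrict _ (ρ ∘ₗ (LinearMap.ker f).subtype) hρ, fun v => ?_⟩
  exact (congrArg Subtype.val
    ((LinearEquiv.ofInjective _ hi).apply_symm_apply ⟨ρ v.1, hρ v⟩)).symm

end Comodules

/-! ### Kernels, quotients and central factorisation in 𝒩(G) -/

section Representations
variable {k : Type u} [Field k] {H : Type v} [CommRing H] [HopfAlgebra k H]

lemma GRep.exists_kernel {V W : GRep k H} (f : V ⟶ W) :
    ∃ (K : GRep k H) (ι : K ⟶ V), Function.Injective (GRep.lin ι) ∧
      Function.Exact (GRep.lin ι) (GRep.lin f) := by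
  obtain ⟨τ, hτ⟩ := IsColinear.exists_coaction_ker (GRep.Hom.colinear f)
  exact ⟨{ carrier := LinearMap.ker (GRep.lin f)
           finite := inferInstanceAs (FiniteDimensional k
             (LinearMap.ker (GRep.lin f : V.carrier →ₗ[k] W.carrier)))
           coact := τ
           isCoaction := IsCoaction.of_injective Subtype.val_injective hτ V.isCoaction },
    GRep.ofLin _ hτ, Subtype.val_injective, LinearMap.exact_subtype_ker_map _⟩

namespace NLie

/-- The projection to the quotient of a Lie algebra by an ideal. -/
def mkQuotient {L : Type*} [LieRing L] [LieAlgebra k L] (I : LieIdeal k L) : L →ₗ⁅k⁆ L ⧸ I :=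
  { I.toSubmodule.mkQ with map_lie' := rfl }

/-- The quotient by an ideal that is a subrepresentation. -/
noncomputable def quotient (M : NLie k H) (I : LieIdeal k M.carrier)
    (hI : ∀ x ∈ I, I.toSubmodule.mkQ.rTensor H (M.coact x) = 0) : NLie k H :=
  let ρ : M.carrier ⧸ I →ₗ[k] (M.carrier ⧸ I) ⊗[k] H :=
    I.toSubmodule.liftQ (I.toSubmodule.mkQ.rTensor H ∘ₗ M.coact) hI
  have hρ : IsColinear M.coact ρ I.toSubmodule.mkQ := fun _ => rfl
  { carrier := M.carrier ⧸ I
    finite := inferInstanceAs (FiniteDimensional k (M.carrier ⧸ I.toSubmodule))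
    nilpotent := Function.Surjective.lieAlgebra_isNilpotent (f := mkQuotient I)
      I.toSubmodule.mkQ_surjective
    coact := ρ
    isCoaction := IsCoaction.of_surjective I.toSubmodule.mkQ_surjective hρ M.isCoaction
    colinear_bracket := by
      intro t
      -- Equivariance of the bracket is tested on M ⊗ M, which surjects onto the tensor square of
      -- the quotient.
      obtain ⟨s, rfl⟩ := TensorProduct.map_surjective I.toSubmodule.mkQ_surjective
        I.toSubmodule.mkQ_surjective t
      have e : brLin k (M.carrier ⧸ I) ∘ₗ TensorProduct.map I.toSubmodule.mkQ I.toSubmodule.mkQ =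
          I.toSubmodule.mkQ ∘ₗ brLin k M.carrier := TensorProduct.ext' fun _ _ => rfl
      have e' := fun s => LinearMap.congr_fun e s
      simp only [LinearMap.comp_apply] at e'
      rw [e', hρ.tensor hρ s, ← LinearMap.comp_apply (LinearMap.rTensor H _),
        ← LinearMap.rTensor_comp, e]
      exact hρ.comp M.colinear_bracket s }

variable {M N : NLie k H}

/-- The projection to the quotient by an ideal. -/
noncomputable def toQuotient (M : NLie k H) (I : LieIdeal k M.carrier)
    (hI : ∀ x ∈ I, I.toSubmodule.mkQ.rTensor H (M.coact x) = 0) : M ⟶ M.quotient I hI :=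
  NLie.Hom.mk (mkQuotient I) fun _ => rfl

lemma toQuotient_surjective (M : NLie k H) (I : LieIdeal k M.carrier)
    (hI : ∀ x ∈ I, I.toSubmodule.mkQ.rTensor H (M.coact x) = 0) :
    Function.Surjective (lieHom (M.toQuotient I hI)) := I.toSubmodule.mkQ_surjective

lemma ker_toQuotient (M : NLie k H) (I : LieIdeal k M.carrier)
    (hI : ∀ x ∈ I, I.toSubmodule.mkQ.rTensor H (M.coact x) = 0) :
    (lieHom (M.toQuotient I hI)).ker = I := by
  ext x
  exact Submodule.Quotient.mk_eq_zero I.toSubmodule (x := x)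

/-- Equivariant homomorphisms that vanish on an ideal factor through the quotient. -/
lemma exists_toQuotient_comp (I : LieIdeal k M.carrier)
    (hI : ∀ x ∈ I, I.toSubmodule.mkQ.rTensor H (M.coact x) = 0) (p : M ⟶ N)
    (hp : I ≤ (lieHom p).ker) : ∃ r : M.quotient I hI ⟶ N, M.toQuotient I hI ≫ r = p := by
  let l : M.carrier ⧸ I →ₗ[k] N.carrier :=
    I.toSubmodule.liftQ (lieHom p : M.carrier →ₗ[k] N.carrier) fun x hx => hp hx
  refine ⟨NLie.Hom.mk { l with map_lie' := ?_ } ?_, NLie.Hom.ext (LieHom.ext fun _ => rfl)⟩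
  · intro x y
    obtain ⟨x, rfl⟩ := I.toSubmodule.mkQ_surjective x
    obtain ⟨y, rfl⟩ := I.toSubmodule.mkQ_surjective y
    exact (lieHom p).map_lie x y
  · intro x
    obtain ⟨x, rfl⟩ := I.toSubmodule.mkQ_surjective x
    refine (NLie.Hom.colinear p x).trans ?_
    change _ = l.rTensor H (I.toSubmodule.mkQ.rTensor H (M.coact x))
    exact LinearMap.congr_fun (LinearMap.rTensor_comp H l I.toSubmodule.mkQ) (M.coact x)

/-- The ideal `[M, ker p]` is a subrepresentation. -/
lemma rTensor_coact_lie_ker (p : M ⟶ N) :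
    ∀ x ∈ ⁅(⊤ : LieIdeal k M.carrier), (lieHom p).ker⁆,
      (⁅(⊤ : LieIdeal k M.carrier), (lieHom p).ker⁆).toSubmodule.mkQ.rTensor H (M.coact x) = 0 := by
  set K := (lieHom p).ker
  set I := ⁅(⊤ : LieIdeal k M.carrier), K⁆ with hI
  have he := Module.Flat.rTensor_exact (M := H)
    (LinearMap.exact_subtype_ker_map (lieHom p : M.carrier →ₗ[k] N.carrier))
  -- The bracket with coefficients in O(G): pairing M ⊗ H with ker p ⊗ H lands in [M, ker p] ⊗ H,
  -- hence dies modulo the ideal.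
  have key : ∀ (s : M.carrier ⊗[k] H) (t : K.toSubmodule ⊗[k] H),
      (I.toSubmodule.mkQ ∘ₗ brLin k M.carrier).rTensor H
        (tprod H _ _ s (K.toSubmodule.subtype.rTensor H t)) = 0 := by
    intro s t
    induction s with
    | zero => simp
    | add x y hx hy => simp only [map_add, LinearMap.add_apply, hx, hy, add_zero]
    | tmul m a =>
      induction t with
      | zero => simp
      | add x y hx hy => simp only [map_add, hx, hy, add_zero]
      | tmul n b =>
        have h0 : (I.toSubmodule.mkQ ∘ₗ brLin k M.carrier) (m ⊗ₜ K.toSubmodule.subtype n) = 0 :=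
          (Submodule.Quotient.mk_eq_zero I.toSubmodule).mpr
            (LieSubmodule.lie_mem_lie (LieSubmodule.mem_top m) n.2)
        rw [LinearMap.rTensor_tmul, tprod_tmul, LinearMap.rTensor_tmul, h0, zero_tmul]
  intro x hx
  rw [hI, ← LieSubmodule.mem_toSubmodule, LieSubmodule.lieIdeal_oper_eq_linear_span'] at hx
  refine (Submodule.span_le (p := LinearMap.ker (I.toSubmodule.mkQ.rTensor H ∘ₗ M.coact))).mpr
    ?_ hx
  rintro _ ⟨m, _, n, hn, rfl⟩
  -- The coaction of n ∈ ker p is killed by p ⊗ H, so flatness places it in ker p ⊗ H. Since the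
  -- coaction of ⁅m, n⁆ is the bracket of the coactions of m and n, the previous computation
  -- applies.
  have hn' : (lieHom p : M.carrier →ₗ[k] N.carrier).rTensor H (M.coact n) = 0 := by
    refine (NLie.Hom.colinear p n).symm.trans ?_
    exact (congrArg N.coact hn).trans (map_zero _)
  obtain ⟨t, ht⟩ := (he _).mp hn'
  have h1 : M.coact ⁅m, n⁆ = _ := M.colinear_bracket (m ⊗ₜ n)
  change I.toSubmodule.mkQ.rTensor H (M.coact ⁅m, n⁆) = 0
  rw [h1, ← LinearMap.comp_apply, ← LinearMap.rTensor_comp, tcoact_tmul, ← ht]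
  exact key _ t

/-- A property of surjections that holds for central extensions and is stable under composition
holds for all surjections. -/
theorem surjective_induction {P : ∀ {M N : NLie k H}, (M ⟶ N) → Prop}
    (central : ∀ {M N : NLie k H} (p : M ⟶ N), Function.Surjective (lieHom p) →
      (∀ (m : M.carrier) (n : M.carrier), lieHom p n = 0 → ⁅m, n⁆ = 0) → P p)
    (comp : ∀ {M N Q : NLie k H} (p : M ⟶ N) (q : N ⟶ Q), P p → P q → P (p ≫ q))
    {M N : NLie k H} (p : M ⟶ N) (hp : Function.Surjective (lieHom p)) : P p := by
  -- The induction is on the number of brackets with M that annihilate ker p; it is finite because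
  -- these iterates lie in the lower central series of M.
  obtain ⟨n, hn⟩ : ∃ n, LieSubmodule.lcs n (lieHom p).ker = ⊥ := by
    obtain ⟨n, hn⟩ := (LieModule.isNilpotent_iff k M.carrier M.carrier).mp M.nilpotent
    have h : ∀ n, LieSubmodule.lcs n (lieHom p).ker ≤
        LieModule.lowerCentralSeries k M.carrier M.carrier n := by
      intro n
      induction n with
      | zero => exact le_top
      | succ n ih =>
        rw [LieSubmodule.lcs_succ, LieModule.lowerCentralSeries_succ]
        exact LieSubmodule.mono_lie_right ⊤ ih
    exact ⟨n, eq_bot_iff.mpr ((h n).trans hn.le)⟩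
  induction n generalizing M N with
  | zero =>
    -- With no bracket needed the kernel itself is zero, so p is trivially central.
    refine central p hp fun m n h0 => ?_
    have : n ∈ (lieHom p).ker := h0
    rw [LieSubmodule.lcs_zero] at hn
    rw [hn, LieSubmodule.mem_bot] at this
    rw [this, lie_zero]
  | succ n ih =>
    have hI := rTensor_coact_lie_ker p
    obtain ⟨r, hr⟩ := exists_toQuotient_comp _ hI p (LieSubmodule.lie_le_right _ _)
    have hr' : ∀ x, lieHom r (lieHom (M.toQuotient _ hI) x) = lieHom p x :=
      fun x => congrArg (fun f => lieHom f x) hr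
    rw [← hr]
    -- In M → M / [M, ker p] → N the first map has kernel [M, ker p], which needs one bracket less.
    -- The second is central because brackets with elements of ker p have been divided out.
    refine comp _ _ (ih _ (M.toQuotient_surjective _ hI) ?_) (central _ ?_ ?_)
    · rw [ker_toQuotient, ← hn]
      exact (Function.iterate_succ_apply _ n _).symm
    · intro y
      obtain ⟨x, rfl⟩ := hp y
      exact ⟨_, hr' x⟩
    · intro x y hy
      obtain ⟨x, rfl⟩ := M.toQuotient_surjective _ hI x
      obtain ⟨y, rfl⟩ := M.toQuotient_surjective _ hI y
      rw [hr'] at hy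
      rw [← LieHom.map_lie]
      refine (Submodule.Quotient.mk_eq_zero _).mpr ?_
      exact LieSubmodule.lie_mem_lie (LieSubmodule.mem_top x) hy

/-- The zero object. -/
noncomputable def zero : NLie k H :=
  GRep.eps { carrier := PUnit, coact := 0, isCoaction := ⟨fun _ => by simp, fun _ => rfl⟩ }

/-- The map to the zero object. -/
noncomputable def toZero (M : NLie k H) : M ⟶ zero :=
  NLie.Hom.mk (0 : M.carrier →ₗ⁅k⁆ (zero (k := k) (H := H)).carrier) fun v => by
    rw [show ((0 : M.carrier →ₗ⁅k⁆ (zero (k := k) (H := H)).carrier) :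
      M.carrier →ₗ[k] (zero (k := k) (H := H)).carrier) = 0 from rfl, LinearMap.rTensor_zero]
    rfl

lemma toZero_surjective (M : NLie k H) : Function.Surjective (lieHom M.toZero) :=
  fun _ => ⟨0, rfl⟩

end NLie
end Representations
end TwistedDGA

namespace TwistedDGA
open Malcev

/-! ### Extracting H⁰ and H¹ from deformations -/

section CentralExtension
variable {C : Type u₁} [Category.{v₁} C] [Preadditive C] [MonoidalCategory C]
  [SymmetricCategory C] {A B : DGA.{w} C} {φ : DGA.Hom A B} {V : C} {M N : NilLie C}
  {ι : V ⟶ M.X} {p : M ⟶ N}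

/-- The trivial Maurer–Cartan element. -/
noncomputable instance (A : DGA.{w} C) (N : NilLie C) : Zero (MC A N) := ⟨0, by simp⟩

lemma LHom.mc_zero (F : LHom A M B N) : F.mc 0 = 0 := Subtype.ext (_root_.map_zero (F.map 1))

/-- The automorphisms of the trivial deformation that come from `A(V)⁰` are the cocycles. -/
lemma DGA.CentralExt.ofDeg_smul_zero_iff (E : A.CentralExt ι p) (a : Deg A.F V 0) :
    Gauge.ofDeg A ι a • (0 : MC A M) = 0 ↔ dif A.F V 0 a = 0 := by
  rw [show Gauge.ofDeg A ι a • (0 : MC A M) = 0 ↔ _ from Subtype.ext_iff, E.ofDeg_smul, sub_eq_self]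
  exact ⟨fun h => E.ofDeg_injective (h.trans (map_zero _).symm), fun h => by rw [h, map_zero]⟩

lemma LHom.ofDGA_gauge_ofDeg (φ : DGA.Hom A B) (a : Deg A.F V 0) :
    (LHom.ofDGA φ M).gauge (Gauge.ofDeg A ι a) = Gauge.ofDeg B ι (φ.map V 0 a) :=
  ExpGroup.ext (LHom.ofDGA_ofDeg φ 0 a)

/-- A 0-cocycle killed by φ gives an automorphism of the trivial deformation with the same image as
the identity. -/
lemma DGA.Hom.FaithfulAt.zeroInj (E : A.CentralExt ι p) (h : φ.FaithfulAt M) : φ.ZeroInj V := by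
  intro a ha hφ
  have e := h 0 (Gauge.ofDeg A ι a) 1 (by rw [(E.ofDeg_smul_zero_iff a).mpr ha, one_smul]) (by
    rw [map_one, LHom.ofDGA_gauge_ofDeg, hφ]
    exact ExpGroup.ext (map_zero _))
  exact E.ofDeg_injective ((congrArg ExpGroup.log e).trans (map_zero _).symm)

/-- A 0-cocycle of B(V) is an automorphism of the trivial deformation, and fullness lifts it to A.
Since A(N)⁰ = 0, the lift comes from A(V)⁰, and it is a cocycle because it fixes 0. -/
lemma DGA.Hom.FullAt.zeroSurj [Subsingleton (LDeg A N 0)] (EA : A.CentralExt ι p)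
    (EB : B.CentralExt ι p) (h : φ.FullAt M) : φ.ZeroSurj V := by
  intro b hb
  obtain ⟨g, hg, hg'⟩ := h 0 0 (Gauge.ofDeg B ι b)
    (by rw [LHom.mc_zero, (EB.ofDeg_smul_zero_iff b).mpr hb])
  obtain ⟨a, ha⟩ := EA.exists_ofDeg (x := g.log) (Subsingleton.elim _ _)
  obtain rfl : Gauge.ofDeg A ι a = g := ExpGroup.ext ha
  refine ⟨a, (EA.ofDeg_smul_zero_iff a).mp hg, EB.ofDeg_injective ?_⟩
  rw [LHom.ofDGA_gauge_ofDeg] at hg'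
  exact congrArg ExpGroup.log hg'

/-- The map of deformation sets over an extension of zero is injective if `H¹(φ)` is. -/
lemma DGA.Hom.CohInj.defMap_injective [Subsingleton (LDeg A N 1)] [Subsingleton (LDeg B N 0)]
    (EA : A.CentralExt ι p) (EB : B.CentralExt ι p) (h1 : φ.CohInj V 0) :
    Function.Injective (LHom.ofDGA φ M).defMap := by
  intro x x' h
  obtain ⟨x, rfl⟩ := Quotient.exists_rep x
  obtain ⟨x', rfl⟩ := Quotient.exists_rep x'
  obtain ⟨g, hg⟩ := Quotient.exact h
  -- As A(N)¹ and B(N)⁰ vanish, both the difference of the two points and the gauge element that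
  -- identifies their images come from V. The action is then translation by coboundaries, and what
  -- remains is that φ(v) = d(−b) forces v = dc.
  obtain ⟨v, hv⟩ := EA.exists_eq_add (x := x.1) (y := x'.1) (Subsingleton.elim _ _)
  obtain ⟨b, hb⟩ := EB.exists_ofDeg (x := g.log) (Subsingleton.elim _ _)
  obtain rfl : Gauge.ofDeg B ι b = g := ExpGroup.ext hb
  have h2 : ((LHom.ofDGA φ M).mc x).1 =
      ((LHom.ofDGA φ M).mc x').1 - LDeg.ofDeg B ι 1 (dif B.F V 0 b) := by
    rw [← EB.ofDeg_smul]
    exact congrArg Subtype.val hg.symm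
  have h3 : ((LHom.ofDGA φ M).mc x).1 =
      ((LHom.ofDGA φ M).mc x').1 + LDeg.ofDeg B ι 1 (φ.map V 1 v) := by
    rw [← LHom.ofDGA_ofDeg]
    exact (congrArg ((LHom.ofDGA φ M).map 1) hv).trans (_root_.map_add _ _ _)
  rw [h2, sub_eq_add_neg, ← map_neg] at h3
  obtain ⟨c, hc⟩ := h1 v (EA.dif_eq_zero hv) (-b) (by
    rw [map_neg]
    exact (EB.ofDeg_injective (add_left_cancel h3)).symm)
  -- The gauge element −c carries x' to x' + dc = x' + v = x.
  refine Quotient.sound ⟨Gauge.ofDeg A ι (-c), Subtype.ext ?_⟩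
  refine (EA.ofDeg_smul _ _).trans ?_
  rw [map_neg, hc, map_neg, sub_neg_eq_add, hv]

end CentralExtension

/-! ### Gauge conditions and functors of groupoids -/

section Groupoid
variable {C : Type u₁} [Category.{v₁} C] [Preadditive C] [MonoidalCategory C]
  [SymmetricCategory C] {A B : DGA.{w} C} (φ : DGA.Hom A B) (N : NilLie C)

lemma DGA.Hom.fullAt_iff : φ.FullAt N ↔ (LHom.ofDGA φ N).grpdMap.Full := by
  constructor
  · intro h
    refine ⟨fun {x y} f => ?_⟩
    obtain ⟨g, hg, hg'⟩ := h x.pt y.pt (DefGrpd.Hom.g f) (DefGrpd.Hom.eq f)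
    exact ⟨DefGrpd.Hom.mk g hg, DefGrpd.hom_ext hg'⟩
  · intro h x x' g hg
    obtain ⟨f, hf⟩ := (LHom.ofDGA φ N).grpdMap.map_surjective (X := ⟨x⟩) (Y := ⟨x'⟩)
      (DefGrpd.Hom.mk (x := ⟨_⟩) (y := ⟨_⟩) g hg)
    exact ⟨DefGrpd.Hom.g f, DefGrpd.Hom.eq f, congrArg DefGrpd.Hom.g hf⟩

lemma DGA.Hom.faithfulAt_iff : φ.FaithfulAt N ↔ (LHom.ofDGA φ N).grpdMap.Faithful := by
  constructor
  · intro h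
    refine ⟨fun {x y} f g e => DefGrpd.hom_ext (h x.pt _ _ ?_ (congrArg DefGrpd.Hom.g e))⟩
    rw [DefGrpd.Hom.eq f, DefGrpd.Hom.eq g]
  · intro h x g g' e e'
    -- The common target is taken to be g' • x, which makes g and g' parallel morphisms.
    exact congrArg DefGrpd.Hom.g ((LHom.ofDGA φ N).grpdMap.map_injective (X := ⟨x⟩) (Y := ⟨g' • x⟩)
      (a₁ := DefGrpd.Hom.mk g e) (a₂ := DefGrpd.Hom.mk g' rfl) (DefGrpd.hom_ext e'))

/-- Isomorphism classes of the groupoid are the gauge orbits, so surjectivity on orbits is essential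
surjectivity. -/
lemma LHom.grpdMap_essSurj {A B : DGA.{w} C} {M N : NilLie C} (F : LHom A M B N)
    (h : Function.Surjective F.defMap) : F.grpdMap.EssSurj := by
  refine ⟨fun y => ?_⟩
  obtain ⟨x, hx⟩ := h (Quotient.mk _ y.pt)
  obtain ⟨x, rfl⟩ := Quotient.exists_rep x
  obtain ⟨g, hg⟩ := Quotient.exact hx
  exact ⟨⟨x⟩, ⟨((Groupoid.isoEquivHom y (F.grpdMap.obj ⟨x⟩)).symm
    (DefGrpd.Hom.mk (x := y) (y := ⟨F.mc x⟩) g hg)).symm⟩⟩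

/-- A gauge element that identifies two images lifts to one that identifies the points themselves.
-/
lemma DGA.Hom.FullAt.defMap_injective {φ : DGA.Hom A B} {N : NilLie C} (h : φ.FullAt N) :
    Function.Injective (LHom.ofDGA φ N).defMap := by
  intro x x' e
  obtain ⟨x, rfl⟩ := Quotient.exists_rep x
  obtain ⟨x', rfl⟩ := Quotient.exists_rep x'
  obtain ⟨g, hg⟩ := Quotient.exact e
  obtain ⟨g', hg', -⟩ := h x' x g hg
  exact Quotient.sound ⟨g', hg'⟩

end Groupoid
-- Flat DGAs over Rep(G): from central extensions to all of 𝒩(G)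
variable {k : Type u} [Field k] {H : Type v} [CommRing H] [HopfAlgebra k H]

/-- The nilpotent Lie algebra in `Rep(G)` underlying an object of `𝒩(G)`. -/
noncomputable abbrev NLie.nil (N : NLie k H) : NilLie (GRep k H) := (NLie.toNilFunctor k H).obj N

/-- A flat DGA carries central extensions in `𝒩(G)` to central extensions. -/
lemma DGA.Flat.centralExt {A : DGA.{w} (GRep k H)} (hA : A.Flat) {M N : NLie k H} (p : M ⟶ N)
    (hp : Function.Surjective (NLie.lieHom p)) {V : GRep k H} (ι : V ⟶ M.nil.X)
    (hι : Function.Injective (GRep.lin ι))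
    (he : Function.Exact (GRep.lin ι) (GRep.lin ((NLie.toNilFunctor k H).map p).hom))
    (hc : ∀ m n : M.carrier, NLie.lieHom p n = 0 → ⁅m, n⁆ = 0) :
    A.CentralExt (M := M.nil) (N := N.nil) ι ((NLie.toNilFunctor k H).map p) where
  central := by
    apply GRep.lin_injective
    refine TensorProduct.ext' fun m v => ?_
    exact hc m (GRep.lin ι v) (he.apply_apply_eq_zero v)
  injective i := (hA _ _ _ ι ((NLie.toNilFunctor k H).map p).hom hι he hp i).1
  exact i := (hA _ _ _ ι ((NLie.toNilFunctor k H).map p).hom hι he hp i).2.1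
  surjective i := (hA _ _ _ ι ((NLie.toNilFunctor k H).map p).hom hι he hp i).2.2

/-- Surjections with central kernel give central extensions for flat DGAs. -/
lemma NLie.exists_centralExt {A B : DGA.{w} (GRep k H)} (hA : A.Flat) (hB : B.Flat) {M N : NLie k H}
    (p : M ⟶ N) (hp : Function.Surjective (NLie.lieHom p))
    (hc : ∀ m n : M.carrier, NLie.lieHom p n = 0 → ⁅m, n⁆ = 0) :
    ∃ (V : GRep k H) (ι : V ⟶ M.nil.X),
      A.CentralExt (N := N.nil) ι ((NLie.toNilFunctor k H).map p) ∧
      B.CentralExt (N := N.nil) ι ((NLie.toNilFunctor k H).map p) := by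
  obtain ⟨V, ι, hι, he⟩ := GRep.exists_kernel ((NLie.toNilFunctor k H).map p).hom
  exact ⟨V, ι, hA.centralExt p hp ι hι he hc, hB.centralExt p hp ι hι he hc⟩

/-- The identity of the zero representation is the zero map, and an additive functor sends it to
both 1 and 0. All inductions over N → 0 start from this. -/
instance (A : DGA.{w} (GRep k H)) (n : ℕ) :
    Subsingleton (LDeg A (NLie.zero (k := k) (H := H)).nil n) := by
  refine subsingleton_of_forall_eq 0 fun a => ?_
  have h : 𝟙 (NLie.zero (k := k) (H := H)).nil.X = 0 :=
    GRep.lin_injective (LinearMap.ext fun _ => rfl)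
  exact (Deg.map_id A.F n a).symm.trans ((congrArg (fun f => Deg.map A.F f n a) h).trans
    (Deg.map_zero A.F n (show Deg A.F (NLie.zero (k := k) (H := H)).nil.X n from a)))

instance (A : DGA.{w} (GRep k H)) : Subsingleton (Gauge A (NLie.zero (k := k) (H := H)).nil) :=
  ⟨fun _ _ => ExpGroup.ext (Subsingleton.elim _ _)⟩

instance (A : DGA.{w} (GRep k H)) : Subsingleton (MC A (NLie.zero (k := k) (H := H)).nil) :=
  ⟨fun _ _ => Subtype.ext (Subsingleton.elim _ _)⟩

variable {A B : DGA.{w} (GRep k H)} {φ : DGA.Hom A B}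

/-- The lifting property is stable under composition, so only central extensions matter, and there
it is `exists_mc_lift` read modulo gauge. -/
theorem isSmooth_map (hA : A.Flat) (hB : B.Flat) (h1 : ∀ V, φ.CohSurj V 0) (h2 : ∀ V, φ.CohInj V 1) :
    IsSmooth (Def.map φ) := by
  intro M N p hp
  refine NLie.surjective_induction (P := fun {M N} p => ∀ (y : (Def B).obj M) (x : (Def A).obj N),
    (Def B).map p y = (Def.map φ).app N x →
      ∃ z : (Def A).obj M, (Def.map φ).app M z = y ∧ (Def A).map p z = x) ?_ ?_ p hp
  · intro M N p hp hc y x hyx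
    obtain ⟨V, ι, EA, EB⟩ := NLie.exists_centralExt hA hB p hp hc
    obtain ⟨y, rfl⟩ := Quotient.exists_rep y
    obtain ⟨x, rfl⟩ := Quotient.exists_rep x
    obtain ⟨g, hg⟩ := Quotient.exact hyx.symm
    -- The hypothesis matches y and x over N only up to a gauge element. Its lift to M replaces y by
    -- g • y, after which they match exactly.
    obtain ⟨g, rfl⟩ := EB.exists_gauge_lift g
    obtain ⟨z, hz, h, hh⟩ := exists_mc_lift EA EB (h1 V) (h2 V) (g • y) x
      (((LHom.ofHom B ((NLie.toNilFunctor k H).map p)).mc_smul g y).trans hg)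
    refine ⟨Quotient.mk _ z, Quotient.sound ⟨h * g, ?_⟩, congrArg (Quotient.mk _) hz⟩
    exact (mul_smul h g y).trans hh
  · intro M N Q p q ihp ihq y x hyx
    -- The point is lifted through q against the image of y, and the result is lifted through p
    -- against y itself.
    obtain ⟨z', h1, h2⟩ := ihq ((Def B).map p y) x (by rw [← hyx, Functor.map_comp]; rfl)
    obtain ⟨z, h3, h4⟩ := ihp y z' h1.symm
    exact ⟨z, h3, by rw [Functor.map_comp, ← h2, ← h4]; rfl⟩

/-- The property attached to a surjection M → N is the implication from fullness at N to fullness at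
M, which composes. It is applied to N → 0, where the gauge groups and Maurer–Cartan sets are
trivial. -/
theorem fullAt_nil (hA : A.Flat) (hB : B.Flat) (h0 : ∀ V, φ.ZeroSurj V) (h1 : ∀ V, φ.CohInj V 0) (N : NLie k H) :
    φ.FullAt N.nil := by
  refine NLie.surjective_induction (P := fun {M N} _ => φ.FullAt N.nil → φ.FullAt M.nil)
    ?_ ?_ N.toZero N.toZero_surjective ?_
  · intro M N p hp hc hN
    obtain ⟨V, ι, EA, EB⟩ := NLie.exists_centralExt hA hB p hp hc
    exact hN.of_centralExt EA EB (h0 V) (h1 V)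
  · exact fun _ _ hp hq h => hp (hq h)
  · exact fun x x' g _ => ⟨1, Subsingleton.elim _ _, Subsingleton.elim _ _⟩

theorem faithfulAt_nil (hA : A.Flat) (hB : B.Flat) (h0 : ∀ V, φ.ZeroInj V) (N : NLie k H) : φ.FaithfulAt N.nil := by
  refine NLie.surjective_induction
    (P := fun {M N} _ => φ.FaithfulAt N.nil → φ.FaithfulAt M.nil)
    ?_ ?_ N.toZero N.toZero_surjective ?_
  · intro M N p hp hc hN
    obtain ⟨V, ι, EA, EB⟩ := NLie.exists_centralExt hA hB p hp hc
    exact hN.of_centralExt EA EB (h0 V)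
  · exact fun _ _ hp hq h => hp (hq h)
  · exact fun _ _ _ _ _ => Subsingleton.elim _ _

/-- This is smoothness for N → 0: both deformation sets of the zero object consist of one point, so
every y satisfies the compatibility condition. -/
theorem map_app_surjective (hA : A.Flat) (hB : B.Flat) (h1 : ∀ V, φ.CohSurj V 0) (h2 : ∀ V, φ.CohInj V 1) (N : NLie k H) :
    Function.Surjective ((Def.map φ).app N) := by
  intro y
  obtain ⟨z, hz, -⟩ := isSmooth_map hA hB h1 h2 N _ N.toZero N.toZero_surjective y
    (Quotient.mk _ 0) (by
      obtain ⟨y, rfl⟩ := Quotient.exists_rep y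
      exact congrArg (Quotient.mk _) (Subsingleton.elim _ _))
  exact ⟨z, hz⟩

/-- For a flat DGA, `Vε` is a central extension of zero. -/
lemma DGA.Flat.centralExt_eps (hA : A.Flat) (V : GRep k H) :
    A.CentralExt (V := V) (M := V.eps.nil) (𝟙 V)
      ((NLie.toNilFunctor k H).map V.eps.toZero) :=
  hA.centralExt V.eps.toZero V.eps.toZero_surjective (𝟙 V) (fun _ _ h => h)
    (fun v => ⟨fun _ => ⟨v, rfl⟩, fun _ => rfl⟩) (fun _ _ _ => rfl)

/-- The extension Vε → 0 has kernel V itself, so injectivity of H¹ at V is injectivity of the map on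
Def(Vε). -/
theorem isUnramified_map (hA : A.Flat) (hB : B.Flat) (h1 : ∀ V, φ.CohInj V 0) :
    IsUnramified (Def.map φ) :=
  fun V _ => (h1 V).defMap_injective (hA.centralExt_eps V) (hB.centralExt_eps V)

end TwistedDGA
end DeformationInvariance

open TwistedDGA in
theorem mainTheorem11 {k : Type*} [Field k] [CharZero k] {H : Type*} [CommRing H]
    [HopfAlgebra k H] (A B : TwistedDGA.DGA (TwistedDGA.GRep k H)) (hA : A.Flat) (hB : B.Flat)
    (φ : TwistedDGA.DGA.Hom A B) :
    ((∀ V, Function.Bijective ((TwistedDGA.cohomologyMap φ 1).app V)) →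
      (∀ V, Function.Injective ((TwistedDGA.cohomologyMap φ 2).app V)) →
      TwistedDGA.IsEtale (TwistedDGA.Def.map φ)) ∧
    ((∀ V, Function.Bijective ((TwistedDGA.cohomologyMap φ 1).app V)) →
      (∀ V, Function.Injective ((TwistedDGA.cohomologyMap φ 2).app V)) →
      (∀ V, Function.Surjective ((TwistedDGA.cohomologyMap φ 0).app V)) →
      CategoryTheory.IsIso (TwistedDGA.Def.map φ)) ∧
    ((∀ V, Function.Bijective ((TwistedDGA.cohomologyMap φ 1).app V)) →
      (∀ V, Function.Injective ((TwistedDGA.cohomologyMap φ 2).app V)) →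
      (TwistedDGA.IsGrpdEquivalence (TwistedDGA.DefGroupoid.map φ) ↔
        CategoryTheory.IsIso (TwistedDGA.cohomologyMap φ 0))) := by
  refine ⟨fun h1 h2 => ?_, fun h1 h2 h0 => ?_, fun h1 h2 => ?_⟩
  · exact ⟨isSmooth_map hA hB (fun V => φ.cohSurj V (h1 V).2) fun V => φ.cohInj V (h2 V),
      isUnramified_map hA hB fun V => φ.cohInj V (h1 V).1⟩
  · rw [CategoryTheory.NatTrans.isIso_iff_isIso_app]
    intro N
    rw [CategoryTheory.isIso_iff_bijective]
    exact ⟨(fullAt_nil hA hB (fun V => (φ.zeroSurj_iff V).mpr (h0 V))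
      (fun V => φ.cohInj V (h1 V).1) N).defMap_injective,
      map_app_surjective hA hB (fun V => φ.cohSurj V (h1 V).2) (fun V => φ.cohInj V (h2 V)) N⟩
  · rw [isIso_cohomologyMap_zero_iff]
    constructor
    · intro h V
      -- The equivalence is evaluated on Vε, where faithful and full at the trivial deformation mean
      -- that H⁰ is injective and surjective at V.
      have h' : (LHom.ofDGA φ V.eps.nil).grpdMap.IsEquivalence := h V.eps
      exact ⟨((φ.faithfulAt_iff _).mpr h'.faithful).zeroInj (hA.centralExt_eps V),
        ((φ.fullAt_iff _).mpr h'.full).zeroSurj (hA.centralExt_eps V) (hB.centralExt_eps V)⟩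
    · intro h N
      have e1 := (φ.faithfulAt_iff _).mp (faithfulAt_nil hA hB (fun V => (h V).1) N)
      have e2 := (φ.fullAt_iff _).mp (fullAt_nil hA hB (fun V => (h V).2)
        (fun V => φ.cohInj V (h1 V).1) N)
      have e3 := LHom.grpdMap_essSurj (LHom.ofDGA φ N.nil)
        (map_app_surjective hA hB (fun V => φ.cohSurj V (h1 V).2) (fun V => φ.cohInj V (h2 V)) N)
      exact (⟨e1, e2, e3⟩ : (LHom.ofDGA φ N.nil).grpdMap.IsEquivalence)
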